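/- Let $X$ be a complex manifold of dimension $n\ge 2$ (Hausdorff, second countable) with a smooth Hermitian metric, let $J$ be its complex structure and let $\omega$ be the $(1,1)$-form associated to the metric. Let $L\subset X$ be a compact real hypersurface of class $C^3$ (embedded, without boundary) which is Levi flat: for every local defining function $\rho$ of $L$, the form $i\partial\bar\partial\rho$ vanishes on the complex tangent spaces $T_xL\cap JT_xL$, $x\in L$. Then $L$ is foliated by complex hypersurfaces tangent to $TL\cap JTL$ (the Levi foliation). Let $\mathcal N_L^{1,0}$ be the normal bundle to the Levi foliation, that is, the complex line bundle over $L$ with fibres $T_xX/(T_xL\cap JT_xL)$, which is holomorphic along the leaves. Suppose that $\mathcal N_L^{1,0}$ admits a Hermitian metric $h$ of class $C^2$ with leafwise positive curvature: on every leaf and for every local nowhere vanishing holomorphic section $s$ of $\mathcal N_L^{1,0}$ along the leaf, the curvature form $-i\partial\bar\partial\ln\|s\|_h^2$ is a positive $(1,1)$-form on the leaf. Then there exist an open neighborhood $U$ of $L$, a constant $c>0$ and a function $v\in C^2(U)$ with $v=0$ on $L$ and $v>0$ on $U\setminus L$, such that $$-i\partial\bar\partial\ln v\ \ge\ c\,\omega\quad\text{on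 } U\setminus L .$$ Moreover, $U$ and $v$ can be chosen so that there is a continuous nowhere vanishing function $g$ on $U$ with $v=g\,\delta^2$ on $U$, where $\delta$ is the geodesic distance to $L$. -/

import Mathlib

open Set Topology Bundle
open scoped Manifold ContDiff

noncomputable section

/-- The model space `ℂⁿ`. -/
abbrev Cn (n : ℕ) : Type := EuclideanSpace ℂ (Fin n)

/-- A complex manifold, modelled on `ℂⁿ` with holomorphic transition maps, is in particular a real
manifold with the same charts. -/
instance isManifold_real_of_complex {n : ℕ} {X : Type*} [TopologicalSpace X]
    [ChartedSpace (Cn n) X] [IsManifold 𝓘(ℂ, Cn n) ω X] : IsManifold 𝓘(ℝ, Cn n) ω X := by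
  refine isManifold_of_contDiffOn 𝓘(ℝ, Cn n) ω X fun e e' he he' => ?_
  have h := (contDiffGroupoid ω 𝓘(ℂ, Cn n)).compatible he he'
  rw [contDiffGroupoid, mem_groupoid_of_pregroupoid] at h
  have h1 : ContDiffOn ℂ ω (𝓘(ℂ, Cn n) ∘ (e.symm.trans e') ∘ 𝓘(ℂ, Cn n).symm)
      (𝓘(ℂ, Cn n).symm ⁻¹' (e.symm.trans e').source ∩ range 𝓘(ℂ, Cn n)) := h.1
  exact h1.restrict_scalars ℝ

/-- The complex structure `J` on the tangent spaces of a complex manifold: multiplication by `i`.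
(The tangent space at `x` is `ℂⁿ`, read in the preferred chart at `x`.) -/
def almostJ {n : ℕ} {X : Type*} [TopologicalSpace X] [ChartedSpace (Cn n) X] {x : X}
    (u : TangentSpace 𝓘(ℝ, Cn n) x) : TangentSpace 𝓘(ℝ, Cn n) x :=
  show Cn n from Complex.I • (show Cn n from u)

/-- The differential `df` at `x` of a real function on `X`, evaluated at the tangent vector `u`. -/
def realDiff {n : ℕ} {X : Type*} [TopologicalSpace X] [ChartedSpace (Cn n) X]
    (f : X → ℝ) (x : X) (u : TangentSpace 𝓘(ℝ, Cn n) x) : ℝ :=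
  mfderiv 𝓘(ℝ, Cn n) 𝓘(ℝ, ℝ) f x u

/-- The second derivative of a real function on `X`, computed in the preferred chart at `x`. -/
def chartHessian {n : ℕ} {X : Type*} [TopologicalSpace X] [ChartedSpace (Cn n) X]
    (f : X → ℝ) (x : X) (u w : TangentSpace 𝓘(ℝ, Cn n) x) : ℝ :=
  fderiv ℝ (fderiv ℝ (f ∘ (chartAt (Cn n) x).symm)) (chartAt (Cn n) x x)
    (show Cn n from u) (show Cn n from w)

/-- The real `(1,1)`-form `i∂∂̄f` at `x`, as an alternating form in two real tangent vectors:
`(i ∑ f_{jk̄} dz_j ∧ dz̄_k)(u, w) = (D²f(Ju, w) - D²f(u, Jw)) / 2`. In particular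
`(i∂∂̄f)(u, Ju) = (D²f(u, u) + D²f(Ju, Ju)) / 2 = 2 ∑ f_{jk̄} u_j ū_k`. The second derivatives depend
on the chart, this combination of them does not. -/
def iddbar {n : ℕ} {X : Type*} [TopologicalSpace X] [ChartedSpace (Cn n) X]
    (f : X → ℝ) (x : X) (u w : TangentSpace 𝓘(ℝ, Cn n) x) : ℝ :=
  (chartHessian f x (almostJ u) w - chartHessian f x u (almostJ w)) / 2

/-! ### Real hypersurfaces, the Levi form -/

/-- `ρ` is a defining function of class `C^k` of `L` on the open set `V`. -/
structure IsDefiningFunction {n : ℕ} {X : Type*} [TopologicalSpace X] [ChartedSpace (Cn n) X]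
    (k : ℕ) (L V : Set X) (ρ : X → ℝ) : Prop where
  isOpen : IsOpen V
  contMDiffOn : ContMDiffOn 𝓘(ℝ, Cn n) 𝓘(ℝ, ℝ) k ρ V
  mem_iff : ∀ x ∈ V, x ∈ L ↔ ρ x = 0
  diff_ne_zero : ∀ x ∈ L ∩ V, ∃ u : TangentSpace 𝓘(ℝ, Cn n) x, realDiff ρ x u ≠ 0

/-- `L` is an (embedded, boundaryless) real hypersurface of class `C^k` in `X`. -/
def IsRealHypersurface (n : ℕ) {X : Type*} [TopologicalSpace X] [ChartedSpace (Cn n) X]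
    (k : ℕ) (L : Set X) : Prop :=
  ∀ p ∈ L, ∃ (V : Set X) (ρ : X → ℝ), p ∈ V ∧ IsDefiningFunction (n := n) k L V ρ

/-- The complex tangent space `T_xL ∩ J T_xL` of a real hypersurface at a point `x` of `L`:
the tangent vectors `u` with `dρ(u) = dρ(Ju) = 0`. The defining function does not matter, and the
definition lets it vary. For Levi flat `L` these are the tangent spaces of the leaves of the Levi
foliation. -/
def complexTangent {n : ℕ} {X : Type*} [TopologicalSpace X] [ChartedSpace (Cn n) X]
    (L : Set X) (x : X) : Submodule ℂ (Cn n) where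
  carrier := {u | ∀ (V : Set X) (ρ : X → ℝ), IsDefiningFunction (n := n) 2 L V ρ → x ∈ V →
    realDiff ρ x u = 0 ∧ realDiff (n := n) ρ x (almostJ (n := n) (x := x) u) = 0}
  zero_mem' := by
    intro V ρ _ _
    have h : almostJ (n := n) (x := x) (0 : Cn n) = (0 : Cn n) := by
      change Complex.I • (0 : Cn n) = 0
      simp
    rw [h]
    exact ⟨map_zero (mfderiv 𝓘(ℝ, Cn n) 𝓘(ℝ, ℝ) ρ x), map_zero (mfderiv 𝓘(ℝ, Cn n) 𝓘(ℝ, ℝ) ρ x)⟩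
  add_mem' := by
    intro a b ha hb V ρ hρ hx
    obtain ⟨ha1, ha2⟩ := ha V ρ hρ hx
    obtain ⟨hb1, hb2⟩ := hb V ρ hρ hx
    have hadd : ∀ u w : Cn n, realDiff (n := n) ρ x (u + w : Cn n)
        = realDiff (n := n) ρ x u + realDiff (n := n) ρ x w :=
      fun u w => map_add (mfderiv 𝓘(ℝ, Cn n) 𝓘(ℝ, ℝ) ρ x) u w
    have h : almostJ (n := n) (x := x) (a + b : Cn n)
        = ((Complex.I • a + Complex.I • b : Cn n)) := smul_add Complex.I a b
    refine ⟨by rw [hadd, ha1, hb1, add_zero], ?_⟩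
    rw [h, hadd]
    exact (congrArg₂ (· + ·) ha2 hb2).trans (add_zero 0)
  smul_mem' := by
    intro c a ha V ρ hρ hx
    obtain ⟨ha1, ha2⟩ := ha V ρ hρ hx
    have hlin : ∀ (r s : ℝ) (u w : Cn n), realDiff (n := n) ρ x (r • u + s • w : Cn n)
        = r * realDiff (n := n) ρ x u + s * realDiff (n := n) ρ x w := by
      intro r s u w
      have h1 := map_add (mfderiv 𝓘(ℝ, Cn n) 𝓘(ℝ, ℝ) ρ x) (r • u : Cn n) (s • w : Cn n)
      have h2 := map_smul (mfderiv 𝓘(ℝ, Cn n) 𝓘(ℝ, ℝ) ρ x) r u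
      have h3 := map_smul (mfderiv 𝓘(ℝ, Cn n) 𝓘(ℝ, ℝ) ρ x) s w
      exact h1.trans (congrArg₂ (· + ·) h2 h3)
    have hc1 : (c • a : Cn n) = c.re • a + c.im • (Complex.I • a) := by
      ext i
      simp only [PiLp.smul_apply, PiLp.add_apply, smul_eq_mul, Complex.real_smul]
      conv_lhs => rw [← Complex.re_add_im c]
      ring
    have hc2 : Complex.I • (c • a : Cn n) = (-c.im) • a + c.re • (Complex.I • a) := by
      ext i
      simp only [PiLp.smul_apply, PiLp.add_apply, smul_eq_mul, Complex.real_smul]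
      conv_lhs => rw [← Complex.re_add_im c]
      push_cast
      linear_combination (c.im : ℂ) * a i * Complex.I_mul_I
    have ha3 : realDiff (n := n) ρ x (Complex.I • a : Cn n) = 0 := ha2
    constructor
    · rw [hc1, hlin, ha1, ha3, mul_zero, mul_zero, add_zero]
    · change realDiff (n := n) ρ x (Complex.I • (c • a) : Cn n) = 0
      rw [hc2, hlin, ha1, ha3, mul_zero, mul_zero, add_zero]

/-- A real hypersurface is Levi flat if its Levi form vanishes: for each local defining function
`ρ`, the form `i∂∂̄ρ` vanishes on the complex tangent spaces of `L`. -/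
def IsLeviFlat (n : ℕ) {X : Type*} [TopologicalSpace X] [ChartedSpace (Cn n) X]
    (L : Set X) : Prop :=
  ∀ (V : Set X) (ρ : X → ℝ), IsDefiningFunction (n := n) 2 L V ρ →
    ∀ x ∈ L ∩ V, ∀ u : TangentSpace 𝓘(ℝ, Cn n) x,
      realDiff ρ x u = 0 → realDiff ρ x (almostJ u) = 0 → iddbar ρ x u (almostJ u) = 0

/-! ### The normal bundle to the Levi foliation and its Hermitian metrics -/

/-- The fibre at `x` of the normal bundle to the Levi foliation: the complex line
`T_xX / (T_xL ∩ J T_xL)`. -/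
abbrev LeviNormal {n : ℕ} {X : Type*} [TopologicalSpace X] [ChartedSpace (Cn n) X]
    (L : Set X) (x : X) : Type :=
  Cn n ⧸ complexTangent (n := n) L x

/-- A Hermitian metric of class `C²` on the normal bundle to the Levi foliation of `L`: a Hermitian
inner product on each fibre over `L`, such that for every vector field `Y` of class `C²` on an open
subset `W` of `X` the squared length of the class of `Y` is a `C²` function on `L ∩ W`, that is,
locally the restriction to `L` of a `C²` function on an open subset of `X`. -/
structure LeviNormalMetric (n : ℕ) {X : Type*} [TopologicalSpace X] [ChartedSpace (Cn n) X]
    [IsManifold 𝓘(ℂ, Cn n) ω X] (L : Set X) where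
  core : ∀ x : L, InnerProductSpace.Core ℂ (LeviNormal (n := n) L (x : X))
  contMDiff : ∀ (W : Set X), IsOpen W → ∀ Y : (x : X) → TangentSpace 𝓘(ℝ, Cn n) x,
    ContMDiffOn 𝓘(ℝ, Cn n) 𝓘(ℝ, Cn n).tangent 2
      (fun x => (⟨x, Y x⟩ : TangentBundle 𝓘(ℝ, Cn n) X)) W →
    ∀ p ∈ L ∩ W, ∃ (W' : Set X) (f : X → ℝ), IsOpen W' ∧ p ∈ W' ∧ W' ⊆ W ∧
      ContMDiffOn 𝓘(ℝ, Cn n) 𝓘(ℝ, ℝ) 2 f W' ∧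
      ∀ x : L, (x : X) ∈ W' → f x =
        ((core x).inner (Submodule.Quotient.mk (show Cn n from Y x))
          (Submodule.Quotient.mk (show Cn n from Y x))).re

open Classical in
/-- The squared length, for the metric `h` on the normal bundle, of the class of the tangent vector
`V` to `X` (only used when the base point of `V` lies on `L`; it is `0` by convention otherwise). -/
def LeviNormalMetric.normSq {n : ℕ} {X : Type*} [TopologicalSpace X] [ChartedSpace (Cn n) X]
    [IsManifold 𝓘(ℂ, Cn n) ω X] {L : Set X} (h : LeviNormalMetric n L)
    (V : TangentBundle 𝓘(ℂ, Cn n) X) : ℝ :=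
  if hV : V.proj ∈ L then
    ((h.core ⟨V.proj, hV⟩).inner (Submodule.Quotient.mk (show Cn n from V.snd))
      (Submodule.Quotient.mk (show Cn n from V.snd))).re
  else 0

/-- A local holomorphic frame of the normal bundle along a piece of a leaf of the Levi foliation.
`Y` is a holomorphic family, over the open set `B ⊆ ℂⁿ⁻¹`, of tangent vectors to `X`. Its base point
`b ↦ (Y b).proj` is a holomorphic immersion with values in `L`, so it parametrizes an open piece
of a leaf. The vector `Y b` is not tangent to the leaf, so `b ↦ [Y b]` is a nowhere vanishing
holomorphic section of the normal bundle along this piece of a leaf. -/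
structure IsLeafFrame {n : ℕ} {X : Type*} [TopologicalSpace X] [ChartedSpace (Cn n) X]
    [IsManifold 𝓘(ℂ, Cn n) ω X] (L : Set X) (B : Set (Cn (n - 1)))
    (Y : Cn (n - 1) → TangentBundle 𝓘(ℂ, Cn n) X) : Prop where
  isOpen : IsOpen B
  holomorphic : ContMDiffOn 𝓘(ℂ, Cn (n - 1)) 𝓘(ℂ, Cn n).tangent ω Y B
  mem : ∀ b ∈ B, (Y b).proj ∈ L
  immersion : ∀ b ∈ B, Function.Injective
    (mfderiv 𝓘(ℂ, Cn (n - 1)) 𝓘(ℂ, Cn n) (fun b' => (Y b').proj) b)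
  transverse : ∀ b ∈ B, (show Cn n from (Y b).snd) ∉ complexTangent (n := n) L (Y b).proj

/-- The metric `h` has leafwise positive curvature: on each leaf, in a holomorphic frame `s`
of the normal bundle, its curvature form `-i∂∂̄ log ‖s‖²` is a positive `(1,1)`-form. -/
def LeviNormalMetric.IsLeafwisePositive {n : ℕ} {X : Type*} [TopologicalSpace X]
    [ChartedSpace (Cn n) X] [IsManifold 𝓘(ℂ, Cn n) ω X] {L : Set X}
    (h : LeviNormalMetric n L) : Prop :=
  ∀ (B : Set (Cn (n - 1))) (Y : Cn (n - 1) → TangentBundle 𝓘(ℂ, Cn n) X),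
    IsLeafFrame L B Y → ∀ b ∈ B, ∀ ζ : TangentSpace 𝓘(ℝ, Cn (n - 1)) b, ζ ≠ 0 →
      0 < - iddbar (n := n - 1) (fun b' => Real.log (h.normSq (Y b'))) b ζ (almostJ ζ)

/-! ### Hermitian metrics on the manifold -/

/-- The Riemannian metric on `X` is Hermitian: `J` is an isometry. -/
def IsHermitianMetric (n : ℕ) (X : Type*) [TopologicalSpace X] [ChartedSpace (Cn n) X]
    [RiemannianBundle (fun x : X => TangentSpace 𝓘(ℝ, Cn n) x)] : Prop :=
  ∀ (x : X) (u w : TangentSpace 𝓘(ℝ, Cn n) x), inner ℝ (almostJ u) (almostJ w) = inner ℝ u w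

/-- The `(1,1)`-form associated to the Hermitian metric, `(u, w) ↦ ⟨Ju, w⟩`. -/
def fundamentalForm {n : ℕ} {X : Type*} [TopologicalSpace X] [ChartedSpace (Cn n) X]
    [RiemannianBundle (fun x : X => TangentSpace 𝓘(ℝ, Cn n) x)]
    (x : X) (u w : TangentSpace 𝓘(ℝ, Cn n) x) : ℝ :=
  inner ℝ (almostJ u) w

/-- The geodesic distance to `L`: the infimum of the lengths of `C¹` paths from `x` to points
of `L`. -/
def geodesicDist (n : ℕ) {X : Type*} [TopologicalSpace X] [ChartedSpace (Cn n) X]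
    [RiemannianBundle (fun x : X => TangentSpace 𝓘(ℝ, Cn n) x)] (L : Set X) (x : X) : ℝ :=
  (⨅ y ∈ L, Manifold.riemannianEDist 𝓘(ℝ, Cn n) x y).toReal

end

/-!
Locally `L` is the zero set of a function `ρ` of class `C³`. The function `R`, locally `|ρ|`, is
defined globally even if `L` is not co-oriented (`exists_isAbsDefiningFunction`). The `(1,0)`-form
`2∂ρ` has the complex tangent space of `L` as its kernel, so on the normal bundle, whose fibres
are complex lines, the given metric is `G |2∂ρ|²` with a positive function `G`, which extends to a
positive function of class `C²` on `X` (`LeviNormalMetric.exists_factor`). The required function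
is `v = G R²`.

*Curvature.* If `e` is a constant vector in a chart, transverse to the complex tangent space, then
`[e]` is a holomorphic section of the normal bundle along the leaves, of squared length
`G |2∂ρ(e)|²`. Leafwise positivity therefore says that the complex Hessian of
`log G + log |2∂ρ(e)|²` is negative on the complex tangent spaces of `L`
(`leviH_neg_of_isLeafwisePositive`). To use the hypothesis, one needs the leaves. The projection
to the complex tangent space along `e` turns the problem into a total differential equation, which
is integrable along `L` because `L` is Levi flat (`fderiv_leviProj_comm`). It is solved by
integrating along rays (`exists_hasFDerivAt_of_integrable`). The solution is complex
differentiable, hence analytic (`analyticOnNhd_of_differentiableOn_complex`), which gives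
`exists_leaf`.

*Positivity off `L`.* At a point `x` near `L`, decompose a vector as `u + ρ s N` with `u` in the
kernel of `2∂ρ` and `2∂ρ(N) = 1`. The Levi form of `-log (G ρ²)` is then the sum of `-H(log G)`,
of `-2 H(ρ)(u) / ρ`, and of a quadratic polynomial in `s`. Completing the square in `s` leaves
`-2 |m|²`, where `m` is the mixed component of the Hessian of `ρ` (`neg_leviH_add_log`). Since `L`
is Levi flat, `H(ρ)(u)` vanishes on `L`, and its quotient by `ρ` tends to its normal derivative
(`HasStrictFDerivAt.sub_smul_isLittleO`). By third order calculus, twice this derivative plus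
`2 |m|²` is exactly the Levi form of `log |2∂ρ(e)|²` (`leviH_log_normSq_twoDel`), so the limit of
the lower bound is the leafwise curvature, which is positive. In transverse directions the term
`|2∂ρ(U)|² / ρ²` dominates. Compactness of the unit sphere and of `L` gives a uniform constant
(`exists_eventually_mul_norm_sq_le_neg_leviH`, `exists_eventually_le_neg_iddbar`).

*Distance.* Near a point `p` of `L`, the quotient of `|ρ|` by the distance to `L` tends to the
norm of `dρ` at `p` (`IsAbsDefiningFunction.tendsto_div_geodesicDist`): a path cannot decrease
`|ρ|` faster than this norm permits, and a segment in a chart in the direction of steepest descent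
attains it up to a factor close to `1`. So `v / δ²` extends continuously, with positive values on
`L`.
-/

noncomputable section

set_option linter.unusedSectionVars false

/-! ### Level sets of strictly differentiable functions -/

section LevelSets

open Filter Asymptotics

variable {E W : Type*} [NormedAddCommGroup E] [NormedSpace ℝ E]
  [NormedAddCommGroup W] [NormedSpace ℝ W]

/-- The intermediate value theorem on the segment from `x` to `x - 2 ρ(x) ν`. -/
theorem HasStrictFDerivAt.eventually_exists_zero_of_nonneg {ρ : E → ℝ} {ρ' : E →L[ℝ] ℝ}
    {x₀ ν : E} (hρ : HasStrictFDerivAt ρ ρ' x₀) (h₀ : ρ x₀ = 0) (hν : ρ' ν = 1) :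
    ∀ᶠ x in 𝓝 x₀, 0 ≤ ρ x → ∃ t : ℝ, |t| ≤ 2 * |ρ x| ∧ ρ (x - t • ν) = 0 := by
  obtain ⟨K, s, hs, hK⟩ := hρ.exists_lipschitzOnWith
  -- with this error constant, `ρ` decreases along `ν` at least at half the speed of `ρ'`
  set c : ℝ := 1 / (2 * (‖ν‖ + 1)) with hc
  have hc0 : 0 < c := by positivity
  have hcν : c * ‖ν‖ ≤ 1 / 2 := by
    rw [hc, div_mul_eq_mul_div, one_mul, div_le_iff₀ (by positivity)]
    nlinarith [norm_nonneg ν]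
  have hst := hρ.isLittleO.def hc0
  rw [nhds_prod_eq] at hst
  obtain ⟨u, hu, hut⟩ := mem_prod_self_iff.1 hst
  have hust : ∀ y ∈ u, ∀ z ∈ u, _ := fun y hy z hz => hut (mk_mem_prod hy hz)
  simp only [mem_ofPred_eq] at hust
  obtain ⟨ε, hε, hball⟩ := Metric.mem_nhds_iff.1 (inter_mem hs hu)
  have hcont : Tendsto (fun x => ‖x - x₀‖ + 2 * |ρ x| * ‖ν‖) (𝓝 x₀) (𝓝 0) := by
    have h1 : ContinuousAt ρ x₀ := hρ.continuousAt
    have h2 : ContinuousAt (fun x => ‖x - x₀‖ + 2 * |ρ x| * ‖ν‖) x₀ := by fun_prop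
    have h3 := h2.tendsto
    simpa [h₀] using h3
  filter_upwards [hcont (gt_mem_nhds hε)] with x hx hx0
  have hx' : ‖x - x₀‖ + 2 * |ρ x| * ‖ν‖ < ε := hx
  have hmem : ∀ t ∈ Icc (0 : ℝ) (2 * ρ x), x - t • ν ∈ s ∩ u := by
    intro t ht
    apply hball
    rw [Metric.mem_ball, dist_eq_norm]
    calc ‖x - t • ν - x₀‖ = ‖(x - x₀) - t • ν‖ := by congr 1; abel
      _ ≤ ‖x - x₀‖ + ‖t • ν‖ := norm_sub_le _ _
      _ ≤ ‖x - x₀‖ + 2 * |ρ x| * ‖ν‖ := by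
        rw [norm_smul, Real.norm_eq_abs, abs_of_nonneg ht.1, abs_of_nonneg hx0]
        gcongr
        exact ht.2
      _ < ε := hx'
  have hx2 : (0 : ℝ) ≤ 2 * ρ x := by linarith
  have hcts : ContinuousOn (fun t : ℝ => ρ (x - t • ν)) (Icc 0 (2 * ρ x)) := by
    refine hK.continuousOn.comp (by fun_prop) fun t ht => (hmem t ht).1
  have hend : ρ (x - (2 * ρ x) • ν) ≤ 0 := by
    have h := hust x (by simpa using (hmem 0 ⟨le_rfl, hx2⟩).2) (x - (2 * ρ x) • ν)
      (hmem _ ⟨hx2, le_rfl⟩).2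
    have h2 : x - (x - (2 * ρ x) • ν) = (2 * ρ x) • ν := by abel
    simp only [h2, map_smul, hν, smul_eq_mul, mul_one, norm_smul, Real.norm_eq_abs,
      abs_of_nonneg hx2] at h
    have h3 : c * (2 * ρ x * ‖ν‖) ≤ ρ x := by nlinarith
    have h4 := (abs_le.1 (h.trans h3)).1
    linarith
  obtain ⟨t, ht, htz⟩ := intermediate_value_Icc' hx2 hcts
    (show (0 : ℝ) ∈ Icc _ _ from ⟨hend, by simpa using hx0⟩)
  exact ⟨t, by rw [abs_of_nonneg ht.1, abs_of_nonneg hx0]; exact ht.2, htz⟩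

/-- Near a point of a regular level set, the level set can be reached along a fixed transverse
direction, at a distance controlled by the value of the function. -/
theorem HasStrictFDerivAt.eventually_exists_zero {ρ : E → ℝ} {ρ' : E →L[ℝ] ℝ}
    {x₀ ν : E} (hρ : HasStrictFDerivAt ρ ρ' x₀) (h₀ : ρ x₀ = 0) (hν : ρ' ν = 1) :
    ∀ᶠ x in 𝓝 x₀, ∃ t : ℝ, |t| ≤ 2 * |ρ x| ∧ ρ (x - t • ν) = 0 := by
  have h1 := hρ.eventually_exists_zero_of_nonneg h₀ hν
  have h2 := hρ.neg.eventually_exists_zero_of_nonneg (ν := -ν) (by simp [h₀]) (by simp [hν])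
  filter_upwards [h1, h2] with x hx1 hx2
  rcases le_total 0 (ρ x) with h | h
  · exact hx1 h
  · obtain ⟨t, ht, htz⟩ := hx2 (by simpa using h)
    refine ⟨-t, by simpa using ht, ?_⟩
    simpa using htz

/-- First order division: a strictly differentiable function vanishing on a regular level set
`{ρ = 0}` is, to first order in `ρ`, a multiple of `ρ`. -/
theorem HasStrictFDerivAt.sub_smul_isLittleO {F : E → W} {F' : E →L[ℝ] W} {ρ : E → ℝ}
    {ρ' : E →L[ℝ] ℝ} {x₀ ν : E} (hF : HasStrictFDerivAt F F' x₀)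
    (hρ : HasStrictFDerivAt ρ ρ' x₀) (h₀ : ρ x₀ = 0) (hν : ρ' ν = 1)
    (hz : ∀ᶠ x in 𝓝 x₀, ρ x = 0 → F x = 0) :
    (fun x => F x - ρ x • F' ν) =o[𝓝 x₀] ρ := by
  set F₁ : E → W := fun x => F x - ρ x • F' ν with hF₁
  have hd : HasStrictFDerivAt F₁ (F' - ρ'.smulRight (F' ν)) x₀ :=
    hF.sub (hρ.smul_const (F' ν))
  rw [isLittleO_iff]
  intro ε hε
  set c : ℝ := ε / (2 * (‖ν‖ + 1)) with hc
  have hc0 : 0 < c := by positivity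
  have hcν : c * (2 * ‖ν‖) ≤ ε := by
    rw [hc, div_mul_eq_mul_div, div_le_iff₀ (by positivity)]
    nlinarith [norm_nonneg ν]
  have hst := hd.isLittleO.def hc0
  rw [nhds_prod_eq] at hst
  obtain ⟨u, hu, hut⟩ := mem_prod_self_iff.1 hst
  have hust : ∀ y ∈ u, ∀ z ∈ u, _ := fun y hy z hz => hut (mk_mem_prod hy hz)
  simp only [mem_ofPred_eq] at hust
  obtain ⟨r, hr, hball⟩ := Metric.mem_nhds_iff.1 (inter_mem hz hu)
  have hcont : Tendsto (fun x => ‖x - x₀‖ + 2 * |ρ x| * ‖ν‖) (𝓝 x₀) (𝓝 0) := by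
    have h1 : ContinuousAt ρ x₀ := hρ.continuousAt
    have h2 : ContinuousAt (fun x => ‖x - x₀‖ + 2 * |ρ x| * ‖ν‖) x₀ := by fun_prop
    simpa [h₀] using h2.tendsto
  filter_upwards [hρ.eventually_exists_zero h₀ hν, hcont (gt_mem_nhds hr)]
    with x ⟨t, ht, htz⟩ hx
  have hx' : ‖x - x₀‖ + 2 * |ρ x| * ‖ν‖ < r := hx
  have hmem : ∀ s : ℝ, |s| ≤ 2 * |ρ x| → x - s • ν ∈ {x | ρ x = 0 → F x = 0} ∩ u := by
    intro s hs
    apply hball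
    rw [Metric.mem_ball, dist_eq_norm]
    calc ‖x - s • ν - x₀‖ = ‖(x - x₀) - s • ν‖ := by congr 1; abel
      _ ≤ ‖x - x₀‖ + ‖s • ν‖ := norm_sub_le _ _
      _ ≤ ‖x - x₀‖ + 2 * |ρ x| * ‖ν‖ := by
        rw [norm_smul, Real.norm_eq_abs]
        gcongr
      _ < r := hx'
  have h := hust x (by simpa using (hmem 0 (by simp)).2) _ (hmem t ht).2
  have h1 : F₁ (x - t • ν) = 0 := by
    simp [hF₁, htz, (hmem t ht).1 htz]
  have h2 : x - (x - t • ν) = t • ν := by abel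
  simp only [h1, h2, map_smul, sub_zero, sub_apply,
    ContinuousLinearMap.smulRight_apply, hν, one_smul, sub_self, smul_zero, norm_smul] at h
  refine h.trans ?_
  rw [Real.norm_eq_abs, Real.norm_eq_abs]
  calc c * (|t| * ‖ν‖) ≤ c * (2 * |ρ x| * ‖ν‖) := by gcongr
    _ = c * (2 * ‖ν‖) * |ρ x| := by ring
    _ ≤ ε * |ρ x| := by gcongr

/-- The derivative of a function vanishing on a regular level set is a multiple of that of the
defining function. -/
theorem HasStrictFDerivAt.eq_smulRight_of_zero_on_levelSet {F : E → W} {F' : E →L[ℝ] W}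
    {ρ : E → ℝ} {ρ' : E →L[ℝ] ℝ} {x₀ ν : E} (hF : HasStrictFDerivAt F F' x₀)
    (hρ : HasStrictFDerivAt ρ ρ' x₀) (h₀ : ρ x₀ = 0) (hν : ρ' ν = 1)
    (hz : ∀ᶠ x in 𝓝 x₀, ρ x = 0 → F x = 0) : F' = ρ'.smulRight (F' ν) := by
  have h1 := hF.sub_smul_isLittleO hρ h₀ hν hz
  have h2 : ρ =O[𝓝 x₀] fun x => x - x₀ := by
    simpa [h₀] using hρ.hasFDerivAt.isBigO_sub
  have hF0 : F x₀ = 0 := hz.self_of_nhds h₀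
  have h3 : HasFDerivAt (fun x => F x - ρ x • F' ν) (0 : E →L[ℝ] W) x₀ := by
    refine .of_isLittleO ?_
    simpa [h₀, hF0] using h1.trans_isBigO h2
  have h4 := h3.unique (hF.hasFDerivAt.sub (hρ.hasFDerivAt.smul_const (F' ν)))
  exact (sub_eq_zero.1 h4.symm)

end LevelSets

/-! ### The complex Hessian of a real function -/

section ComplexHessian

open Filter

variable {E F : Type*} [NormedAddCommGroup E] [NormedSpace ℂ E] [NormedSpace ℝ E]
  [IsScalarTower ℝ ℂ E] [NormedAddCommGroup F] [NormedSpace ℂ F] [NormedSpace ℝ F]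
  [IsScalarTower ℝ ℂ F]

/-- The symmetric `J`-invariant part `D²f(u, w) + D²f(iu, iw)` of the second derivative. -/
def leviB (f : E → ℝ) (x u w : E) : ℝ :=
  fderiv ℝ (fderiv ℝ f) x u w + fderiv ℝ (fderiv ℝ f) x (Complex.I • u) (Complex.I • w)

/-- The Levi form `D²f(u, u) + D²f(iu, iu) = 4 ∑ f_{jk̄} u_j ū_k`, which is twice
`i∂∂̄f(u, iu)`. -/
def leviH (f : E → ℝ) (x u : E) : ℝ := leviB f x u u

/-- The `(1,0)`-form `2∂f`, that is, `df(u) - i df(iu)`. -/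
def twoDel (f : E → ℝ) (x u : E) : ℂ :=
  (fderiv ℝ f x u : ℂ) - Complex.I * (fderiv ℝ f x (Complex.I • u) : ℂ)

theorem twoDel_re (f : E → ℝ) (x u : E) : (twoDel f x u).re = fderiv ℝ f x u := by
  simp [twoDel]

theorem twoDel_im (f : E → ℝ) (x u : E) :
    (twoDel f x u).im = - fderiv ℝ f x (Complex.I • u) := by
  simp [twoDel]

theorem twoDel_normSq (f : E → ℝ) (x u : E) :
    Complex.normSq (twoDel f x u) = fderiv ℝ f x u ^ 2 + fderiv ℝ f x (Complex.I • u) ^ 2 := by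
  rw [Complex.normSq_apply, twoDel_re, twoDel_im]; ring

omit [NormedSpace ℝ E] [IsScalarTower ℝ ℂ E] in
theorem I_smul_I_smul (u : E) : Complex.I • Complex.I • u = -u := by
  rw [smul_smul, Complex.I_mul_I, neg_one_smul]

theorem complex_smul_eq (c : ℂ) (u : E) : c • u = c.re • u + c.im • Complex.I • u := by
  conv_lhs => rw [← Complex.re_add_im c]
  rw [add_smul, mul_smul]
  congr 1
  · rw [← algebraMap_smul ℂ c.re u]; rfl
  · rw [← algebraMap_smul ℂ c.im (Complex.I • u)]; rfl

theorem twoDel_add (f : E → ℝ) (x u w : E) :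
    twoDel f x (u + w) = twoDel f x u + twoDel f x w := by
  simp only [twoDel, smul_add, map_add]; push_cast; ring

theorem twoDel_smul (f : E → ℝ) (x : E) (c : ℂ) (u : E) :
    twoDel f x (c • u) = c * twoDel f x u := by
  have h : Complex.I • c • u = c.re • Complex.I • u - c.im • u := by
    rw [complex_smul_eq c u, smul_add, smul_comm Complex.I c.im, I_smul_I_smul, smul_neg,
      sub_eq_add_neg, smul_comm Complex.I c.re]
  simp only [twoDel, h]
  rw [complex_smul_eq c u]
  simp only [map_add, map_sub, map_smul, smul_eq_mul]
  push_cast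
  conv_rhs => rw [← Complex.re_add_im c]
  linear_combination ((c.im : ℂ) * (fderiv ℝ f x (Complex.I • u) : ℂ)) * Complex.I_sq

/-- `2∂f` at `x` as a complex linear form. -/
def twoDelₗ (f : E → ℝ) (x : E) : E →ₗ[ℂ] ℂ where
  toFun := twoDel f x
  map_add' := twoDel_add f x
  map_smul' c u := by simpa using twoDel_smul f x c u

theorem leviB_comm {f : E → ℝ} {x : E} (hf : ContDiffAt ℝ 2 f x) (u w : E) :
    leviB f x u w = leviB f x w u := by
  have h : IsSymmSndFDerivAt ℝ f x := hf.isSymmSndFDerivAt (by simp)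
  rw [leviB, leviB, h.eq, h.eq (Complex.I • u)]

theorem leviB_add_left (f : E → ℝ) (x u u' w : E) :
    leviB f x (u + u') w = leviB f x u w + leviB f x u' w := by
  simp [leviB]; ring

theorem leviB_add_right (f : E → ℝ) (x u w w' : E) :
    leviB f x u (w + w') = leviB f x u w + leviB f x u w' := by
  simp [leviB]; ring

theorem leviB_smul_right (f : E → ℝ) (x u w : E) (c : ℝ) :
    leviB f x u (c • w) = c * leviB f x u w := by
  simp [leviB, smul_comm Complex.I c]; ring

theorem leviB_smul_left (f : E → ℝ) (x u w : E) (c : ℝ) :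
    leviB f x (c • u) w = c * leviB f x u w := by
  simp [leviB, smul_comm Complex.I c]; ring

theorem leviB_I_I (f : E → ℝ) (x u w : E) :
    leviB f x (Complex.I • u) (Complex.I • w) = leviB f x u w := by
  simp [leviB, I_smul_I_smul]; ring

theorem leviH_smul {f : E → ℝ} {x : E} (hf : ContDiffAt ℝ 2 f x) (c : ℂ) (u : E) :
    leviH f x (c • u) = Complex.normSq c * leviH f x u := by
  have h1 : leviB f x u (Complex.I • u) = 0 := by
    have h := leviB_comm hf u (Complex.I • u)
    rw [← leviB_I_I f x (Complex.I • u) u, I_smul_I_smul] at h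
    have h2 := leviB_smul_left f x u (Complex.I • u) (-1)
    rw [neg_one_smul] at h2
    linarith
  have h2 : leviB f x (Complex.I • u) u = 0 := by rw [leviB_comm hf, h1]
  rw [leviH, complex_smul_eq, leviB_add_left, leviB_add_right, leviB_add_right]
  simp only [leviB_smul_left, leviB_smul_right, h1, h2, leviB_I_I]
  rw [Complex.normSq_apply, leviH]; ring

theorem leviH_add_smul {f : E → ℝ} {x : E} (hf : ContDiffAt ℝ 2 f x) (u n : E) (c : ℝ) :
    leviH f x (u + c • n) = leviH f x u + 2 * c * leviB f x u n + c ^ 2 * leviH f x n := by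
  simp only [leviH, leviB_add_left, leviB_add_right, leviB_smul_left, leviB_smul_right,
    leviB_comm hf n u]
  ring

/-- If the Levi form vanishes on a complex subspace then so does its polar form. -/
theorem leviB_eq_zero_of_leviH {f : E → ℝ} {x : E} (hf : ContDiffAt ℝ 2 f x) {u w : E}
    (hu : leviH f x u = 0) (hw : leviH f x w = 0) (huw : leviH f x (u + w) = 0) :
    leviB f x u w = 0 := by
  have h := leviH_add_smul hf u w 1
  rw [one_smul] at h
  linarith

omit [NormedSpace ℂ E] [IsScalarTower ℝ ℂ E] in
theorem fderiv_fderiv_apply {f : E → ℝ} {x : E} (hf : ContDiffAt ℝ 2 f x) (u w : E) :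
    fderiv ℝ (fderiv ℝ f) x u w = fderiv ℝ (fun y => fderiv ℝ f y w) x u := by
  have h : DifferentiableAt ℝ (fderiv ℝ f) x :=
    (hf.fderiv_right (m := 1) le_rfl).differentiableAt one_ne_zero
  rw [fderiv_clm_apply h (differentiableAt_const w)]
  simp

theorem leviB_congr {f g : E → ℝ} {x : E} (h : f =ᶠ[𝓝 x] g) (u w : E) :
    leviB f x u w = leviB g x u w := by
  have h1 : fderiv ℝ f =ᶠ[𝓝 x] fderiv ℝ g := h.fderiv
  rw [leviB, leviB, h1.fderiv_eq]

theorem leviH_congr {f g : E → ℝ} {x : E} (h : f =ᶠ[𝓝 x] g) (u : E) :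
    leviH f x u = leviH g x u := leviB_congr h u u

theorem leviH_add {f g : E → ℝ} {x : E} (hf : ContDiffAt ℝ 2 f x) (hg : ContDiffAt ℝ 2 g x)
    (u : E) : leviH (fun y => f y + g y) x u = leviH f x u + leviH g x u := by
  have hd : ∀ᶠ y in 𝓝 x, fderiv ℝ (fun y => f y + g y) y = fderiv ℝ f y + fderiv ℝ g y := by
    filter_upwards [hf.eventually (by simp), hg.eventually (by simp)] with y h1 h2
    exact fderiv_add (h1.differentiableAt two_ne_zero) (h2.differentiableAt two_ne_zero)
  have h1 : DifferentiableAt ℝ (fderiv ℝ f) x :=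
    (hf.fderiv_right (m := 1) le_rfl).differentiableAt one_ne_zero
  have h2 : DifferentiableAt ℝ (fderiv ℝ g) x :=
    (hg.fderiv_right (m := 1) le_rfl).differentiableAt one_ne_zero
  have h3 : fderiv ℝ (fderiv ℝ (fun y => f y + g y)) x
      = fderiv ℝ (fderiv ℝ f) x + fderiv ℝ (fderiv ℝ g) x := by
    rw [Filter.EventuallyEq.fderiv_eq hd]
    exact fderiv_add h1 h2
  simp [leviH, leviB, h3]; ring

/-- Chain rule for the Levi form of `log f`. -/
theorem leviH_log {f : E → ℝ} {x : E} (hf : ContDiffAt ℝ 2 f x) (hx : f x ≠ 0) (u : E) :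
    leviH (fun y => Real.log (f y)) x u
      = leviH f x u / f x - Complex.normSq (twoDel f x u) / f x ^ 2 := by
  have key : ∀ w, fderiv ℝ (fderiv ℝ (fun y => Real.log (f y))) x w w
      = fderiv ℝ (fderiv ℝ f) x w w / f x - fderiv ℝ f x w ^ 2 / f x ^ 2 := by
    intro w
    have hlog : ContDiffAt ℝ 2 (fun y => Real.log (f y)) x := hf.log hx
    rw [fderiv_fderiv_apply hlog, fderiv_fderiv_apply hf]
    have h1 : (fun y => fderiv ℝ (fun y => Real.log (f y)) y w)
        =ᶠ[𝓝 x] fun y => fderiv ℝ f y w / f y := by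
      filter_upwards [hf.eventually (by simp), hf.continuousAt.eventually_ne hx] with y h1 h2
      rw [fderiv.log (h1.differentiableAt two_ne_zero) h2]
      simp [div_eq_inv_mul]
    rw [h1.fderiv_eq]
    have h2 : DifferentiableAt ℝ (fun y => fderiv ℝ f y w) x :=
      ((hf.fderiv_right (m := 1) le_rfl).clm_apply contDiffAt_const).differentiableAt one_ne_zero
    have h3 : DifferentiableAt ℝ f x := hf.differentiableAt two_ne_zero
    have h5 := (hasDerivAt_inv hx).comp_hasFDerivAt x h3.hasFDerivAt
    have h4 := (h2.hasFDerivAt.mul h5).fderiv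
    have h6 : (fun y => fderiv ℝ f y w / f y)
        = (fun y => fderiv ℝ f y w) * (Inv.inv ∘ f) := by
      funext y; simp [div_eq_mul_inv]
    rw [h6, h4]
    simp
    field_simp
    ring
  rw [leviH, leviB, key, key, twoDel_normSq, leviH, leviB]
  field_simp
  ring

/-- The Levi form is natural under holomorphic maps. -/
theorem leviH_comp {f : F → ℝ} {τ : E → F} {x : E} (hf : ContDiffAt ℝ 2 f (τ x))
    (hτ : ContDiffAt ℂ 2 τ x) (u : E) :
    leviH (fun y => f (τ y)) x u = leviH f (τ x) (fderiv ℂ τ x u) := by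
  have hτr : ContDiffAt ℝ 2 τ x := hτ.restrict_scalars ℝ
  have hc : ContDiffAt ℝ 2 (fun y => f (τ y)) x := hf.comp x hτr
  have key : ∀ w, fderiv ℝ (fderiv ℝ (fun y => f (τ y))) x w w
      = fderiv ℝ (fderiv ℝ f) (τ x) (fderiv ℂ τ x w) (fderiv ℂ τ x w)
        + fderiv ℝ f (τ x) (fderiv ℂ (fun y => fderiv ℂ τ y w) x w) := by
    intro w
    rw [fderiv_fderiv_apply hc]
    have h1 : (fun y => fderiv ℝ (fun y => f (τ y)) y w)
        =ᶠ[𝓝 x] fun y => fderiv ℝ f (τ y) (fderiv ℂ τ y w) := by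
      filter_upwards [hτ.eventually (by simp),
        hτ.continuousAt.eventually (hf.eventually (by simp))] with y h1 h2
      have h3 : DifferentiableAt ℂ τ y := h1.differentiableAt two_ne_zero
      rw [show (fun y => f (τ y)) = f ∘ τ from rfl,
        fderiv_comp y (h2.differentiableAt two_ne_zero) (h3.restrictScalars ℝ),
        h3.fderiv_restrictScalars ℝ]
      rfl
    rw [h1.fderiv_eq]
    have h2 : DifferentiableAt ℝ (fun y => fderiv ℝ f (τ y)) x :=
      (((hf.fderiv_right (m := 1) le_rfl)).comp x (hτr.of_le one_le_two)).differentiableAt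
        one_ne_zero
    have h3 : DifferentiableAt ℂ (fun y => fderiv ℂ τ y w) x :=
      ((hτ.fderiv_right (m := 1) le_rfl).clm_apply contDiffAt_const).differentiableAt one_ne_zero
    rw [fderiv_clm_apply h2 (h3.restrictScalars ℝ), h3.fderiv_restrictScalars ℝ]
    have h4 : fderiv ℝ (fun y => fderiv ℝ f (τ y)) x
        = (fderiv ℝ (fderiv ℝ f) (τ x)).comp (fderiv ℝ τ x) :=
      fderiv_comp x ((hf.fderiv_right (m := 1) le_rfl).differentiableAt one_ne_zero)
        (hτr.differentiableAt two_ne_zero)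
    rw [h4, (hτ.differentiableAt two_ne_zero).fderiv_restrictScalars ℝ]
    simp [add_comm]
  have hI : fderiv ℂ (fun y => fderiv ℂ τ y (Complex.I • u)) x (Complex.I • u)
      = - fderiv ℂ (fun y => fderiv ℂ τ y u) x u := by
    have h3 : DifferentiableAt ℂ (fun y => fderiv ℂ τ y u) x :=
      ((hτ.fderiv_right (m := 1) le_rfl).clm_apply contDiffAt_const).differentiableAt one_ne_zero
    have h4 : (fun y => fderiv ℂ τ y (Complex.I • u))
        = fun y => Complex.I • fderiv ℂ τ y u := by
      funext y; exact map_smul _ _ _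
    rw [h4, fderiv_fun_const_smul h3]
    simp [I_smul_I_smul]
  rw [leviH, leviB, key, key, hI, map_smul (fderiv ℂ τ x), map_neg, leviH, leviB]
  ring

theorem fderiv_comp_holomorphic {f : F → ℝ} {τ : E → F} {x : E} (hf : DifferentiableAt ℝ f (τ x))
    (hτ : DifferentiableAt ℂ τ x) (u : E) :
    fderiv ℝ (fun y => f (τ y)) x u = fderiv ℝ f (τ x) (fderiv ℂ τ x u) := by
  rw [show (fun y => f (τ y)) = f ∘ τ from rfl, fderiv_comp x hf (hτ.restrictScalars ℝ),
    hτ.fderiv_restrictScalars ℝ]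
  rfl

end ComplexHessian

/-! ### Projection to the complex tangent space -/

section LeviProj

open Filter Asymptotics

variable {E : Type*} [NormedAddCommGroup E] [NormedSpace ℂ E] [NormedSpace ℝ E]
  [IsScalarTower ℝ ℂ E]

theorem leviH_real_smul (f : E → ℝ) (x u : E) (c : ℝ) :
    leviH f x (c • u) = c ^ 2 * leviH f x u := by
  rw [leviH, leviB_smul_left, leviB_smul_right, leviH]; ring

theorem twoDel_real_smul (f : E → ℝ) (x u : E) (c : ℝ) :
    twoDel f x (c • u) = c * twoDel f x u := by
  simp only [twoDel, smul_comm Complex.I c, map_smul, smul_eq_mul]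
  push_cast; ring

theorem twoDel_sq {f : E → ℝ} {x : E} (hf : DifferentiableAt ℝ f x) (u : E) :
    twoDel (fun y => f y ^ 2) x u = 2 * f x * twoDel f x u := by
  have h : fderiv ℝ (fun y => f y ^ 2) x = (2 * f x) • fderiv ℝ f x := by
    rw [fderiv_fun_pow 2 hf]; simp
  simp only [twoDel, h]
  simp
  ring

theorem twoDel_fun_add {f g : E → ℝ} {x : E} (hf : DifferentiableAt ℝ f x)
    (hg : DifferentiableAt ℝ g x) (u : E) :
    twoDel (fun y => f y + g y) x u = twoDel f x u + twoDel g x u := by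
  simp only [twoDel, fderiv_fun_add hf hg]
  simp
  ring

theorem leviH_sq {f : E → ℝ} {x : E} (hf : ContDiffAt ℝ 2 f x) (u : E) :
    leviH (fun y => f y ^ 2) x u
      = 2 * f x * leviH f x u + 2 * Complex.normSq (twoDel f x u) := by
  have key : ∀ w, fderiv ℝ (fderiv ℝ (fun y => f y ^ 2)) x w w
      = 2 * f x * fderiv ℝ (fderiv ℝ f) x w w + 2 * fderiv ℝ f x w ^ 2 := by
    intro w
    rw [fderiv_fderiv_apply (hf.pow 2), fderiv_fderiv_apply hf]
    have h1 : (fun y => fderiv ℝ (fun y => f y ^ 2) y w)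
        =ᶠ[𝓝 x] (fun y => 2 * f y) * fun y => fderiv ℝ f y w := by
      filter_upwards [hf.eventually (by simp)] with y h1
      rw [fderiv_fun_pow 2 (h1.differentiableAt two_ne_zero)]
      simp
    rw [h1.fderiv_eq]
    have h2 : DifferentiableAt ℝ (fun y => fderiv ℝ f y w) x :=
      ((hf.fderiv_right (m := 1) le_rfl).clm_apply contDiffAt_const).differentiableAt one_ne_zero
    have h3 : DifferentiableAt ℝ f x := hf.differentiableAt two_ne_zero
    rw [((h3.hasFDerivAt.const_mul 2).mul h2.hasFDerivAt).fderiv]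
    simp
    ring
  rw [leviH, leviB, key, key, twoDel_normSq, leviH, leviB]
  ring

/-- The Levi form of `log |f|²` at a point where `f = α + iβ` takes the value `1`. -/
theorem leviH_log_add_sq {α β : E → ℝ} {x : E} (hα : ContDiffAt ℝ 2 α x)
    (hβ : ContDiffAt ℝ 2 β x) (h1 : α x = 1) (h0 : β x = 0) (u : E) :
    leviH (fun y => Real.log (α y ^ 2 + β y ^ 2)) x u
      = 2 * leviH α x u - 2 * Complex.normSq (twoDel α x u)
        + 2 * Complex.normSq (twoDel β x u) := by
  have hα2 := hα.pow 2
  have hβ2 := hβ.pow 2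
  rw [leviH_log (hα2.add hβ2) (by simp [h1, h0]), leviH_add hα2 hβ2, leviH_sq hα, leviH_sq hβ,
    twoDel_fun_add (hα2.differentiableAt two_ne_zero) (hβ2.differentiableAt two_ne_zero),
    twoDel_sq (hα.differentiableAt two_ne_zero), twoDel_sq (hβ.differentiableAt two_ne_zero)]
  simp [h1, h0]
  ring

/-- Symmetry of third derivatives, in the form needed for the normal derivative of the Levi
form. -/
theorem fderiv_fderiv_fderiv_swap {ρ : E → ℝ} {x : E} (hρ : ContDiffAt ℝ 3 ρ x) (e u : E) :
    fderiv ℝ (fun y => fderiv ℝ (fderiv ℝ ρ) y u u) x e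
      = fderiv ℝ (fderiv ℝ (fun y => fderiv ℝ ρ y e)) x u u := by
  have hd : ∀ w, ContDiffAt ℝ 2 (fun y => fderiv ℝ ρ y w) x := fun w =>
    (hρ.fderiv_right (m := 2) (by norm_num)).clm_apply contDiffAt_const
  have hev : ∀ᶠ y in 𝓝 x, ContDiffAt ℝ 2 ρ y :=
    (hρ.of_le (by norm_num : (2 : WithTop ℕ∞) ≤ 3)).eventually (by simp)
  have h1 : (fun y => fderiv ℝ (fderiv ℝ ρ) y u u)
      =ᶠ[𝓝 x] fun y => fderiv ℝ (fun z => fderiv ℝ ρ z u) y u := by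
    filter_upwards [hev] with y hy using fderiv_fderiv_apply hy u u
  have h2 : (fun y => fderiv ℝ (fun z => fderiv ℝ ρ z u) y e)
      =ᶠ[𝓝 x] fun y => fderiv ℝ (fun z => fderiv ℝ ρ z e) y u := by
    filter_upwards [hev] with y hy
    rw [← fderiv_fderiv_apply hy, ← fderiv_fderiv_apply hy]
    exact (hy.isSymmSndFDerivAt (by simp)).eq e u
  rw [h1.fderiv_eq, ← fderiv_fderiv_apply (hd u),
    ((hd u).isSymmSndFDerivAt (by simp)).eq e u, fderiv_fderiv_apply (hd u), h2.fderiv_eq,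
    ← fderiv_fderiv_apply (hd e)]

/-- The projection of `u` onto the kernel of `2∂ρ` at `x`, along the complex line of `e`. -/
def leviProj (ρ : E → ℝ) (e x u : E) : E := u - (twoDel ρ x u / twoDel ρ x e) • e

theorem twoDel_leviProj {ρ : E → ℝ} {e x : E} (he : twoDel ρ x e ≠ 0) (u : E) :
    twoDel ρ x (leviProj ρ e x u) = 0 := by
  have h := map_sub (twoDelₗ ρ x) u ((twoDel ρ x u / twoDel ρ x e) • e)
  change twoDel ρ x (leviProj ρ e x u) = twoDel ρ x u - twoDel ρ x _ at h
  rw [h, twoDel_smul, div_mul_cancel₀ _ he, sub_self]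

theorem ContDiffAt.twoDel {m k : WithTop ℕ∞} {ρ : E → ℝ} {G : Type*} [NormedAddCommGroup G]
    [NormedSpace ℝ G] {a b : G → E} {p : G} (hρ : ContDiffAt ℝ k ρ (a p)) (hmk : m + 1 ≤ k)
    (ha : ContDiffAt ℝ m a p) (hb : ContDiffAt ℝ m b p) :
    ContDiffAt ℝ m (fun q => twoDel ρ (a q) (b q)) p := by
  have h1 : ContDiffAt ℝ m (fun q => fderiv ℝ ρ (a q)) p :=
    (hρ.fderiv_right hmk).comp p ha
  have h2 : ContDiffAt ℝ m (fun q => Complex.I • b q) p := contDiffAt_const.smul hb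
  unfold _root_.twoDel
  exact (Complex.ofRealCLM.contDiff.contDiffAt.comp p (h1.clm_apply hb)).sub
    (contDiffAt_const.mul (Complex.ofRealCLM.contDiff.contDiffAt.comp p (h1.clm_apply h2)))

theorem ContDiffAt.leviB {m k : WithTop ℕ∞} {ρ : E → ℝ} {G : Type*} [NormedAddCommGroup G]
    [NormedSpace ℝ G] {a b c : G → E} {p : G} (hρ : ContDiffAt ℝ k ρ (a p)) (hmk : m + 2 ≤ k)
    (ha : ContDiffAt ℝ m a p) (hb : ContDiffAt ℝ m b p) (hc : ContDiffAt ℝ m c p) :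
    ContDiffAt ℝ m (fun q => leviB ρ (a q) (b q) (c q)) p := by
  have h1 : ContDiffAt ℝ m (fun q => fderiv ℝ (fderiv ℝ ρ) (a q)) p := by
    have h0 : ContDiffAt ℝ (m + 1) (fderiv ℝ ρ) (a p) :=
      hρ.fderiv_right (by rwa [add_assoc, one_add_one_eq_two])
    exact (h0.fderiv_right le_rfl).comp p ha
  have h2 : ContDiffAt ℝ m (fun q => Complex.I • b q) p := contDiffAt_const.smul hb
  have h3 : ContDiffAt ℝ m (fun q => Complex.I • c q) p := contDiffAt_const.smul hc
  unfold _root_.leviB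
  exact ((h1.clm_apply hb).clm_apply hc).add ((h1.clm_apply h2).clm_apply h3)

theorem ContDiffAt.leviProj {m k : WithTop ℕ∞} {ρ : E → ℝ} {G : Type*} [NormedAddCommGroup G]
    [NormedSpace ℝ G] {a b : G → E} {p : G} {e : E} (hρ : ContDiffAt ℝ k ρ (a p))
    (hmk : m + 1 ≤ k) (he : _root_.twoDel ρ (a p) e ≠ 0)
    (ha : ContDiffAt ℝ m a p) (hb : ContDiffAt ℝ m b p) :
    ContDiffAt ℝ m (fun q => leviProj ρ e (a q) (b q)) p := by
  unfold _root_.leviProj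
  have h1 := (hρ.twoDel hmk ha hb)
  have h2 := (hρ.twoDel hmk ha (contDiffAt_const (c := e)))
  simp only [div_eq_mul_inv]
  exact hb.sub ((h1.mul (h2.inv he)).smul contDiffAt_const)

end LeviProj

/-! ### The normal derivative of the Levi form -/

section NormalDerivative

open Filter Asymptotics

variable {E : Type*} [NormedAddCommGroup E] [NormedSpace ℂ E] [NormedSpace ℝ E]
  [IsScalarTower ℝ ℂ E]

theorem hasFDerivAt_twoDel {f : E → ℝ} {x : E} (hf : DifferentiableAt ℝ (fderiv ℝ f) x) (w : E) :
    HasFDerivAt (fun y => twoDel f y w)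
      (Complex.ofRealCLM.comp ((fderiv ℝ (fderiv ℝ f) x).flip w)
        - Complex.I • Complex.ofRealCLM.comp
          ((fderiv ℝ (fderiv ℝ f) x).flip (Complex.I • w))) x := by
  have h1 : ∀ w' : E, HasFDerivAt (fun y => ((fderiv ℝ f y w' : ℝ) : ℂ))
      (Complex.ofRealCLM.comp ((fderiv ℝ (fderiv ℝ f) x).flip w')) x := by
    intro w'
    have h2 := hf.hasFDerivAt.clm_apply (hasFDerivAt_const w' x)
    have h3 := (Complex.ofRealCLM.hasFDerivAt (x := fderiv ℝ f x w')).comp x h2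
    convert! h3 using 1
    ext v
    simp
  exact (h1 w).sub ((h1 (Complex.I • w)).const_mul Complex.I)

/-- The derivative, in the normal direction `e`, of the Levi form `x ↦ H_x(u_x)`, where `u_x` is
the projection of a fixed vector `u` to the complex tangent space of the level set of `ρ`
through `x`. -/
theorem fderiv_leviH_leviProj {ρ : E → ℝ} {x₀ e u : E} (hρ : ContDiffAt ℝ 3 ρ x₀)
    (he : twoDel ρ x₀ e = 1) (hu : twoDel ρ x₀ u = 0) :
    fderiv ℝ (fun x => leviH ρ x (leviProj ρ e x u)) x₀ e
      = leviH (fun y => fderiv ℝ ρ y e) x₀ u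
        - 2 * (fderiv ℝ (fderiv ℝ ρ) x₀ u e * leviB ρ x₀ u e
          - fderiv ℝ (fderiv ℝ ρ) x₀ (Complex.I • u) e * leviB ρ x₀ u (Complex.I • e)) := by
  have hρ2 : ContDiffAt ℝ 2 ρ x₀ := hρ.of_le (by norm_num)
  have hsymm := hρ2.isSymmSndFDerivAt (by simp)
  have hD1 : DifferentiableAt ℝ (fderiv ℝ ρ) x₀ :=
    (hρ.fderiv_right (m := 2) (by norm_num)).differentiableAt two_ne_zero
  have hD2 : DifferentiableAt ℝ (fderiv ℝ (fderiv ℝ ρ)) x₀ :=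
    ((hρ.fderiv_right (m := 2) (by norm_num)).fderiv_right (m := 1)
      (by norm_num)).differentiableAt one_ne_zero
  -- the projected vector field and its derivative
  have hV : DifferentiableAt ℝ (fun x => leviProj ρ e x u) x₀ :=
    ((hρ.leviProj (a := fun x => x) (b := fun _ => u) (m := 1) (by norm_num)
      (by rw [he]; exact one_ne_zero) contDiffAt_id contDiffAt_const)).differentiableAt one_ne_zero
  have hV0 : leviProj ρ e x₀ u = u := by simp [leviProj, hu]
  have hV' : fderiv ℝ (fun x => leviProj ρ e x u) x₀ e
      = -(fderiv ℝ (fderiv ℝ ρ) x₀ u e • e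
          - fderiv ℝ (fderiv ℝ ρ) x₀ (Complex.I • u) e • Complex.I • e) := by
    have hs := fun w : E => hasFDerivAt_twoDel hD1 w
    have hinv : DifferentiableAt ℝ (fun x => (twoDel ρ x e)⁻¹) x₀ :=
      (hs e).differentiableAt.inv (by rw [he]; exact one_ne_zero)
    have hq := (((hs u).mul hinv.hasFDerivAt).smul_const e).const_sub u
    have hfun : (fun x => leviProj ρ e x u) = fun x => u -
        ((fun x => twoDel ρ x u) * fun x => (twoDel ρ x e)⁻¹) x • e := by
      funext x; simp [leviProj, div_eq_mul_inv]
    rw [hfun, hq.fderiv]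
    simp only [hu, he, neg_apply, ContinuousLinearMap.smulRight_apply, add_apply, smul_apply,
      zero_smul, zero_add, inv_one, one_smul, sub_apply, ContinuousLinearMap.comp_apply,
      ContinuousLinearMap.flip_apply]
    rw [complex_smul_eq]
    simp only [hsymm.eq e]
    simp [sub_eq_add_neg]
  have hfun : (fun x => leviH ρ x (leviProj ρ e x u)) = fun x =>
      fderiv ℝ (fderiv ℝ ρ) x (leviProj ρ e x u) (leviProj ρ e x u)
      + fderiv ℝ (fderiv ℝ ρ) x (Complex.I • leviProj ρ e x u)
        (Complex.I • leviProj ρ e x u) := rfl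
  have hVI : HasFDerivAt (fun x => Complex.I • leviProj ρ e x u)
      (Complex.I • fderiv ℝ (fun x => leviProj ρ e x u) x₀) x₀ := hV.hasFDerivAt.const_smul _
  have hq1 := (hD2.hasFDerivAt.clm_apply hV.hasFDerivAt).clm_apply hV.hasFDerivAt
  have hq2 := (hD2.hasFDerivAt.clm_apply hVI).clm_apply hVI
  have hthird : ∀ w, fderiv ℝ (fderiv ℝ (fderiv ℝ ρ)) x₀ e w w
      = fderiv ℝ (fderiv ℝ (fun y => fderiv ℝ ρ y e)) x₀ w w := by
    intro w
    rw [← fderiv_fderiv_fderiv_swap hρ e w]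
    have := (hD2.hasFDerivAt.clm_apply (hasFDerivAt_const w x₀)).clm_apply (hasFDerivAt_const w x₀)
    rw [this.fderiv]
    simp
  rw [hfun, (hq1.fun_add hq2).fderiv]
  simp only [add_apply, ContinuousLinearMap.comp_apply, ContinuousLinearMap.flip_apply,
    smul_apply, hV', hV0, hthird]
  rw [leviH, leviB, leviB, leviB]
  simp only [smul_neg, smul_sub, map_neg, map_sub, map_smul, I_smul_I_smul, neg_apply, sub_apply,
    smul_apply, smul_eq_mul, smul_comm Complex.I]
  simp only [hsymm.eq e u, hsymm.eq e (Complex.I • u), hsymm.eq (Complex.I • e) u,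
    hsymm.eq (Complex.I • e) (Complex.I • u)]
  ring

end NormalDerivative

/-! ### The transversal estimate near a Levi flat hypersurface -/

section Estimate

open Filter Asymptotics

variable {E : Type*} [NormedAddCommGroup E] [NormedSpace ℂ E] [NormedSpace ℝ E]
  [IsScalarTower ℝ ℂ E]

/-- Along the complex tangent space, the curvature term `i∂∂̄ log |2∂ρ(e)|²` is made of the normal
derivative of the Levi form and of the square of the mixed component of the Hessian of `ρ`; the
latter is exactly what is lost on minimizing the Levi form of `-log ρ²` over the normal
component. -/
theorem leviH_log_normSq_twoDel {ρ : E → ℝ} {x₀ e u : E} (hρ : ContDiffAt ℝ 3 ρ x₀)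
    (he : twoDel ρ x₀ e = 1) (hu : twoDel ρ x₀ u = 0) :
    leviH (fun y => Real.log (Complex.normSq (twoDel ρ y e))) x₀ u
      = 2 * fderiv ℝ (fun x => leviH ρ x (leviProj ρ e x u)) x₀ e
        + 2 * (leviB ρ x₀ u e ^ 2 + leviB ρ x₀ u (Complex.I • e) ^ 2) := by
  have hρ2 : ContDiffAt ℝ 2 ρ x₀ := hρ.of_le (by norm_num)
  have hd : ∀ w, ContDiffAt ℝ 2 (fun y => fderiv ℝ ρ y w) x₀ := fun w =>
    (hρ.fderiv_right (m := 2) (by norm_num)).clm_apply contDiffAt_const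
  have h1 : fderiv ℝ ρ x₀ e = 1 := by rw [← twoDel_re, he]; simp
  have h0 : fderiv ℝ ρ x₀ (Complex.I • e) = 0 := by
    have := twoDel_im ρ x₀ e
    rw [he] at this
    simpa using this.symm
  simp only [twoDel_normSq ρ _ e]
  rw [leviH_log_add_sq (hd e) (hd _) h1 h0, fderiv_leviH_leviProj hρ he hu, twoDel_normSq,
    twoDel_normSq]
  simp only [← fderiv_fderiv_apply hρ2]
  simp only [leviB, I_smul_I_smul, map_neg]
  ring

/-- Decomposition of the Levi form of `-(g + log ρ²)` with respect to the complex tangent direction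
`u` and the normal direction `N`; the square of the rescaled normal component `s` is completed. -/
theorem neg_leviH_add_log {ρ g : E → ℝ} {x u N : E} (hρ : ContDiffAt ℝ 2 ρ x)
    (hg : ContDiffAt ℝ 2 g x) (hr : ρ x ≠ 0) (hu : twoDel ρ x u = 0) (hN : twoDel ρ x N = 1)
    (s : ℂ) :
    - leviH (fun y => g y + (Real.log (ρ y) + Real.log (ρ y))) x (u + ρ x • s • N)
      = - leviH g x (u + ρ x • s • N) - 2 * (leviH ρ x u / ρ x)
        - 2 * (leviB ρ x u N ^ 2 + leviB ρ x u (Complex.I • N) ^ 2)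
        + 2 * ((s.re - leviB ρ x u N) ^ 2 + (s.im - leviB ρ x u (Complex.I • N)) ^ 2)
        - 2 * (ρ x * leviH ρ x N) * Complex.normSq s := by
  have hl := hρ.log hr
  have h1 : twoDel ρ x (u + ρ x • s • N) = ρ x * s := by
    rw [twoDel_add, hu, twoDel_real_smul, twoDel_smul, hN]; ring
  have h2 : leviB ρ x u (s • N) = s.re * leviB ρ x u N + s.im * leviB ρ x u (Complex.I • N) := by
    rw [complex_smul_eq, leviB_add_right, leviB_smul_right, leviB_smul_right]
  have h3 : leviH ρ x (u + ρ x • s • N) = leviH ρ x u + 2 * ρ x * (s.re * leviB ρ x u N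
      + s.im * leviB ρ x u (Complex.I • N)) + ρ x ^ 2 * (Complex.normSq s * leviH ρ x N) := by
    rw [leviH_add_smul hρ, leviH_smul hρ, h2]
  rw [leviH_add hg (hl.add hl), leviH_add hl hl, leviH_log hρ hr, h1, h3]
  simp only [Complex.normSq_mul, Complex.normSq_ofReal]
  rw [Complex.normSq_apply]
  field_simp
  ring

/-- The strict form of the estimate, at a fixed point of the hypersurface and near a fixed
direction. -/
theorem eventually_le_neg_leviH {ρ g : E → ℝ} {x₀ e U₀ : E} (hρ : ContDiffAt ℝ 3 ρ x₀)
    (hg : ContDiffAt ℝ 2 g x₀) (h₀ : ρ x₀ = 0) (he : twoDel ρ x₀ e = 1)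
    (hflat : ∀ᶠ x in 𝓝 x₀, ρ x = 0 → ∀ u, twoDel ρ x u = 0 → leviH ρ x u = 0)
    (hpos : twoDel ρ x₀ U₀ = 0 →
      leviH (fun y => g y + Real.log (Complex.normSq (twoDel ρ y e))) x₀ U₀ < 0) :
    ∃ c > 0, ∀ᶠ p in 𝓝 (x₀, U₀), ρ p.1 ≠ 0 →
      c ≤ - leviH (fun y => g y + (Real.log (ρ y) + Real.log (ρ y))) p.1 p.2 := by
  have he0 : twoDel ρ x₀ e ≠ 0 := by rw [he]; exact one_ne_zero
  have hfst : ContDiffAt ℝ 1 (fun p : E × E => p.1) (x₀, U₀) := contDiff_fst.contDiffAt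
  have hsnd : ContDiffAt ℝ 1 (fun p : E × E => p.2) (x₀, U₀) := contDiff_snd.contDiffAt
  set N : E → E := fun x => (twoDel ρ x e)⁻¹ • e with hNdef
  have hN : ContDiffAt ℝ 1 (fun p : E × E => N p.1) (x₀, U₀) :=
    ((hρ.twoDel (a := fun p : E × E => p.1) (p := (x₀, U₀)) (b := fun _ => e) (by norm_num)
      hfst contDiffAt_const).inv he0).smul contDiffAt_const
  have hu : ContDiffAt ℝ 1 (fun p : E × E => leviProj ρ e p.1 p.2) (x₀, U₀) :=
    hρ.leviProj (a := fun p : E × E => p.1) (p := (x₀, U₀)) (by norm_num) he0 hfst hsnd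
  have hF : ContDiffAt ℝ 1 (fun p : E × E => leviH ρ p.1 (leviProj ρ e p.1 p.2)) (x₀, U₀) :=
    hρ.leviB (a := fun p : E × E => p.1) (p := (x₀, U₀)) (by norm_num) hfst hu hu
  have hK : ContinuousAt (fun p : E × E => ρ p.1 * leviH ρ p.1 (N p.1)) (x₀, U₀) :=
    (hρ.continuousAt.comp (f := fun p : E × E => p.1) (x := (x₀, U₀)) hfst.continuousAt).mul
    (hρ.leviB (a := fun p : E × E => p.1) (p := (x₀, U₀)) (by norm_num) hfst hN hN).continuousAt
  have hB1 : ContinuousAt (fun p : E × E => leviB ρ p.1 (leviProj ρ e p.1 p.2) (N p.1))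
    (x₀, U₀) :=
    (hρ.leviB (a := fun p : E × E => p.1) (p := (x₀, U₀)) (by norm_num) hfst hu hN).continuousAt
  have hB2 : ContinuousAt (fun p : E × E => leviB ρ p.1 (leviProj ρ e p.1 p.2)
      (Complex.I • N p.1)) (x₀, U₀) :=
    (hρ.leviB (a := fun p : E × E => p.1) (p := (x₀, U₀)) (by norm_num) hfst hu
      (contDiffAt_const.smul hN)).continuousAt
  have hM : ContinuousAt (fun p : E × E => leviB ρ p.1 (leviProj ρ e p.1 p.2) (N p.1) ^ 2
      + leviB ρ p.1 (leviProj ρ e p.1 p.2) (Complex.I • N p.1) ^ 2) (x₀, U₀) :=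
    (hB1.pow 2).add (hB2.pow 2)
  have hG : ContinuousAt (fun p : E × E => leviH g p.1 p.2) (x₀, U₀) :=
    (hg.leviB (a := fun p : E × E => p.1) (p := (x₀, U₀)) (m := 0) (by norm_num)
      (hfst.of_le zero_le_one) (hsnd.of_le zero_le_one) (hsnd.of_le zero_le_one)).continuousAt
  have hS : ContinuousAt (fun p : E × E => Complex.normSq (twoDel ρ p.1 p.2)) (x₀, U₀) :=
    Complex.continuous_normSq.continuousAt.comp
      (hρ.twoDel (a := fun p : E × E => p.1) (p := (x₀, U₀)) (m := 1) (by norm_num)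
        hfst hsnd).continuousAt
  have hρc : ContinuousAt (fun p : E × E => ρ p.1) (x₀, U₀) :=
    hρ.continuousAt.comp (f := fun p : E × E => p.1) (x := (x₀, U₀)) hfst.continuousAt
  -- first order division of the projected Levi form by `ρ`
  have hρs : HasStrictFDerivAt (fun p : E × E => ρ p.1)
      ((fderiv ℝ ρ x₀).comp (ContinuousLinearMap.fst ℝ E E)) (x₀, U₀) :=
    (hρ.hasStrictFDerivAt (by norm_num)).comp (f := fun p : E × E => p.1) (x₀, U₀)
      hasStrictFDerivAt_fst
  have hnear : ∀ᶠ p : E × E in 𝓝 (x₀, U₀), twoDel ρ p.1 e ≠ 0 :=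
    ((hρ.twoDel (a := fun p : E × E => p.1) (p := (x₀, U₀)) (b := fun _ => e) (m := 1)
      (by norm_num) hfst contDiffAt_const).continuousAt).eventually_ne he0
  have hdiv := (hF.hasStrictFDerivAt one_ne_zero).sub_smul_isLittleO hρs (ν := (e, 0)) h₀
    (by simp only [ContinuousLinearMap.comp_apply, ContinuousLinearMap.coe_fst']
        rw [← twoDel_re, he]; simp)
    (by filter_upwards [hfst.continuousAt.eventually hflat, hnear] with p h1 h2 h3
        exact h1 h3 _ (twoDel_leviProj h2 _))
  set lam : ℝ := fderiv ℝ (fun p : E × E => leviH ρ p.1 (leviProj ρ e p.1 p.2)) (x₀, U₀) (e, 0)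
    with hlam
  set M₀ : ℝ := leviB ρ x₀ (leviProj ρ e x₀ U₀) (N x₀) ^ 2
      + leviB ρ x₀ (leviProj ρ e x₀ U₀) (Complex.I • N x₀) ^ 2 with hM₀
  have hM₀0 : 0 ≤ M₀ := by positivity
  set G₀ : ℝ := leviH g x₀ U₀ with hG₀
  -- the lower bound common to all directions; `(a, b)` is the rescaled normal component and `η`
  -- bounds the errors of the quantities replaced by their limits
  have main : ∀ η : ℝ, 0 < η → η ≤ 1 / 4 → ∀ᶠ p : E × E in 𝓝 (x₀, U₀), ρ p.1 ≠ 0 →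
      -G₀ - 2 * lam - 2 * M₀ - η * (9 + 4 * M₀)
        + (Complex.normSq (twoDel ρ p.1 p.2) / ρ p.1 ^ 2 / 2 - M₀ - 1) ⊔ 0
      ≤ - leviH (fun y => g y + (Real.log (ρ y) + Real.log (ρ y))) p.1 p.2 := by
    intro η hη hη4
    have e1 := Metric.tendsto_nhds.1 hG.tendsto η hη
    have e2 := Metric.tendsto_nhds.1 hM.tendsto η hη
    have e3 := Metric.tendsto_nhds.1 hK.tendsto η hη
    have e4 := isLittleO_iff.1 hdiv hη
    have e5 := hfst.continuousAt.eventually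
      ((hρ.of_le (by norm_num : (2 : WithTop ℕ∞) ≤ 3)).eventually (by simp))
    have e6 := hfst.continuousAt.eventually (hg.eventually (by simp))
    filter_upwards [e1, e2, e3, e4, e5, e6, hnear] with p h1 h2 h3 h4 h5 h6 h7 h8
    simp only [h₀, zero_mul, Real.dist_eq, sub_zero, Real.norm_eq_abs, smul_eq_mul] at h1 h2 h3 h4
    rw [← hG₀] at h1
    rw [← hM₀] at h2
    have hNp : twoDel ρ p.1 (N p.1) = 1 := by
      rw [hNdef, twoDel_smul, inv_mul_cancel₀ h7]
    have hs : p.2 = leviProj ρ e p.1 p.2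
        + ρ p.1 • (twoDel ρ p.1 p.2 / ρ p.1 : ℂ) • N p.1 := by
      rw [← algebraMap_smul ℂ (ρ p.1), smul_smul]
      have : (algebraMap ℝ ℂ (ρ p.1)) * (twoDel ρ p.1 p.2 / ρ p.1 : ℂ) = twoDel ρ p.1 p.2 := by
        have : (ρ p.1 : ℂ) ≠ 0 := by exact_mod_cast h8
        simp only [Complex.coe_algebraMap]
        field_simp
      rw [this, hNdef, smul_smul, leviProj, div_eq_mul_inv]
      abel
    have hid := neg_leviH_add_log h5 h6 h8 (twoDel_leviProj h7 p.2) hNp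
      (twoDel ρ p.1 p.2 / ρ p.1 : ℂ)
    rw [← hs] at hid
    rw [hid]
    have hsq : Complex.normSq (twoDel ρ p.1 p.2 / ρ p.1 : ℂ)
        = Complex.normSq (twoDel ρ p.1 p.2) / ρ p.1 ^ 2 := by
      rw [Complex.normSq_div, Complex.normSq_ofReal, sq]
    have hsq' := Complex.normSq_apply (twoDel ρ p.1 p.2 / ρ p.1 : ℂ)
    rw [← hsq, hsq']
    have h9 : |leviH ρ p.1 (leviProj ρ e p.1 p.2) / ρ p.1 - lam| ≤ η := by
      have : leviH ρ p.1 (leviProj ρ e p.1 p.2) / ρ p.1 - lam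
          = (leviH ρ p.1 (leviProj ρ e p.1 p.2) - ρ p.1 * lam) / ρ p.1 := by
        field_simp
      rw [this, abs_div, div_le_iff₀ (abs_pos.2 h8)]
      exact h4
    generalize (twoDel ρ p.1 p.2 / ρ p.1 : ℂ).re = a at *
    generalize (twoDel ρ p.1 p.2 / ρ p.1 : ℂ).im = b at *
    generalize leviH ρ p.1 (leviProj ρ e p.1 p.2) / ρ p.1 = q at *
    generalize leviB ρ p.1 (leviProj ρ e p.1 p.2) (N p.1) = m₁ at *
    generalize leviB ρ p.1 (leviProj ρ e p.1 p.2) (Complex.I • N p.1) = m₂ at *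
    generalize ρ p.1 * leviH ρ p.1 (N p.1) = k at *
    generalize leviH g p.1 p.2 = γ at *
    have i1 := (abs_lt.1 h1).2
    have i2 := (abs_lt.1 h2).2
    have i3 := (abs_lt.1 h3).2
    have i4 := (abs_le.1 h9).2
    have j1 : a * a + b * b ≤ 2 * ((a - m₁) ^ 2 + (b - m₂) ^ 2) + 2 * (m₁ ^ 2 + m₂ ^ 2) := by
      nlinarith [sq_nonneg (a - 2 * m₁), sq_nonneg (b - 2 * m₂)]
    have j2 : k * (a * a + b * b) ≤ η * (a * a + b * b) := by
      have : 0 ≤ a * a + b * b := add_nonneg (mul_self_nonneg a) (mul_self_nonneg b)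
      gcongr
    have j3 : η * (a * a + b * b) ≤ η * (2 * ((a - m₁) ^ 2 + (b - m₂) ^ 2))
        + η * (2 * (m₁ ^ 2 + m₂ ^ 2)) := by rw [← mul_add]; gcongr
    have j4 : η * (2 * ((a - m₁) ^ 2 + (b - m₂) ^ 2))
        ≤ 1 / 4 * (2 * ((a - m₁) ^ 2 + (b - m₂) ^ 2)) := by
      gcongr
    have j5 : η * (2 * (m₁ ^ 2 + m₂ ^ 2)) ≤ η * (2 * (M₀ + 1)) := by
      exact mul_le_mul_of_nonneg_left (by linarith) hη.le
    have j6 : ((a * a + b * b) / 2 - M₀ - 1) ⊔ 0 ≤ (a - m₁) ^ 2 + (b - m₂) ^ 2 := by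
      apply sup_le
      · linarith
      · positivity
    linarith
  by_cases hU : twoDel ρ x₀ U₀ = 0
  · -- tangential directions: the limit of the lower bound is given by the curvature
    have hpu : leviProj ρ e x₀ U₀ = U₀ := by simp [leviProj, hU]
    have hNx : N x₀ = e := by simp [hNdef, he]
    have hlam' : lam = fderiv ℝ (fun x => leviH ρ x (leviProj ρ e x U₀)) x₀ e := by
      have h1 : HasFDerivAt (fun x : E => (x, U₀)) (ContinuousLinearMap.inl ℝ E E) x₀ := by
        have := (hasFDerivAt_id (𝕜 := ℝ) x₀).prodMk (hasFDerivAt_const U₀ x₀)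
        exact this
      have h2 := (hF.differentiableAt one_ne_zero).hasFDerivAt.comp x₀ h1
      have h3 : (fun x => leviH ρ x (leviProj ρ e x U₀))
        = (fun p : E × E => leviH ρ p.1 (leviProj ρ e p.1 p.2)) ∘ fun x : E => (x, U₀) := rfl
      rw [h3, h2.fderiv, hlam]
      simp
    have hneg := hpos hU
    have hlogC : ContDiffAt ℝ 2 (fun y => Real.log (Complex.normSq (twoDel ρ y e))) x₀ := by
      have h1 : ContDiffAt ℝ 2 (fun y => Complex.normSq (twoDel ρ y e)) x₀ := by
        simp only [twoDel_normSq]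
        have hd : ∀ w, ContDiffAt ℝ 2 (fun y => fderiv ℝ ρ y w) x₀ := fun w =>
          (hρ.fderiv_right (m := 2) (by norm_num)).clm_apply contDiffAt_const
        exact ((hd _).pow 2).add ((hd _).pow 2)
      exact h1.log (by simp [he])
    rw [leviH_add hg hlogC, leviH_log_normSq_twoDel hρ he hU, ← hlam', ← hG₀] at hneg
    rw [hpu, hNx] at hM₀
    rw [← hM₀] at hneg
    set Q : ℝ := -G₀ - 2 * lam - 2 * M₀ with hQ
    have hQ0 : 0 < Q := by rw [hQ]; linarith
    set η : ℝ := min (1 / 4) (Q / (2 * (9 + 4 * M₀))) with hη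
    have hη0 : 0 < η := by positivity
    have hηQ : η * (9 + 4 * M₀) ≤ Q / 2 := by
      have : η ≤ Q / (2 * (9 + 4 * M₀)) := min_le_right _ _
      calc η * (9 + 4 * M₀) ≤ Q / (2 * (9 + 4 * M₀)) * (9 + 4 * M₀) := by gcongr
        _ = Q / 2 := by field_simp
    refine ⟨Q / 2, by positivity, ?_⟩
    filter_upwards [main η hη0 (min_le_left _ _)] with p hp hp0
    have h1 := hp hp0
    have h2 := le_sup_right (a := Complex.normSq (twoDel ρ p.1 p.2) / ρ p.1 ^ 2 / 2 - M₀ - 1)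
      (b := (0 : ℝ))
    linarith
  · -- transversal directions: the term `|2∂ρ(U)|² / ρ²` dominates
    set κ : ℝ := Complex.normSq (twoDel ρ x₀ U₀) with hκ
    have hκ0 : 0 < κ := Complex.normSq_pos.2 hU
    set C : ℝ := |G₀| + 2 * |lam| + 4 * M₀ + 10 with hC
    have hC0 : 0 < C := by positivity
    have e1 : ∀ᶠ p : E × E in 𝓝 (x₀, U₀), κ / 2 < Complex.normSq (twoDel ρ p.1 p.2) :=
      hS.tendsto.eventually (lt_mem_nhds (half_lt_self hκ0))
    have e2 : ∀ᶠ p : E × E in 𝓝 (x₀, U₀), ρ p.1 ^ 2 < κ / (4 * C) :=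
      (hρc.pow 2).tendsto.eventually (gt_mem_nhds (by
        change ρ x₀ ^ 2 < κ / (4 * C)
        rw [h₀, zero_pow two_ne_zero]; positivity))
    refine ⟨1, one_pos, ?_⟩
    filter_upwards [main (1 / 4) (by norm_num) le_rfl, e1, e2] with p hp h1 h2 hp0
    have h3 := hp hp0
    have h4 := le_sup_left (a := Complex.normSq (twoDel ρ p.1 p.2) / ρ p.1 ^ 2 / 2 - M₀ - 1)
      (b := (0 : ℝ))
    have h5 : C ≤ Complex.normSq (twoDel ρ p.1 p.2) / ρ p.1 ^ 2 / 2 := by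
      have hr : 0 < ρ p.1 ^ 2 := by positivity
      rw [div_div, le_div_iff₀ (by positivity)]
      rw [lt_div_iff₀ (by positivity)] at h2
      linarith
    have h6 := le_abs_self G₀
    have h7 := le_abs_self lam
    linarith

/-- The transversal estimate: near a point of a Levi flat hypersurface `{ρ = 0}` at which the
form `i∂∂̄(g + log |2∂ρ(e)|²)` is negative along the complex tangent space, the function
`g + log ρ²` has a Levi form bounded above by a negative multiple of the metric. -/
theorem exists_eventually_mul_norm_sq_le_neg_leviH [FiniteDimensional ℝ E] {ρ g : E → ℝ}
    {x₀ e : E} (hρ : ContDiffAt ℝ 3 ρ x₀)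
    (hg : ContDiffAt ℝ 2 g x₀) (h₀ : ρ x₀ = 0) (he : twoDel ρ x₀ e = 1)
    (hflat : ∀ᶠ x in 𝓝 x₀, ρ x = 0 → ∀ u, twoDel ρ x u = 0 → leviH ρ x u = 0)
    (hpos : ∀ u ≠ 0, twoDel ρ x₀ u = 0 →
      leviH (fun y => g y + Real.log (Complex.normSq (twoDel ρ y e))) x₀ u < 0) :
    ∃ c > 0, ∀ᶠ x in 𝓝 x₀, ρ x ≠ 0 → ∀ u, c * ‖u‖ ^ 2 ≤
      - leviH (fun y => g y + (Real.log (ρ y) + Real.log (ρ y))) x u := by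
  have hcpt : IsCompact (Metric.sphere (0 : E) 1) := isCompact_sphere 0 1
  have : ∃ c > 0, ∀ᶠ x in 𝓝 x₀, ∀ u ∈ Metric.sphere (0 : E) 1, ρ x ≠ 0 → c ≤
      - leviH (fun y => g y + (Real.log (ρ y) + Real.log (ρ y))) x u := by
    refine hcpt.induction_on (p := fun S => ∃ c > 0, ∀ᶠ x in 𝓝 x₀, ∀ u ∈ S, ρ x ≠ 0 → c ≤
      - leviH (fun y => g y + (Real.log (ρ y) + Real.log (ρ y))) x u) ?_ ?_ ?_ ?_
    · exact ⟨1, one_pos, by simp⟩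
    · rintro S T hST ⟨c, hc, h⟩
      exact ⟨c, hc, h.mono fun x hx u hu => hx u (hST hu)⟩
    · rintro S T ⟨c, hc, h⟩ ⟨d, hd, h'⟩
      refine ⟨min c d, lt_min hc hd, ?_⟩
      filter_upwards [h, h'] with x h1 h2 u hu hx
      rcases hu with hu | hu
      · exact (min_le_left _ _).trans (h1 u hu hx)
      · exact (min_le_right _ _).trans (h2 u hu hx)
    · intro u hu
      have hu0 : u ≠ 0 := by
        rintro rfl
        simp at hu
      obtain ⟨c, hc, h⟩ := eventually_le_neg_leviH hρ hg h₀ he hflat (hpos u hu0)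
      rw [nhds_prod_eq, eventually_prod_iff] at h
      obtain ⟨pa, hpa, pb, hpb, h⟩ := h
      refine ⟨{y | pb y}, mem_nhdsWithin_of_mem_nhds hpb, c, hc, ?_⟩
      filter_upwards [hpa] with x hx y hy hρx
      exact h hx hy hρx
  obtain ⟨c, hc, h⟩ := this
  refine ⟨c, hc, ?_⟩
  filter_upwards [h] with x hx hρx u
  by_cases hu : u = 0
  · subst hu
    have := leviH_real_smul (fun y => g y + (Real.log (ρ y) + Real.log (ρ y))) x (0 : E) 0
    simp only [smul_zero] at this
    rw [this]; simp
  · have hn : 0 < ‖u‖ := norm_pos_iff.2 hu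
    have h1 := hx (‖u‖⁻¹ • u) (by simp [norm_smul, hn.ne']) hρx
    rw [leviH_real_smul] at h1
    have h2 : u = ‖u‖ • ‖u‖⁻¹ • u := by rw [smul_smul, mul_inv_cancel₀ hn.ne', one_smul]
    rw [inv_pow, ← mul_neg, inv_mul_eq_div, le_div_iff₀ (by positivity)] at h1
    exact h1

end Estimate

/-! ### Holomorphic functions of several variables are analytic -/

section SeveralVariables

open Filter MeasureTheory Metric

variable {E F : Type*} [NormedAddCommGroup E] [NormedSpace ℂ E]
  [NormedAddCommGroup F] [NormedSpace ℂ F] [CompleteSpace F]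

theorem add_smul_mem_ball {x v : E} {r δ : ℝ} (hv : r * ‖v‖ < δ) {z : ℂ}
    (hz : z ∈ closedBall (0 : ℂ) r) : x + z • v ∈ ball x δ := by
  rw [mem_ball, dist_eq_norm, add_sub_cancel_left, norm_smul]
  refine lt_of_le_of_lt ?_ hv
  gcongr
  simpa using hz

/-- Cauchy's formula for a directional derivative. -/
theorem fderiv_apply_eq_intervalIntegral {f : E → F} {x v : E} {r δ : ℝ} (hr : 0 < r)
    (hv : r * ‖v‖ < δ) (hf : ∀ y ∈ ball x δ, DifferentiableAt ℂ f y) :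
    fderiv ℂ f x v = (2 * Real.pi * Complex.I : ℂ)⁻¹ • ∫ θ in (0 : ℝ)..2 * Real.pi,
      (deriv (circleMap 0 r) θ * (circleMap 0 r θ ^ 2)⁻¹) • f (x + circleMap 0 r θ • v) := by
  set g : ℂ → F := fun z => f (x + z • v) with hg
  have hgd : ∀ z : ℂ, x + z • v ∈ ball x δ → HasDerivAt g (fderiv ℂ f (x + z • v) v) z := by
    intro z hz
    have h1 := (hf _ hz).hasFDerivAt
    have h2 : HasDerivAt (fun z : ℂ => x + z • v) v z := by
      simpa using ((hasDerivAt_id z).smul_const v).const_add x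
    exact h1.comp_hasDerivAt z h2
  have h0 : (0 : ℂ) ∈ ball (0 : ℂ) r := by simpa using hr
  have h1 := (hgd 0 (add_smul_mem_ball hv (ball_subset_closedBall h0))).deriv
  rw [zero_smul, add_zero] at h1
  have h2 : deriv g 0 = (2 * Real.pi * Complex.I : ℂ)⁻¹ •
      ∮ z in C(0, r), ((z - 0) ^ 2)⁻¹ • g z := by
    have hU : IsOpen ((fun z : ℂ => x + z • v) ⁻¹' ball x δ) :=
      isOpen_ball.preimage (by fun_prop)
    exact (Complex.two_pi_I_inv_smul_circleIntegral_sub_sq_inv_smul_of_differentiable hU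
      (fun z hz => add_smul_mem_ball hv hz)
      (fun z hz => (hgd z hz).differentiableAt.differentiableWithinAt) h0).symm
  rw [← h1, h2, circleIntegral]
  simp only [sub_zero, smul_smul, hg]

theorem continuous_cauchyKernel {r : ℝ} (hr : 0 < r) :
    Continuous fun θ : ℝ => deriv (circleMap 0 r) θ * (circleMap 0 r θ ^ 2)⁻¹ := by
  have h0 : ∀ θ, circleMap 0 r θ ^ 2 ≠ 0 := fun θ =>
    pow_ne_zero 2 (circleMap_ne_center hr.ne')
  simp only [deriv_circleMap]
  exact ((continuous_circleMap 0 r).mul continuous_const).mul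
    (((continuous_circleMap 0 r).pow 2).inv₀ h0)

variable [FiniteDimensional ℂ E]

theorem exists_radius {Ω : Set E} (hΩ : IsOpen Ω) {x : E} (hx : x ∈ Ω) (v : E) :
    ∃ δ > 0, ∃ r > 0, r * ‖v‖ < δ ∧ closedBall x (2 * δ) ⊆ Ω := by
  obtain ⟨ε, hε, hball⟩ := nhds_basis_closedBall.mem_iff.1 (hΩ.mem_nhds hx)
  refine ⟨ε / 2, by positivity, ε / 2 / (‖v‖ + 1), by positivity, ?_, by
    rwa [mul_div_cancel₀ _ two_ne_zero]⟩
  rw [div_mul_eq_mul_div, div_lt_iff₀ (by positivity)]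
  gcongr
  linarith

theorem closedBall_two_mul_sub {x y : E} {δ : ℝ} (hy : y ∈ ball x δ) :
    closedBall y δ ⊆ closedBall x (2 * δ) := by
  apply closedBall_subset_closedBall'
  rw [mem_ball] at hy
  linarith

/-- The derivative is a circle integral which depends continuously on the point. -/
theorem continuousOn_fderiv_of_differentiableOn_complex {f : E → F} {Ω : Set E} (hΩ : IsOpen Ω)
    (hf : DifferentiableOn ℂ f Ω) : ContinuousOn (fderiv ℂ f) Ω := by
  have : ProperSpace E := FiniteDimensional.proper ℂ E
  rw [continuousOn_clm_apply]
  intro v x hx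
  obtain ⟨δ, hδ, r, hr, hrv, hball⟩ := exists_radius hΩ hx v
  have hfd : ∀ y ∈ closedBall x (2 * δ), DifferentiableAt ℂ f y := fun y hy =>
    hf.differentiableAt (hΩ.mem_nhds (hball hy))
  have hloc : ∀ᶠ y in 𝓝 x, fderiv ℂ f y v = (2 * Real.pi * Complex.I : ℂ)⁻¹ •
      ∫ θ in (0 : ℝ)..2 * Real.pi,
      (deriv (circleMap 0 r) θ * (circleMap 0 r θ ^ 2)⁻¹) • f (y + circleMap 0 r θ • v) := by
    filter_upwards [ball_mem_nhds x hδ] with y hy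
    exact fderiv_apply_eq_intervalIntegral hr hrv fun z hz =>
      hfd z (closedBall_two_mul_sub hy (ball_subset_closedBall hz))
  obtain ⟨M, hM⟩ := (isCompact_closedBall x (2 * δ)).exists_bound_of_continuousOn
    (f := f) (fun y hy => (hfd y hy).continuousAt.continuousWithinAt)
  have hmem : ∀ y ∈ ball x δ, ∀ θ, y + circleMap 0 r θ • v ∈ closedBall x (2 * δ) := fun y hy θ =>
    closedBall_two_mul_sub hy (ball_subset_closedBall (add_smul_mem_ball hrv
      (circleMap_mem_closedBall 0 hr.le θ)))
  have hcont : ContinuousAt (fun y => ∫ θ in (0 : ℝ)..2 * Real.pi,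
      (deriv (circleMap 0 r) θ * (circleMap 0 r θ ^ 2)⁻¹) • f (y + circleMap 0 r θ • v)) x := by
    apply intervalIntegral.continuousAt_of_dominated_interval
      (bound := fun θ => ‖deriv (circleMap 0 r) θ * (circleMap 0 r θ ^ 2)⁻¹‖ * M)
    · filter_upwards [ball_mem_nhds x hδ] with y hy
      refine Continuous.aestronglyMeasurable ?_
      refine (continuous_cauchyKernel hr).smul (continuous_iff_continuousAt.2 fun θ => ?_)
      exact (hfd _ (hmem y hy θ)).continuousAt.comp
        (f := fun θ => y + circleMap 0 r θ • v) (by fun_prop)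
    · filter_upwards [ball_mem_nhds x hδ] with y hy
      refine Eventually.of_forall fun θ _ => ?_
      rw [norm_smul]
      gcongr
      exact hM _ (hmem y hy θ)
    · exact ((continuous_cauchyKernel hr).norm.mul continuous_const).intervalIntegrable _ _
    · refine Eventually.of_forall fun θ _ => ?_
      refine ContinuousAt.smul continuousAt_const ?_
      exact (hfd _ (hmem x (mem_ball_self hδ) θ)).continuousAt.comp
        (f := fun y => y + circleMap 0 r θ • v) (by fun_prop)
  exact ((hcont.const_smul _).congr (hloc.mono fun y hy => hy.symm)).continuousWithinAt

/-- Differentiation under the integral sign in Cauchy's formula. -/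
theorem differentiableOn_fderiv_apply_of_complex {f : E → F} {Ω : Set E} (hΩ : IsOpen Ω)
    (hf : DifferentiableOn ℂ f Ω) (v : E) : DifferentiableOn ℂ (fun y => fderiv ℂ f y v) Ω := by
  have : ProperSpace E := FiniteDimensional.proper ℂ E
  have hcf := continuousOn_fderiv_of_differentiableOn_complex hΩ hf
  intro x hx
  obtain ⟨δ, hδ, r, hr, hrv, hball⟩ := exists_radius hΩ hx v
  have hfd : ∀ y ∈ closedBall x (2 * δ), DifferentiableAt ℂ f y := fun y hy =>
    hf.differentiableAt (hΩ.mem_nhds (hball hy))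
  have hloc : (fun y => fderiv ℂ f y v) =ᶠ[𝓝 x] fun y => (2 * Real.pi * Complex.I : ℂ)⁻¹ •
      ∫ θ in (0 : ℝ)..2 * Real.pi,
      (deriv (circleMap 0 r) θ * (circleMap 0 r θ ^ 2)⁻¹) • f (y + circleMap 0 r θ • v) := by
    filter_upwards [ball_mem_nhds x hδ] with y hy
    exact fderiv_apply_eq_intervalIntegral hr hrv fun z hz =>
      hfd z (closedBall_two_mul_sub hy (ball_subset_closedBall hz))
  obtain ⟨M, hM⟩ := (isCompact_closedBall x (2 * δ)).exists_bound_of_continuousOn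
    (f := fderiv ℂ f) (hcf.mono hball)
  have hmem : ∀ y ∈ ball x δ, ∀ θ, y + circleMap 0 r θ • v ∈ closedBall x (2 * δ) := fun y hy θ =>
    closedBall_two_mul_sub hy (ball_subset_closedBall (add_smul_mem_ball hrv
      (circleMap_mem_closedBall 0 hr.le θ)))
  have hint : ∀ y ∈ ball x δ, Continuous fun θ =>
      (deriv (circleMap 0 r) θ * (circleMap 0 r θ ^ 2)⁻¹) • f (y + circleMap 0 r θ • v) := by
    intro y hy
    refine (continuous_cauchyKernel hr).smul (continuous_iff_continuousAt.2 fun θ => ?_)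
    exact (hfd _ (hmem y hy θ)).continuousAt.comp
      (f := fun θ => y + circleMap 0 r θ • v) (by fun_prop)
  have hder := intervalIntegral.hasFDerivAt_integral_of_dominated_of_fderiv_le (𝕜 := ℂ)
    (μ := volume) (s := ball x δ) (x₀ := x) (a := 0) (b := 2 * Real.pi)
    (F := fun y θ => (deriv (circleMap 0 r) θ * (circleMap 0 r θ ^ 2)⁻¹) •
      f (y + circleMap 0 r θ • v))
    (F' := fun y θ => (deriv (circleMap 0 r) θ * (circleMap 0 r θ ^ 2)⁻¹) •
      fderiv ℂ f (y + circleMap 0 r θ • v))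
    (bound := fun θ => ‖deriv (circleMap 0 r) θ * (circleMap 0 r θ ^ 2)⁻¹‖ * M)
    (ball_mem_nhds x hδ)
    (by filter_upwards [ball_mem_nhds x hδ] with y hy
        exact (hint y hy).aestronglyMeasurable)
    ((hint x (mem_ball_self hδ)).intervalIntegrable _ _)
    (by refine Continuous.aestronglyMeasurable ?_
        refine (continuous_cauchyKernel hr).smul ?_
        exact (hcf.mono hball).comp_continuous (by fun_prop) (hmem x (mem_ball_self hδ)))
    (Eventually.of_forall fun θ _ y hy => by
      rw [norm_smul]
      gcongr
      exact hM _ (hmem y hy θ))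
    (((continuous_cauchyKernel hr).norm.mul continuous_const).intervalIntegrable _ _)
    (Eventually.of_forall fun θ _ y hy => by
      refine HasFDerivAt.const_smul ?_ _
      exact (hasFDerivAt_comp_add_right _).2 (hfd _ (hmem y hy θ)).hasFDerivAt)
  exact ((hder.differentiableAt.const_smul _).congr_of_eventuallyEq hloc).differentiableWithinAt

/-- In finite dimension, complex differentiability implies complex smoothness. -/
theorem contDiffOn_nat_of_differentiableOn_complex {Ω : Set E} (hΩ : IsOpen Ω) (k : ℕ) {f : E → F}
    (hf : DifferentiableOn ℂ f Ω) : ContDiffOn ℂ k f Ω := by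
  induction k generalizing f with
  | zero => exact contDiffOn_zero.2 hf.continuousOn
  | succ k ih =>
    rw [Nat.cast_succ, contDiffOn_succ_iff_fderiv_of_isOpen hΩ]
    refine ⟨hf, fun h => by simp at h, contDiffOn_clm_apply.2 fun v => ?_⟩
    exact ih (differentiableOn_fderiv_apply_of_complex hΩ hf v)

theorem differentiableAt_iteratedFDeriv_of_complex {Ω : Set E} (hΩ : IsOpen Ω) {f : E → F}
    (hf : DifferentiableOn ℂ f Ω) (k : ℕ) {x : E} (hx : x ∈ Ω) :
    DifferentiableAt ℂ (iteratedFDeriv ℂ k f) x :=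
  ((contDiffOn_nat_of_differentiableOn_complex hΩ (k + 1) hf).contDiffAt
    (hΩ.mem_nhds hx)).differentiableAt_iteratedFDeriv (by exact_mod_cast Nat.lt_succ_self k)

omit [FiniteDimensional ℂ E] in
/-- Cauchy's estimate for the derivative of a holomorphic function. -/
theorem norm_fderiv_le_of_forall_mem_ball {G : Type*} [NormedAddCommGroup G] [NormedSpace ℂ G]
    {f : E → G} {x : E} {δ M : ℝ} (hδ : 0 < δ) (hf : ∀ y ∈ closedBall x δ, DifferentiableAt ℂ f y)
    (hM : ∀ y ∈ closedBall x δ, ‖f y‖ ≤ M) : ‖fderiv ℂ f x‖ ≤ M / δ := by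
  have hM0 : 0 ≤ M := (norm_nonneg _).trans (hM x (mem_closedBall_self hδ.le))
  refine ContinuousLinearMap.opNorm_le_bound _ (by positivity) fun v => ?_
  rcases eq_or_ne v 0 with rfl | hv
  · simp
  have hvn : 0 < ‖v‖ := norm_pos_iff.2 hv
  have hr : 0 < δ / ‖v‖ := by positivity
  have hmem : ∀ z ∈ closedBall (0 : ℂ) (δ / ‖v‖), x + z • v ∈ closedBall x δ := by
    intro z hz
    rw [mem_closedBall, dist_eq_norm, add_sub_cancel_left, norm_smul]
    rw [mem_closedBall, dist_zero_right, le_div_iff₀ hvn] at hz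
    exact hz
  have hgd : ∀ z ∈ closedBall (0 : ℂ) (δ / ‖v‖),
      HasDerivAt (fun z : ℂ => f (x + z • v)) (fderiv ℂ f (x + z • v) v) z := by
    intro z hz
    have h1 := (hf _ (hmem z hz)).hasFDerivAt
    have h2 : HasDerivAt (fun z : ℂ => x + z • v) v z := by
      simpa using ((hasDerivAt_id z).smul_const v).const_add x
    exact h1.comp_hasDerivAt z h2
  have h := Complex.norm_deriv_le_of_forall_mem_sphere_norm_le (f := fun z : ℂ => f (x + z • v))
    (c := 0) (C := M) hr
    ⟨fun z hz => (hgd z (ball_subset_closedBall hz)).differentiableAt.differentiableWithinAt,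
      fun z hz => (hgd z (closure_ball_subset_closedBall hz)).continuousAt.continuousWithinAt⟩
    fun z hz => hM _ (hmem z (sphere_subset_closedBall hz))
  rw [(hgd 0 (mem_closedBall_self hr.le)).deriv, zero_smul, add_zero] at h
  calc _ ≤ M / (δ / ‖v‖) := h
    _ = M / δ * ‖v‖ := by field_simp

/-- Cauchy's estimates for all derivatives, by shrinking the ball `k` times. -/
theorem norm_iteratedFDeriv_le_of_complex {Ω : Set E} (hΩ : IsOpen Ω) {f : E → F}
    (hf : DifferentiableOn ℂ f Ω) {M δ : ℝ} (hδ : 0 < δ) (hM : ∀ y ∈ Ω, ‖f y‖ ≤ M) (k : ℕ) {x : E}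
    (hx : closedBall x (k * δ) ⊆ Ω) : ‖iteratedFDeriv ℂ k f x‖ ≤ M / δ ^ k := by
  induction k generalizing x with
  | zero =>
    simp only [norm_iteratedFDeriv_zero, pow_zero, div_one]
    exact hM x (hx (by simp))
  | succ k ih =>
    have hsub : ∀ y ∈ closedBall x δ, closedBall y (k * δ) ⊆ Ω := by
      intro y hy
      refine (closedBall_subset_closedBall' ?_).trans hx
      rw [mem_closedBall] at hy
      push_cast
      linarith
    have h := norm_fderiv_le_of_forall_mem_ball (f := iteratedFDeriv ℂ k f) (x := x)
      (M := M / δ ^ k) hδ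
      (fun y hy => differentiableAt_iteratedFDeriv_of_complex hΩ hf k
        (hsub y hy (mem_closedBall_self (by positivity))))
      fun y hy => ih (hsub y hy)
    rw [norm_fderiv_iteratedFDeriv] at h
    rwa [pow_succ, ← div_div]

theorem iteratedDeriv_comp_line {Ω : Set E} (hΩ : IsOpen Ω) {f : E → F}
    (hf : DifferentiableOn ℂ f Ω) (x y : E) (k : ℕ) {z : ℂ} (hz : x + z • y ∈ Ω) :
    iteratedDeriv k (fun z : ℂ => f (x + z • y)) z
      = iteratedFDeriv ℂ k f (x + z • y) fun _ => y := by
  induction k generalizing z with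
  | zero => simp
  | succ k ih =>
    have hev : ∀ᶠ w in 𝓝 z, x + w • y ∈ Ω :=
      (show Continuous fun w : ℂ => x + w • y by fun_prop).continuousAt.eventually
        (hΩ.mem_nhds hz)
    have h1 : iteratedDeriv k (fun z : ℂ => f (x + z • y)) =ᶠ[𝓝 z]
        fun w => iteratedFDeriv ℂ k f (x + w • y) fun _ => y := hev.mono fun w hw => ih hw
    rw [iteratedDeriv_succ, h1.deriv_eq, iteratedFDeriv_succ_apply_left]
    have h2 : HasDerivAt (fun z : ℂ => x + z • y) y z := by
      simpa using ((hasDerivAt_id z).smul_const y).const_add x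
    have h3 := (differentiableAt_iteratedFDeriv_of_complex hΩ hf k hz).hasFDerivAt.comp_hasDerivAt
      z h2
    have h4 := ((ContinuousMultilinearMap.apply ℂ (fun _ : Fin k => E) F
      (fun _ => y)).hasFDerivAt.comp_hasDerivAt z h3)
    have h5 := h4.deriv
    simp only [ContinuousMultilinearMap.apply_apply] at h5
    convert! h5 using 1

/-- A complex differentiable function on an open subset of a finite dimensional space is
analytic. -/
theorem analyticOnNhd_of_differentiableOn_complex {Ω : Set E} (hΩ : IsOpen Ω) {f : E → F}
    (hf : DifferentiableOn ℂ f Ω) : AnalyticOnNhd ℂ f Ω := by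
  have : ProperSpace E := FiniteDimensional.proper ℂ E
  intro x hx
  obtain ⟨R, hR, hball⟩ := nhds_basis_closedBall.mem_iff.1 (hΩ.mem_nhds hx)
  obtain ⟨M, hM⟩ := (isCompact_closedBall x R).exists_bound_of_continuousOn
    (hf.continuousOn.mono hball)
  have hM0 : 0 ≤ M := (norm_nonneg _).trans (hM x (mem_closedBall_self hR.le))
  have hfb : DifferentiableOn ℂ f (ball x R) := hf.mono (ball_subset_closedBall.trans hball)
  let p : FormalMultilinearSeries ℂ E F := fun k =>
    ((k.factorial : ℂ)⁻¹) • iteratedFDeriv ℂ k f x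
  -- Cauchy's estimates with `δ = R / (2 k)` give geometric growth, as `k ^ k / k! ≤ exp k`
  have hp : ∀ k, ‖p k‖ * (R / 6) ^ k ≤ M := by
    intro k
    rcases Nat.eq_zero_or_pos k with rfl | hk
    · simpa [p] using hM x (mem_closedBall_self hR.le)
    have hk' : (0 : ℝ) < k := by exact_mod_cast hk
    have h1 := norm_iteratedFDeriv_le_of_complex isOpen_ball hfb (M := M) (δ := R / (2 * k))
      (by positivity) (fun y hy => hM y (ball_subset_closedBall hy)) k (x := x)
      (closedBall_subset_ball (by field_simp; norm_num))
    have h2 : (k : ℝ) ^ k / k.factorial ≤ 3 ^ k := by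
      refine (Real.pow_div_factorial_le_exp k hk'.le k).trans ?_
      rw [← mul_one (k : ℝ), Real.exp_nat_mul]
      gcongr
      exact Real.exp_one_lt_three.le
    have h3 : ‖p k‖ = (k.factorial : ℝ)⁻¹ * ‖iteratedFDeriv ℂ k f x‖ := by
      simp [p, norm_smul]
    have hfac : (0 : ℝ) < k.factorial := by positivity
    calc ‖p k‖ * (R / 6) ^ k ≤ (k.factorial : ℝ)⁻¹ * (M / (R / (2 * k)) ^ k) * (R / 6) ^ k := by
          rw [h3]; gcongr
      _ = M * ((k : ℝ) ^ k / k.factorial) * (1 / 3) ^ k := by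
          have : (R / 6) ^ k = (R / (2 * k)) ^ k * ((k : ℝ) ^ k * (1 / 3) ^ k) := by
            rw [← mul_pow, ← mul_pow]; congr 1; field_simp; norm_num
          rw [this]
          field_simp
      _ ≤ M * 3 ^ k * (1 / 3) ^ k := by gcongr
      _ = M := by rw [mul_assoc, ← mul_pow]; norm_num
  refine ⟨p, ENNReal.ofReal (R / 6), ?_, by simpa using hR, ?_⟩
  · have := p.le_radius_of_bound (r := (R / 6).toNNReal) M
      (by rw [Real.coe_toNNReal _ (by positivity)]; exact hp)
    exact this
  · intro y hy
    rw [mem_eball, edist_zero_right, ← ofReal_norm, ENNReal.ofReal_lt_ofReal_iff (by positivity)]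
      at hy
    have hmem : ∀ z ∈ ball (0 : ℂ) 2, x + z • y ∈ ball x R := by
      intro z hz
      rw [mem_ball, dist_eq_norm, add_sub_cancel_left, norm_smul]
      rw [mem_ball, dist_zero_right] at hz
      nlinarith [norm_nonneg z, norm_nonneg y]
    have hd : DifferentiableOn ℂ (fun z : ℂ => f (x + z • y)) (ball 0 2) := by
      refine hfb.comp (fun z _ => ?_) hmem
      exact DifferentiableAt.differentiableWithinAt (by fun_prop)
    have hs := Complex.hasSum_taylorSeries_on_ball hd (z := 1) (by simp)
    simp only [sub_zero, one_pow, one_smul] at hs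
    refine hs.congr_fun ?_
    intro k
    rw [iteratedDeriv_comp_line isOpen_ball hfb x y k (by simpa using hR)]
    simp [p]

theorem contDiffOn_omega_of_differentiableOn_complex {Ω : Set E} (hΩ : IsOpen Ω) {f : E → F}
    (hf : DifferentiableOn ℂ f Ω) : ContDiffOn ℂ ω f Ω :=
  (contDiffOn_omega_iff_analyticOn hΩ.uniqueDiffOn).2
    (analyticOnNhd_of_differentiableOn_complex hΩ hf).analyticOn

end SeveralVariables

/-! ### Integral submanifolds of total differential equations -/

section Frobenius

open Filter Metric
open scoped NNReal

variable {W E : Type*} [NormedAddCommGroup W] [NormedSpace ℝ W]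
  [NormedAddCommGroup E] [NormedSpace ℝ E] [CompleteSpace E]

/-- The Picard–Lindelöf theorem with a solution on all of `[0, 1]`, which stays in the given
ball. -/
theorem exists_hasDerivWithinAt_Icc_of_lipschitzOnWith {f : E → E} {x₀ : E} {R K : ℝ≥0}
    (hf : ∀ x ∈ closedBall x₀ R, ‖f x‖ ≤ R) (hK : LipschitzOnWith K f (closedBall x₀ R)) :
    ∃ α : ℝ → E, α 0 = x₀ ∧ (∀ t, α t ∈ closedBall x₀ R) ∧ Continuous α ∧
      ∀ t ∈ Icc (0 : ℝ) 1, HasDerivWithinAt α (f (α t)) (Icc 0 1) t := by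
  have h : IsPicardLindelof (fun _ ↦ f) (tmin := 0) (tmax := 1) ⟨0, by simp⟩ x₀ R 0 R K :=
    .of_time_independent hf hK (by simp)
  obtain ⟨α, hα⟩ := ODE.FunSpace.exists_isFixedPt_next h (mem_closedBall_self le_rfl)
  refine ⟨α.compProj, ?_, fun t => α.compProj_mem_closedBall h.mul_max_le,
    α.continuous_compProj, fun t ht => ?_⟩
  · have h1 := ODE.FunSpace.compProj_val (α := α) (t := ⟨0, by simp⟩)
    rw [show ((⟨0, by simp⟩ : Icc (0 : ℝ) 1) : ℝ) = 0 from rfl] at h1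
    rw [h1, ← hα, ODE.FunSpace.next_apply₀]
  · apply ODE.hasDerivWithinAt_picard_Icc (t₀ := (0 : ℝ)) (by simp) h.continuousOn_uncurry
      α.continuous_compProj.continuousOn (fun _ ht' ↦ α.compProj_mem_closedBall h.mul_max_le)
      x₀ ht |>.congr_of_mem _ ht
    intro t' ht'
    nth_rw 1 [← hα]
    rw [ODE.FunSpace.compProj_of_mem ht', ODE.FunSpace.next_apply]

theorem eq_of_hasDerivWithinAt_zero_Icc {G : Type*} [NormedAddCommGroup G] [NormedSpace ℝ G]
    {α : ℝ → G} (h : ∀ t ∈ Icc (0 : ℝ) 1, HasDerivWithinAt α 0 (Icc 0 1) t) {t : ℝ}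
    (ht : t ∈ Icc (0 : ℝ) 1) : α t = α 0 :=
  constant_of_derivWithin_zero (fun t ht => (h t ht).differentiableWithinAt)
    (fun t ht => (h t (Ico_subset_Icc_self ht)).derivWithin
      (uniqueDiffOn_Icc zero_lt_one t (Ico_subset_Icc_self ht))) t ht

/-- The first variation of the solutions of `γ' = A(γ) z` with respect to `z`: integrability of `A`
along `γ` makes `γ + t A(γ) v` a solution of `γ' = A(γ) (z + v)` up to an error of order `‖v‖²`. -/
theorem norm_sub_sub_le_of_integrable {A : E → W →L[ℝ] E} {s : Set E} {M M₁ K₂ r : ℝ}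
    (hM : 0 ≤ M) (hM₁ : 0 ≤ M₁) (hK₂ : 0 ≤ K₂) (hr : 0 ≤ r) (hs : Convex ℝ s)
    (hA : ∀ x ∈ s, HasFDerivAt A (fderiv ℝ A x) x) (hAM : ∀ x ∈ s, ‖A x‖ ≤ M)
    (hAM₁ : ∀ x ∈ s, ‖fderiv ℝ A x‖ ≤ M₁)
    (hAK : ∀ x ∈ s, ∀ y ∈ s, ‖fderiv ℝ A x - fderiv ℝ A y‖ ≤ K₂ * ‖x - y‖)
    {z v : W} (hzv : ‖z + v‖ ≤ r) {γ η : ℝ → E} (h0 : γ 0 = η 0) (hγc : Continuous γ)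
    (hηc : Continuous η)
    (hγ : ∀ t ∈ Icc (0 : ℝ) 1, HasDerivWithinAt γ (A (γ t) z) (Icc 0 1) t)
    (hη : ∀ t ∈ Icc (0 : ℝ) 1, HasDerivWithinAt η (A (η t) (z + v)) (Icc 0 1) t)
    (hγs : ∀ t ∈ Icc (0 : ℝ) 1, γ t ∈ s) (hηs : ∀ t ∈ Icc (0 : ℝ) 1, η t ∈ s)
    (hγvs : ∀ t ∈ Icc (0 : ℝ) 1, γ t + t • A (γ t) v ∈ s)
    (hint : ∀ t ∈ Icc (0 : ℝ) 1, fderiv ℝ A (γ t) (A (γ t) v) z = fderiv ℝ A (γ t) (A (γ t) z) v) :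
    ‖η 1 - γ 1 - A (γ 1) v‖ ≤ (Real.exp (M₁ * r + 1) - 1) / (M₁ * r + 1)
      * (M₁ * M + K₂ * M ^ 2 * r) * ‖v‖ ^ 2 := by
  set K : ℝ≥0 := ⟨M₁ * r + 1, by positivity⟩ with hKdef
  have hK : (K : ℝ) = M₁ * r + 1 := rfl
  set ε : ℝ := (M₁ * M + K₂ * M ^ 2 * r) * ‖v‖ ^ 2 with hε
  have hlip : LipschitzOnWith K (fun x => A x (z + v)) s := by
    apply Convex.lipschitzOnWith_of_nnnorm_hasFDerivWithin_le (𝕜 := ℝ)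
      (f' := fun x => (fderiv ℝ A x).flip (z + v)) (fun x hx => ?_) (fun x hx => ?_) hs
    · have := (hA x hx).clm_apply (hasFDerivAt_const (z + v) x)
      simpa using this.hasFDerivWithinAt
    · rw [← NNReal.coe_le_coe, coe_nnnorm, hK]
      calc ‖(fderiv ℝ A x).flip (z + v)‖ ≤ ‖(fderiv ℝ A x).flip‖ * ‖z + v‖ :=
            ContinuousLinearMap.le_opNorm _ _
        _ ≤ M₁ * r := by
          rw [ContinuousLinearMap.opNorm_flip]
          exact mul_le_mul (hAM₁ x hx) hzv (norm_nonneg _) hM₁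
        _ ≤ _ := by linarith
  have hd : ∀ t ∈ Ico (0 : ℝ) 1, HasDerivWithinAt (fun t => γ t + t • A (γ t) v)
      (A (γ t) z + (t • fderiv ℝ A (γ t) (A (γ t) z) v + A (γ t) v)) (Icc 0 1) t := by
    intro t ht
    have ht' := Ico_subset_Icc_self ht
    have h1 := (hA _ (hγs t ht')).comp_hasDerivWithinAt t (hγ t ht')
    have h2 := h1.clm_apply (hasDerivWithinAt_const t (Icc 0 1) v)
    have h3 := (hasDerivWithinAt_id t (Icc 0 1)).smul h2
    convert! (hγ t ht').add h3 using 1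
    simp
  have hbound : ∀ t ∈ Ico (0 : ℝ) 1,
      dist (A (γ t) z + (t • fderiv ℝ A (γ t) (A (γ t) z) v + A (γ t) v))
        (A (γ t + t • A (γ t) v) (z + v)) ≤ ε := by
    intro t ht
    have ht' := Ico_subset_Icc_self ht
    set x := γ t with hx
    set y := t • A x v with hy
    have hxs : x ∈ s := hγs t ht'
    have hAv : ‖A x v‖ ≤ M * ‖v‖ := (A x).le_of_opNorm_le (hAM x hxs) v
    have hyn : ‖y‖ ≤ M * ‖v‖ := by
      rw [hy, norm_smul, Real.norm_eq_abs, abs_of_nonneg ht.1]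
      calc t * ‖A x v‖ ≤ 1 * ‖A x v‖ := by gcongr; exact ht.2.le
        _ ≤ _ := by rw [one_mul]; exact hAv
    have hseg : segment ℝ x (x + y) ⊆ s := hs.segment_subset hxs (hγvs t ht')
    have he : ‖A (x + y) - A x - fderiv ℝ A x (x + y - x)‖ ≤ K₂ * ‖y‖ * ‖x + y - x‖ := by
      apply Convex.norm_image_sub_le_of_norm_hasFDerivWithin_le' (𝕜 := ℝ)
        (s := segment ℝ x (x + y)) (f' := fun w => fderiv ℝ A w)
        (fun w hw => (hA w (hseg hw)).hasFDerivWithinAt) (fun w hw => ?_) (convex_segment _ _)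
        (left_mem_segment ℝ _ _) (right_mem_segment ℝ _ _)
      refine (hAK w (hseg hw) x hxs).trans ?_
      gcongr
      have := norm_sub_le_of_mem_segment hw
      simpa using this
    rw [add_sub_cancel_left] at he
    have hid : A x z + (t • fderiv ℝ A x (A x z) v + A x v) - A (x + y) (z + v)
        = -(t • fderiv ℝ A x (A x v) v) - (A (x + y) - A x - fderiv ℝ A x y) (z + v) := by
      have h1 := hint t ht'
      simp only [sub_apply, map_add, hy, map_smul, smul_apply]
      rw [← hx] at h1
      rw [h1]
      module
    rw [dist_eq_norm, hid]
    have h1 : ‖t • fderiv ℝ A x (A x v) v‖ ≤ M₁ * M * ‖v‖ ^ 2 := by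
      rw [norm_smul, Real.norm_eq_abs, abs_of_nonneg ht.1]
      calc t * ‖fderiv ℝ A x (A x v) v‖ ≤ 1 * ‖fderiv ℝ A x (A x v) v‖ := by
            gcongr; exact ht.2.le
        _ ≤ ‖fderiv ℝ A x (A x v)‖ * ‖v‖ := by rw [one_mul]; exact ContinuousLinearMap.le_opNorm _ _
        _ ≤ (M₁ * (M * ‖v‖)) * ‖v‖ := by
            gcongr
            exact ((fderiv ℝ A x).le_of_opNorm_le (hAM₁ x hxs) _).trans (by gcongr)
        _ = _ := by ring
    have h2 : ‖(A (x + y) - A x - fderiv ℝ A x y) (z + v)‖ ≤ K₂ * M ^ 2 * r * ‖v‖ ^ 2 := by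
      calc _ ≤ ‖A (x + y) - A x - fderiv ℝ A x y‖ * ‖z + v‖ := ContinuousLinearMap.le_opNorm _ _
        _ ≤ (K₂ * (M * ‖v‖) * (M * ‖v‖)) * r := by
            gcongr
            exact he.trans (by gcongr)
        _ = _ := by ring
    calc _ ≤ ‖-(t • fderiv ℝ A x (A x v) v)‖ + _ := norm_sub_le _ _
      _ ≤ M₁ * M * ‖v‖ ^ 2 + K₂ * M ^ 2 * r * ‖v‖ ^ 2 := by rw [norm_neg]; gcongr
      _ = ε := by rw [hε]; ring
  have hIci : ∀ {α : ℝ → E} {α' : E} {t : ℝ}, t ∈ Ico (0 : ℝ) 1 →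
      HasDerivWithinAt α α' (Icc 0 1) t → HasDerivWithinAt α α' (Ici t) t := by
    intro α α' t ht h
    have h1 := h.mono (Icc_subset_Icc_left ht.1)
    exact h1.mono_of_mem_nhdsWithin (Icc_mem_nhdsGE ht.2)
  have hg := dist_le_of_approx_trajectories_ODE_of_mem (a := 0) (b := 1) (K := K) (εf := ε)
    (εg := 0) (δ := 0) (v := fun _ x => A x (z + v)) (s := fun _ => s)
    (f := fun t => γ t + t • A (γ t) v) (g := η)
    (fun t _ => hlip) (fun t ht => ?_) (fun t ht => hIci ht (hd t ht)) hbound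
    (fun t ht => hγvs t (Ico_subset_Icc_self ht)) hηc.continuousOn
    (fun t ht => hIci ht (hη t (Ico_subset_Icc_self ht))) (fun t _ => by simp)
    (fun t ht => hηs t (Ico_subset_Icc_self ht)) (by simp [h0]) 1 (by simp)
  · rw [gronwallBound_of_K_ne_0 (by rw [hK]; positivity), hK] at hg
    rw [dist_comm, dist_eq_norm] at hg
    simp only [one_smul, zero_mul, zero_add, add_zero, sub_zero, mul_one] at hg
    rw [sub_sub]
    refine hg.trans (le_of_eq ?_)
    rw [hε]; ring
  · have h1 : ContinuousWithinAt A s (γ t) := (hA _ (hγs t ht)).continuousAt.continuousWithinAt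
    have h2 : ContinuousWithinAt (fun t => A (γ t)) (Icc 0 1) t :=
      ((hA _ (hγs t ht)).continuousAt.comp hγc.continuousAt).continuousWithinAt
    exact hγc.continuousWithinAt.add
      (continuousWithinAt_id.smul (h2.clm_apply continuousWithinAt_const))

theorem eventually_norm_lt_add_one {V G : Type*} [TopologicalSpace V] [NormedAddCommGroup G]
    {f : V → G} {x₀ : V} (hf : ContinuousAt f x₀) : ∀ᶠ x in 𝓝 x₀, ‖f x‖ < ‖f x₀‖ + 1 :=
  hf.norm.tendsto.eventually (gt_mem_nhds (lt_add_one _))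

set_option synthInstance.maxHeartbeats 100000 in
/-- Frobenius' theorem for a total differential equation `dφ = A(φ)` which is integrable along
the zero set of a first integral `ρ`: it has a local solution with values in `{ρ = 0}`. -/
theorem exists_hasFDerivAt_of_integrable {A : E → W →L[ℝ] E} {ρ : E → ℝ} {x₀ : E}
    (hA : ContDiffAt ℝ 2 A x₀) (hρ : ContDiffAt ℝ 1 ρ x₀) (h₀ : ρ x₀ = 0)
    (htan : ∀ᶠ x in 𝓝 x₀, ∀ z, fderiv ℝ ρ x (A x z) = 0)
    (hint : ∀ᶠ x in 𝓝 x₀, ρ x = 0 → ∀ v z, fderiv ℝ A x (A x v) z = fderiv ℝ A x (A x z) v) :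
    ∃ r > 0, ∃ φ : W → E, φ 0 = x₀ ∧
      ∀ z ∈ ball (0 : W) r, HasFDerivAt φ (A (φ z)) z ∧ ρ (φ z) = 0 := by
  have hA1 : ContDiffAt ℝ 1 (fderiv ℝ A) x₀ := hA.fderiv_right le_rfl
  obtain ⟨K₂, s₂, hs₂, hK₂⟩ := hA1.exists_lipschitzOnWith
  have e1 : ∀ᶠ x in 𝓝 x₀, ‖A x‖ < ‖A x₀‖ + 1 :=
    eventually_norm_lt_add_one hA.continuousAt
  have e2 : ∀ᶠ x in 𝓝 x₀, ‖fderiv ℝ A x‖ < ‖fderiv ℝ A x₀‖ + 1 :=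
    eventually_norm_lt_add_one hA1.continuousAt
  have e3 := hA.eventually (by simp)
  have e4 := hρ.eventually (by simp)
  obtain ⟨R, hR, hball⟩ := nhds_basis_closedBall.mem_iff.1
    (inter_mem hs₂ (e1.and (e2.and (e3.and (e4.and (htan.and hint))))))
  set M := ‖A x₀‖ + 1 with hM
  set M₁ := ‖fderiv ℝ A x₀‖ + 1 with hM₁
  have hM0 : 0 < M := by positivity
  have hM₁0 : 0 < M₁ := by positivity
  -- for `‖z‖ < r` the solutions stay in the ball of radius `R / 2` up to time `1`
  set r := R / (2 * M) with hr
  have hr0 : 0 < r := by positivity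
  have hMr : M * r = R / 2 := by rw [hr]; field_simp
  have hhalf : closedBall x₀ (R / 2) ⊆ closedBall x₀ R := closedBall_subset_closedBall (by linarith)
  have hAd : ∀ x ∈ closedBall x₀ R, HasFDerivAt A (fderiv ℝ A x) x := fun x hx =>
    ((hball hx).2.2.2.1.differentiableAt two_ne_zero).hasFDerivAt
  have hAM : ∀ x ∈ closedBall x₀ R, ‖A x‖ ≤ M := fun x hx => (hball hx).2.1.le
  have hAM₁ : ∀ x ∈ closedBall x₀ R, ‖fderiv ℝ A x‖ ≤ M₁ := fun x hx => (hball hx).2.2.1.le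
  have hsol : ∀ z : W, ∃ α : ℝ → E, z ∈ ball (0 : W) r → α 0 = x₀ ∧
      (∀ t, α t ∈ closedBall x₀ (R / 2)) ∧ Continuous α ∧
      ∀ t ∈ Icc (0 : ℝ) 1, HasDerivWithinAt α (A (α t) z) (Icc 0 1) t := by
    intro z
    by_cases hz : z ∈ ball (0 : W) r
    · have hz' : ‖z‖ ≤ r := by simpa using (mem_ball.1 hz).le
      set R' : ℝ≥0 := ⟨R / 2, by positivity⟩
      set K : ℝ≥0 := ⟨M₁ * r, by positivity⟩
      have hlip : LipschitzOnWith K (fun x => A x z) (closedBall x₀ R') := by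
        apply Convex.lipschitzOnWith_of_nnnorm_hasFDerivWithin_le (𝕜 := ℝ)
          (f' := fun x => (fderiv ℝ A x).flip z) (fun x hx => ?_) (fun x hx => ?_)
          (convex_closedBall _ _)
        · have := (hAd x (hhalf hx)).clm_apply (hasFDerivAt_const z x)
          simpa using this.hasFDerivWithinAt
        · rw [← NNReal.coe_le_coe, coe_nnnorm]
          calc ‖(fderiv ℝ A x).flip z‖ ≤ ‖(fderiv ℝ A x).flip‖ * ‖z‖ :=
                ContinuousLinearMap.le_opNorm _ _
            _ ≤ M₁ * r := by
              rw [ContinuousLinearMap.opNorm_flip]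
              exact mul_le_mul (hAM₁ x (hhalf hx)) hz' (norm_nonneg _) hM₁0.le
      obtain ⟨α, h1, h2, h3, h4⟩ := exists_hasDerivWithinAt_Icc_of_lipschitzOnWith
        (f := fun x => A x z) (x₀ := x₀) (R := R') (fun x hx => by
          calc ‖A x z‖ ≤ M * ‖z‖ := (A x).le_of_opNorm_le (hAM x (hhalf hx)) z
            _ ≤ M * r := by gcongr
            _ = R / 2 := hMr) hlip
      exact ⟨α, fun _ => ⟨h1, h2, h3, h4⟩⟩
    · exact ⟨fun _ => x₀, fun h => absurd h hz⟩
  choose α hα using hsol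
  have hρα : ∀ z ∈ ball (0 : W) r, ∀ t ∈ Icc (0 : ℝ) 1, ρ (α z t) = 0 := by
    intro z hz t ht
    obtain ⟨h1, h2, h3, h4⟩ := hα z hz
    have h5 : ∀ t ∈ Icc (0 : ℝ) 1, HasDerivWithinAt (fun t => ρ (α z t)) 0 (Icc 0 1) t := by
      intro t ht
      have hb := (hball (hhalf (h2 t))).2.2.2.2
      have := (hb.1.differentiableAt one_ne_zero).hasFDerivAt.comp_hasDerivWithinAt t (h4 t ht)
      rwa [hb.2.1] at this
    have h6 := eq_of_hasDerivWithinAt_zero_Icc h5 ht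
    simpa [h1, h₀] using h6
  -- the value at time `1` of the solution of `γ' = A(γ) z`, that is, the solution along the ray
  -- through `z`
  refine ⟨r, hr0, fun z => α z 1, ?_, fun z hz => ⟨?_, hρα z hz 1 (by simp)⟩⟩
  · obtain ⟨h1, h2, h3, h4⟩ := hα 0 (by simpa using hr0)
    have h5 := eq_of_hasDerivWithinAt_zero_Icc (α := α 0) (fun t ht => by simpa using h4 t ht)
      (t := 1) (by simp)
    simpa [h1] using h5
  · obtain ⟨h1, h2, h3, h4⟩ := hα z hz
    rw [hasFDerivAt_iff_isLittleO_nhds_zero]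
    refine Asymptotics.IsBigO.trans_isLittleO (g := fun v : W => ‖v‖ ^ 2) ?_
      (Asymptotics.isLittleO_norm_pow_id one_lt_two)
    refine Asymptotics.IsBigO.of_bound ((Real.exp (M₁ * r + 1) - 1) / (M₁ * r + 1)
      * (M₁ * M + K₂ * M ^ 2 * r)) ?_
    have hzv : ∀ᶠ v : W in 𝓝 0, z + v ∈ ball (0 : W) r := by
      have : Tendsto (fun v : W => z + v) (𝓝 0) (𝓝 z) := by
        simpa using (show Continuous fun v : W => z + v by fun_prop).tendsto 0
      exact this (isOpen_ball.mem_nhds hz)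
    filter_upwards [hzv, ball_mem_nhds (0 : W) hr0] with v hv hvr
    obtain ⟨k1, k2, k3, k4⟩ := hα (z + v) hv
    have hvr' : ‖v‖ ≤ r := by simpa using (mem_ball.1 hvr).le
    have key := norm_sub_sub_le_of_integrable (A := A) (s := closedBall x₀ R) hM0.le hM₁0.le
      K₂.coe_nonneg hr0.le (convex_closedBall _ _) hAd hAM hAM₁
      (fun x hx y hy => by
        simpa [dist_eq_norm] using hK₂.dist_le_mul x (hball hx).1 y (hball hy).1)
      (z := z) (v := v) (by simpa using (mem_ball.1 hv).le) (γ := α z) (η := α (z + v))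
      (by rw [h1, k1]) h3 k3 h4 k4 (fun t _ => hhalf (h2 t)) (fun t _ => hhalf (k2 t))
      (fun t ht => ?_)
      (fun t ht => (hball (hhalf (h2 t))).2.2.2.2.2.2 (hρα z hz t ht) v z)
    · rw [norm_pow, norm_norm]
      exact key
    · have h5 := mem_closedBall_iff_norm.1 (h2 t)
      have h6 : ‖t • A (α z t) v‖ ≤ R / 2 := by
        rw [norm_smul, Real.norm_eq_abs, abs_of_nonneg ht.1]
        calc t * ‖A (α z t) v‖ ≤ 1 * ‖A (α z t) v‖ := by gcongr; exact ht.2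
          _ ≤ M * ‖v‖ := by rw [one_mul]; exact (A _).le_of_opNorm_le (hAM _ (hhalf (h2 t))) v
          _ ≤ M * r := by gcongr
          _ = R / 2 := hMr
      rw [mem_closedBall_iff_norm]
      calc ‖α z t + t • A (α z t) v - x₀‖ = ‖(α z t - x₀) + t • A (α z t) v‖ := by
            congr 1; abel
        _ ≤ ‖α z t - x₀‖ + ‖t • A (α z t) v‖ := norm_add_le _ _
        _ ≤ R := by linarith

end Frobenius

/-! ### Leaves of the Levi foliation -/

section Leaves

open Filter Metric

variable {E V : Type*} [NormedAddCommGroup E] [NormedSpace ℂ E] [NormedSpace ℝ E]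
  [IsScalarTower ℝ ℂ E] [NormedAddCommGroup V] [NormedSpace ℂ V] [NormedSpace ℝ V]
  [IsScalarTower ℝ ℂ V]

/-- Derivative with respect to the base point of the projection of a fixed vector to the complex
tangent space. -/
theorem fderiv_leviProj {ρ : E → ℝ} {x e : E} (hρ : ContDiffAt ℝ 2 ρ x)
    (he : twoDel ρ x e ≠ 0) (u y : E) :
    fderiv ℝ (fun x => leviProj ρ e x u) x y
      = -((((fderiv ℝ (fderiv ℝ ρ) x y (leviProj ρ e x u) : ℝ) : ℂ)
        - Complex.I * (fderiv ℝ (fderiv ℝ ρ) x y (Complex.I • leviProj ρ e x u) : ℝ))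
          / twoDel ρ x e) • e := by
  have hD : DifferentiableAt ℝ (fderiv ℝ ρ) x :=
    (hρ.fderiv_right (m := 1) le_rfl).differentiableAt one_ne_zero
  have hinv := (hasDerivAt_inv he).comp_hasFDerivAt (𝕜 := ℝ) (𝕜' := ℂ) x
    (hasFDerivAt_twoDel hD e)
  have hq := (((hasFDerivAt_twoDel hD u).mul hinv).smul_const e).const_sub u
  have hfun : (fun x => leviProj ρ e x u) = fun x => u -
      ((fun x => twoDel ρ x u) * (Inv.inv ∘ fun x => twoDel ρ x e)) x • e := by
    funext x; simp [leviProj, div_eq_mul_inv]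
  -- complex linearity of `w ↦ D²ρ(y, w) - i D²ρ(y, iw)`
  have hlin : ∀ w, twoDel (fderiv ℝ (fderiv ℝ ρ) x y) 0 w
      = ((fderiv ℝ (fderiv ℝ ρ) x y w : ℝ) : ℂ)
        - Complex.I * (fderiv ℝ (fderiv ℝ ρ) x y (Complex.I • w) : ℝ) := by
    intro w
    rw [twoDel, ContinuousLinearMap.fderiv]
  have hsub := map_sub (twoDelₗ (fderiv ℝ (fderiv ℝ ρ) x y) 0) u
    ((twoDel ρ x u / twoDel ρ x e) • e)
  rw [map_smul] at hsub
  change twoDel _ _ (leviProj ρ e x u) = twoDel _ _ u - _ • twoDel _ _ e at hsub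
  rw [← hlin, hsub, hlin, hlin, hfun, hq.fderiv]
  simp only [neg_apply, ContinuousLinearMap.smulRight_apply, add_apply, smul_apply,
    sub_apply, ContinuousLinearMap.comp_apply, ContinuousLinearMap.flip_apply,
    Complex.ofRealCLM_apply, smul_eq_mul, Function.comp_apply]
  rw [← neg_smul]
  congr 1
  field_simp
  ring

/-- Integrability of the complex tangent distribution along a Levi flat hypersurface. -/
theorem fderiv_leviProj_comm {ρ : E → ℝ} {x e : E} (hρ : ContDiffAt ℝ 2 ρ x)
    (he : twoDel ρ x e ≠ 0) (hflat : ∀ u, twoDel ρ x u = 0 → leviH ρ x u = 0) (u w : E) :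
    fderiv ℝ (fun x => leviProj ρ e x w) x (leviProj ρ e x u)
      = fderiv ℝ (fun x => leviProj ρ e x u) x (leviProj ρ e x w) := by
  have hu := twoDel_leviProj he u
  have hw := twoDel_leviProj he w
  rw [fderiv_leviProj hρ he, fderiv_leviProj hρ he]
  set U := leviProj ρ e x u
  set Z := leviProj ρ e x w
  have hIZ : twoDel ρ x (Complex.I • Z) = 0 := by rw [twoDel_smul, hw, mul_zero]
  have h1 : leviB ρ x U (Complex.I • Z) = 0 :=
    leviB_eq_zero_of_leviH hρ (hflat _ hu) (hflat _ hIZ)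
      (hflat _ (by rw [twoDel_add, hu, hIZ, add_zero]))
  have hs := hρ.isSymmSndFDerivAt (by simp)
  rw [leviB, I_smul_I_smul, map_neg] at h1
  rw [hs.eq Z U, hs.eq Z (Complex.I • U), ← sub_eq_zero.1 (by rw [← h1]; ring :
    fderiv ℝ (fderiv ℝ ρ) x U (Complex.I • Z) - fderiv ℝ (fderiv ℝ ρ) x (Complex.I • U) Z = 0)]

/-- The complex linear map `ζ ↦ P_x(ι ζ)`, where `P_x` is the projection to the complex tangent
space of the level set of `ρ` along `e`. -/
def leviField [FiniteDimensional ℂ V] (ρ : E → ℝ) (e : E) (ι : V →ₗ[ℂ] E) (x : E) : V →L[ℂ] E :=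
  LinearMap.toContinuousLinearMap
    (ι - (((twoDel ρ x e)⁻¹ • twoDelₗ ρ x).smulRight e).comp ι)

theorem leviField_apply [FiniteDimensional ℂ V] (ρ : E → ℝ) (e : E) (ι : V →ₗ[ℂ] E) (x : E)
    (ζ : V) : leviField ρ e ι x ζ = leviProj ρ e x (ι ζ) := by
  simp [leviField, leviProj, twoDelₗ, div_eq_inv_mul]

/-- Through each point of a Levi flat hypersurface of class `C³` passes a complex hypersurface
contained in it: a holomorphic immersion `φ` with `ρ ∘ φ = 0` and with prescribed derivative at the
origin. -/
theorem exists_leaf [FiniteDimensional ℂ V] [CompleteSpace E] {ρ : E → ℝ} {x₀ e : E}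
    (hρ : ContDiffAt ℝ 3 ρ x₀) (h₀ : ρ x₀ = 0) (he : twoDel ρ x₀ e = 1)
    (hflat : ∀ᶠ x in 𝓝 x₀, ρ x = 0 → ∀ u, twoDel ρ x u = 0 → leviH ρ x u = 0)
    (ι : V →ₗ[ℂ] E) (hι : Function.Injective ι) (hker : ∀ ζ, twoDel ρ x₀ (ι ζ) = 0)
    {Ω : Set E} (hΩ : Ω ∈ 𝓝 x₀) :
    ∃ B : Set V, IsOpen B ∧ (0 : V) ∈ B ∧ ∃ φ : V → E, φ 0 = x₀ ∧ ContDiffOn ℂ ω φ B ∧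
      (∀ ζ, fderiv ℂ φ 0 ζ = ι ζ) ∧
      ∀ b ∈ B, φ b ∈ Ω ∧ ρ (φ b) = 0 ∧ Function.Injective (fderiv ℂ φ b) := by
  have : FiniteDimensional ℝ V := .trans ℝ ℂ V
  have he0 : twoDel ρ x₀ e ≠ 0 := by rw [he]; exact one_ne_zero
  have hne : ∀ᶠ x in 𝓝 x₀, twoDel ρ x e ≠ 0 :=
    (hρ.twoDel (a := fun x => x) (b := fun _ => e) (m := 1) (by norm_num) contDiffAt_id
      contDiffAt_const).continuousAt.eventually_ne he0
  have hC : ∀ᶠ x in 𝓝 x₀, ContDiffAt ℝ 3 ρ x := hρ.eventually (by simp)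
  set A : E → V →L[ℝ] E := fun x => (leviField ρ e ι x).restrictScalars ℝ with hAdef
  have hAapp : ∀ x ζ, A x ζ = leviProj ρ e x (ι ζ) := fun x ζ => leviField_apply ρ e ι x ζ
  have hAC : ∀ x, ContDiffAt ℝ 3 ρ x → twoDel ρ x e ≠ 0 → ∀ u,
      ContDiffAt ℝ 2 (fun x => leviProj ρ e x u) x := fun x hx hx' u =>
    hx.leviProj (a := fun x => x) (b := fun _ => u) (by norm_num) hx' contDiffAt_id
      contDiffAt_const
  have hA : ContDiffAt ℝ 2 A x₀ := by
    obtain ⟨s, hs, hso, hxs⟩ := _root_.eventually_nhds_iff.1 (hne.and hC)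
    have h1 : ContDiffOn ℝ 2 A s := contDiffOn_clm_apply.2 fun ζ x hx => by
      simp only [hAapp]
      exact (hAC x (hs x hx).2 (hs x hx).1 _).contDiffWithinAt
    exact h1.contDiffAt (hso.mem_nhds hxs)
  have hfA : ∀ x, DifferentiableAt ℝ A x → ∀ y ζ,
      fderiv ℝ A x y ζ = fderiv ℝ (fun x => leviProj ρ e x (ι ζ)) x y := by
    intro x hx y ζ
    have h1 := hx.hasFDerivAt.clm_apply (hasFDerivAt_const ζ x)
    simp only [hAapp] at h1
    rw [h1.fderiv]
    simp
  have htan : ∀ᶠ x in 𝓝 x₀, ∀ z, fderiv ℝ ρ x (A x z) = 0 := by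
    filter_upwards [hne] with x hx z
    rw [hAapp, ← twoDel_re, twoDel_leviProj hx, Complex.zero_re]
  have hint : ∀ᶠ x in 𝓝 x₀, ρ x = 0 →
      ∀ v z, fderiv ℝ A x (A x v) z = fderiv ℝ A x (A x z) v := by
    filter_upwards [hne, hC, hflat, hA.eventually (by simp)] with x h1 h2 h3 h4 h5 v z
    have h6 := h4.differentiableAt two_ne_zero
    rw [hfA x h6, hfA x h6, hAapp, hAapp]
    exact fderiv_leviProj_comm (h2.of_le (by norm_num)) h1 (h3 h5) _ _
  obtain ⟨r, hr, φ, hφ0, hφ⟩ := exists_hasFDerivAt_of_integrable hA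
    (hρ.of_le (by norm_num)) h₀ htan hint
  have hφc : ∀ z ∈ ball (0 : V) r, HasFDerivAt φ (leviField ρ e ι (φ z)) z := fun z hz =>
    (hφ z hz).1.congr_fderiv rfl |> hasFDerivAt_of_restrictScalars ℝ <| rfl
  have hcont : ContinuousOn φ (ball 0 r) := fun z hz =>
    (hφc z hz).continuousAt.continuousWithinAt
  obtain ⟨Ω', hΩ', hΩo, hxΩ⟩ := _root_.mem_nhds_iff.1 hΩ
  have hB : IsOpen (ball (0 : V) r ∩ φ ⁻¹' Ω') := hcont.isOpen_inter_preimage isOpen_ball hΩo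
  refine ⟨_, hB, ⟨by simpa using hr, by simpa [hφ0] using hxΩ⟩, φ, hφ0, ?_, ?_, ?_⟩
  -- `A` has complex linear values, so `φ` is complex differentiable
  · exact contDiffOn_omega_of_differentiableOn_complex hB fun z hz =>
      (hφc z hz.1).differentiableAt.differentiableWithinAt
  · intro ζ
    rw [(hφc 0 (by simpa using hr)).fderiv, hφ0, leviField_apply, leviProj, hker]
    simp
  · rintro b ⟨hb, hbΩ⟩
    refine ⟨hΩ' hbΩ, (hφ b hb).2, ?_⟩
    rw [(hφc b hb).fderiv]
    refine (injective_iff_map_eq_zero _).2 fun ζ hζ => ?_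
    rw [leviField_apply, leviProj, sub_eq_zero] at hζ
    have h1 := hker ζ
    rw [hζ, twoDel_smul, he, mul_one] at h1
    rw [h1, zero_smul] at hζ
    exact hι (by rw [hζ, map_zero])

end Leaves

/-! ### Reading differential forms in a fixed chart -/

section Charts

open Filter

variable {n : ℕ} {X : Type*} [TopologicalSpace X] [ChartedSpace (Cn n) X]
  [IsManifold 𝓘(ℂ, Cn n) ω X]

/-- The coordinates, in the chart at `p`, of tangent vectors at `x`, which are given by their
coordinates in the preferred chart at `x`. -/
def chartDeriv (p x : X) : Cn n →L[ℂ] Cn n :=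
  fderiv ℂ (chartAt (Cn n) p ∘ (chartAt (Cn n) x).symm) (chartAt (Cn n) x x)

theorem chartDeriv_eq_tangentCoordChange (p x : X) :
    chartDeriv p x = tangentCoordChange 𝓘(ℂ, Cn n) x p x := by
  rw [tangentCoordChange_def]
  simp [chartDeriv, fderivWithin_univ]

theorem contDiffAt_chart_comp_symm {p x : X} (hx : x ∈ (chartAt (Cn n) p).source) :
    ContDiffAt ℂ ω (chartAt (Cn n) p ∘ (chartAt (Cn n) x).symm) (chartAt (Cn n) x x) := by
  have h := contDiffWithinAt_ext_coord_change (I := 𝓘(ℂ, Cn n)) (n := ω) p x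
    (y := chartAt (Cn n) x x) (by simp [hx])
  simpa [contDiffWithinAt_univ] using h

theorem chartDeriv_bijective {p x : X} (hx : x ∈ (chartAt (Cn n) p).source) :
    Function.Bijective (chartDeriv (n := n) p x) := by
  have hx' : x ∈ (extChartAt 𝓘(ℂ, Cn n) p).source := by simpa using hx
  have hxx : x ∈ (extChartAt 𝓘(ℂ, Cn n) x).source := by simp
  rw [chartDeriv_eq_tangentCoordChange]
  refine ⟨Function.LeftInverse.injective (g := tangentCoordChange 𝓘(ℂ, Cn n) p x x) fun u => ?_,
    Function.RightInverse.surjective (g := tangentCoordChange 𝓘(ℂ, Cn n) p x x) fun u => ?_⟩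
  · rw [tangentCoordChange_comp ⟨⟨hxx, hx'⟩, hxx⟩, tangentCoordChange_self hxx]
  · rw [tangentCoordChange_comp ⟨⟨hx', hxx⟩, hx'⟩, tangentCoordChange_self hx']

theorem tangentCoordChange_real_apply {p x : X} (hx : x ∈ (chartAt (Cn n) p).source) (u : Cn n) :
    tangentCoordChange 𝓘(ℝ, Cn n) x p x u = chartDeriv p x u := by
  rw [tangentCoordChange_def]
  simp only [modelWithCornersSelf_coe, range_id, fderivWithin_univ, extChartAt, mfld_simps]
  rw [((contDiffAt_chart_comp_symm hx).differentiableAt (by simp)).fderiv_restrictScalars ℝ]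
  rfl

theorem contMDiffAt_iff_chart {k : WithTop ℕ∞} {F : Type*} [NormedAddCommGroup F] [NormedSpace ℝ F]
    {f : X → F} {p x : X} (hx : x ∈ (chartAt (Cn n) p).source) :
    ContMDiffAt 𝓘(ℝ, Cn n) 𝓘(ℝ, F) k f x ↔
      ContDiffAt ℝ k (f ∘ (chartAt (Cn n) p).symm) (chartAt (Cn n) p x) := by
  have : IsManifold 𝓘(ℝ, Cn n) k X := .of_le (n := ω) le_top
  rw [contMDiffAt_iff_source_of_mem_source hx]
  simp only [modelWithCornersSelf_coe, range_id, extChartAt, mfld_simps]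
  exact contMDiffAt_iff_contDiffAt

theorem comp_symm_eventuallyEq {α : Type*} (f : X → α) {p x : X}
    (hx : x ∈ (chartAt (Cn n) p).source) :
    f ∘ (chartAt (Cn n) x).symm =ᶠ[𝓝 (chartAt (Cn n) x x)] fun y =>
      (f ∘ (chartAt (Cn n) p).symm) ((chartAt (Cn n) p ∘ (chartAt (Cn n) x).symm) y) := by
  have h1 : ContinuousAt (chartAt (Cn n) x).symm (chartAt (Cn n) x x) :=
    (chartAt (Cn n) x).continuousAt_symm (by simp)
  have h2 : (chartAt (Cn n) p).source ∈ 𝓝 ((chartAt (Cn n) x).symm (chartAt (Cn n) x x)) := by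
    simpa using (chartAt (Cn n) p).open_source.mem_nhds hx
  filter_upwards [h1.preimage_mem_nhds h2] with y hy
  simp [(chartAt (Cn n) p).left_inv hy]

theorem chart_comp_symm_self (p x : X) :
    (chartAt (Cn n) p ∘ (chartAt (Cn n) x).symm) (chartAt (Cn n) x x) = chartAt (Cn n) p x := by
  simp

theorem realDiff_eq_fderiv {f : X → ℝ} {p x : X} (hx : x ∈ (chartAt (Cn n) p).source)
    (hf : ContMDiffAt 𝓘(ℝ, Cn n) 𝓘(ℝ, ℝ) 1 f x) (u : Cn n) :
    realDiff (n := n) f x u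
      = fderiv ℝ (f ∘ (chartAt (Cn n) p).symm) (chartAt (Cn n) p x) (chartDeriv p x u) := by
  have h1 : realDiff (n := n) f x u
      = fderiv ℝ (f ∘ (chartAt (Cn n) x).symm) (chartAt (Cn n) x x) u := by
    refine (DFunLike.congr_fun (hf.mdifferentiableAt one_ne_zero).mfderiv u).trans ?_
    simp only [writtenInExtChartAt, modelWithCornersSelf_coe, range_id, fderivWithin_univ,
      extChartAt, mfld_simps]
    rfl
  have h2 := ((contMDiffAt_iff_chart hx).1 hf).differentiableAt one_ne_zero
  rw [← chart_comp_symm_self p x] at h2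
  rw [h1, (comp_symm_eventuallyEq f hx).fderiv_eq, fderiv_comp_holomorphic h2
    ((contDiffAt_chart_comp_symm hx).differentiableAt (by simp)), chart_comp_symm_self]
  rfl

theorem realDiff_almostJ_eq_fderiv {f : X → ℝ} {p x : X} (hx : x ∈ (chartAt (Cn n) p).source)
    (hf : ContMDiffAt 𝓘(ℝ, Cn n) 𝓘(ℝ, ℝ) 1 f x) (u : Cn n) :
    realDiff (n := n) f x (almostJ (n := n) (x := x) u)
      = fderiv ℝ (f ∘ (chartAt (Cn n) p).symm) (chartAt (Cn n) p x)
        (Complex.I • chartDeriv p x u) :=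
  (realDiff_eq_fderiv hx hf _).trans (by rw [← map_smul]; rfl)

omit [IsManifold 𝓘(ℂ, Cn n) ω X] in
theorem iddbar_almostJ_eq_leviH_self (f : X → ℝ) (x : X) (u : Cn n) :
    iddbar (n := n) f x u (almostJ (n := n) (x := x) u)
      = leviH (f ∘ (chartAt (Cn n) x).symm) (chartAt (Cn n) x x) u / 2 := by
  change (fderiv ℝ (fderiv ℝ (f ∘ (chartAt (Cn n) x).symm)) (chartAt (Cn n) x x)
    (Complex.I • u) (Complex.I • u) - fderiv ℝ (fderiv ℝ (f ∘ (chartAt (Cn n) x).symm))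
    (chartAt (Cn n) x x) u (Complex.I • Complex.I • u)) / 2 = _
  rw [I_smul_I_smul, map_neg, leviH, leviB]
  ring

theorem iddbar_almostJ_eq_leviH {f : X → ℝ} {p x : X} (hx : x ∈ (chartAt (Cn n) p).source)
    (hf : ContMDiffAt 𝓘(ℝ, Cn n) 𝓘(ℝ, ℝ) 2 f x) (u : Cn n) :
    iddbar (n := n) f x u (almostJ (n := n) (x := x) u)
      = leviH (f ∘ (chartAt (Cn n) p).symm) (chartAt (Cn n) p x) (chartDeriv p x u) / 2 := by
  have h2 := (contMDiffAt_iff_chart hx).1 hf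
  rw [← chart_comp_symm_self p x] at h2
  rw [iddbar_almostJ_eq_leviH_self, leviH_congr (comp_symm_eventuallyEq f hx), leviH_comp h2
    ((contDiffAt_chart_comp_symm hx).of_le le_top), chart_comp_symm_self]
  rfl

/-- The size of `df` on the complex line spanned by a tangent vector. -/
theorem realDiff_sq_add_eq_normSq {f : X → ℝ} {p x : X} (hx : x ∈ (chartAt (Cn n) p).source)
    (hf : ContMDiffAt 𝓘(ℝ, Cn n) 𝓘(ℝ, ℝ) 1 f x) (u : Cn n) :
    realDiff (n := n) f x u ^ 2 + realDiff (n := n) f x (almostJ (n := n) (x := x) u) ^ 2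
      = Complex.normSq (twoDel (f ∘ (chartAt (Cn n) p).symm) (chartAt (Cn n) p x)
          (chartDeriv p x u)) := by
  rw [twoDel_normSq, realDiff_eq_fderiv hx hf, realDiff_almostJ_eq_fderiv hx hf]

end Charts

/-! ### Defining functions -/

section DefiningFunctions

open Filter

/-- Two functions of class `C¹` with the same regular zero set have proportional differentials, and
each is to first order a multiple of the other. -/
theorem exists_fderiv_eq_smul {E : Type*} [NormedAddCommGroup E] [NormedSpace ℝ E]
    {r₁ r₂ : E → ℝ} {z : E} (h1 : ContDiffAt ℝ 1 r₁ z) (h2 : ContDiffAt ℝ 1 r₂ z) (h0 : r₂ z = 0)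
    (hd1 : fderiv ℝ r₁ z ≠ 0) (hd2 : fderiv ℝ r₂ z ≠ 0)
    (hz : ∀ᶠ y in 𝓝 z, r₂ y = 0 → r₁ y = 0) :
    ∃ a : ℝ, a ≠ 0 ∧ fderiv ℝ r₁ z = a • fderiv ℝ r₂ z ∧
      ∀ᶠ y in 𝓝 z, |r₁ y - a * r₂ y| ≤ |a| / 2 * |r₂ y| := by
  obtain ⟨w, hw⟩ : ∃ w, fderiv ℝ r₂ z w ≠ 0 := by
    by_contra! h
    exact hd2 (ContinuousLinearMap.ext h)
  set ν := (fderiv ℝ r₂ z w)⁻¹ • w with hν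
  have hν1 : fderiv ℝ r₂ z ν = 1 := by rw [hν, map_smul, smul_eq_mul, inv_mul_cancel₀ hw]
  have hs1 := h1.hasStrictFDerivAt one_ne_zero
  have hs2 := h2.hasStrictFDerivAt one_ne_zero
  have hp := hs1.eq_smulRight_of_zero_on_levelSet hs2 h0 hν1 hz
  have ha : fderiv ℝ r₁ z ν ≠ 0 := by
    intro h
    rw [h] at hp
    exact hd1 (by rw [hp]; ext; simp)
  refine ⟨fderiv ℝ r₁ z ν, ha, ?_, ?_⟩
  · conv_lhs => rw [hp]
    ext u
    simp [mul_comm]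
  · have := (hs1.sub_smul_isLittleO hs2 h0 hν1 hz).def (c := |fderiv ℝ r₁ z ν| / 2)
      (by positivity)
    filter_upwards [this] with y hy
    simpa [mul_comm] using hy

variable {n : ℕ} {X : Type*} [TopologicalSpace X] [ChartedSpace (Cn n) X]
  [IsManifold 𝓘(ℂ, Cn n) ω X] {k : ℕ} {L V : Set X} {ρ : X → ℝ} {p x : X}

namespace IsDefiningFunction

theorem of_le {m : ℕ} (h : IsDefiningFunction (n := n) k L V ρ) (hm : m ≤ k) :
    IsDefiningFunction (n := n) m L V ρ where
  isOpen := h.isOpen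
  contMDiffOn := h.contMDiffOn.of_le (by exact_mod_cast hm)
  mem_iff := h.mem_iff
  diff_ne_zero := h.diff_ne_zero

theorem contMDiffAt (h : IsDefiningFunction (n := n) k L V ρ) (hV : x ∈ V) :
    ContMDiffAt 𝓘(ℝ, Cn n) 𝓘(ℝ, ℝ) k ρ x :=
  h.contMDiffOn.contMDiffAt (h.isOpen.mem_nhds hV)

theorem contDiffAt (h : IsDefiningFunction (n := n) k L V ρ) (hV : x ∈ V)
    (hx : x ∈ (chartAt (Cn n) p).source) :
    ContDiffAt ℝ k (ρ ∘ (chartAt (Cn n) p).symm) (chartAt (Cn n) p x) :=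
  (contMDiffAt_iff_chart hx).1 (h.contMDiffAt hV)

theorem fderiv_ne_zero (h : IsDefiningFunction (n := n) k L V ρ) (hk : 1 ≤ k) (hV : x ∈ V)
    (hL : x ∈ L) (hx : x ∈ (chartAt (Cn n) p).source) :
    fderiv ℝ (ρ ∘ (chartAt (Cn n) p).symm) (chartAt (Cn n) p x) ≠ 0 := by
  obtain ⟨u, hu⟩ := h.diff_ne_zero x ⟨hL, hV⟩
  intro h0
  refine hu ((realDiff_eq_fderiv hx
    ((h.contMDiffAt hV).of_le (by exact_mod_cast hk)) u).trans ?_)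
  rw [h0]
  rfl

end IsDefiningFunction

theorem eventually_chart_symm {P : X → Prop} (hx : x ∈ (chartAt (Cn n) p).source)
    (hP : ∀ᶠ y in 𝓝 x, P y) :
    ∀ᶠ z in 𝓝 (chartAt (Cn n) p x), P ((chartAt (Cn n) p).symm z) := by
  have h := (chartAt (Cn n) p).continuousAt_symm ((chartAt (Cn n) p).map_source hx)
  rw [ContinuousAt, (chartAt (Cn n) p).left_inv hx] at h
  exact h.eventually hP

theorem eventually_of_chart_symm {P : Cn n → Prop} (hx : x ∈ (chartAt (Cn n) p).source)
    (hP : ∀ᶠ z in 𝓝 (chartAt (Cn n) p x), P z) :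
    ∀ᶠ y in 𝓝 x, P (chartAt (Cn n) p y) :=
  ((chartAt (Cn n) p).continuousAt hx).eventually hP

namespace IsDefiningFunction

theorem eventually_mem_iff (h : IsDefiningFunction (n := n) k L V ρ) (hV : x ∈ V)
    (hx : x ∈ (chartAt (Cn n) p).source) :
    ∀ᶠ z in 𝓝 (chartAt (Cn n) p x),
      ((chartAt (Cn n) p).symm z ∈ L ↔ (ρ ∘ (chartAt (Cn n) p).symm) z = 0) :=
  eventually_chart_symm hx ((h.isOpen.eventually_mem hV).mono fun y hy => h.mem_iff y hy)

/-- Two defining functions of the same hypersurface are proportional to first order. -/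
theorem exists_smul {V' : Set X} {ρ' : X → ℝ} {k' : ℕ} (h : IsDefiningFunction (n := n) k L V ρ)
    (h' : IsDefiningFunction (n := n) k' L V' ρ') (hk : 1 ≤ k) (hk' : 1 ≤ k') (hV : x ∈ V)
    (hV' : x ∈ V') (hL : x ∈ L) (hx : x ∈ (chartAt (Cn n) p).source) :
    ∃ a : ℝ, a ≠ 0 ∧ fderiv ℝ (ρ ∘ (chartAt (Cn n) p).symm) (chartAt (Cn n) p x)
        = a • fderiv ℝ (ρ' ∘ (chartAt (Cn n) p).symm) (chartAt (Cn n) p x) ∧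
      ∀ᶠ y in 𝓝 x, |ρ y - a * ρ' y| ≤ |a| / 2 * |ρ' y| := by
  obtain ⟨a, ha, h1, h2⟩ := exists_fderiv_eq_smul ((h.contDiffAt hV hx).of_le (m := 1)
    (by exact_mod_cast hk)) ((h'.contDiffAt hV' hx).of_le (m := 1) (by exact_mod_cast hk'))
    (by simpa [(chartAt (Cn n) p).left_inv hx] using (h'.mem_iff x hV').1 hL)
    (h.fderiv_ne_zero hk hV hL hx) (h'.fderiv_ne_zero hk' hV' hL hx)
    (by
      filter_upwards [h.eventually_mem_iff hV hx, h'.eventually_mem_iff hV' hx] with z hz hz' hz0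
      exact hz.1 (hz'.2 hz0))
  refine ⟨a, ha, h1, ?_⟩
  filter_upwards [eventually_of_chart_symm hx h2,
    (chartAt (Cn n) p).open_source.eventually_mem hx] with y hy hys
  simpa [(chartAt (Cn n) p).left_inv hys] using hy

/-- The complex tangent space is the kernel of `2∂ρ`, in any chart and for any defining function. -/
theorem mem_complexTangent_iff (h : IsDefiningFunction (n := n) k L V ρ) (hk : 2 ≤ k) (hV : x ∈ V)
    (hL : x ∈ L) (hx : x ∈ (chartAt (Cn n) p).source) (u : Cn n) :
    u ∈ complexTangent (n := n) L x ↔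
      twoDel (ρ ∘ (chartAt (Cn n) p).symm) (chartAt (Cn n) p x) (chartDeriv p x u) = 0 := by
  have hC : ∀ {V' ρ'}, IsDefiningFunction (n := n) 2 L V' ρ' → x ∈ V' →
      ContMDiffAt 𝓘(ℝ, Cn n) 𝓘(ℝ, ℝ) 1 ρ' x := fun h' hV' =>
    (h'.contMDiffAt hV').of_le (by norm_num)
  have h2 := h.of_le hk
  constructor
  · intro hu
    obtain ⟨h3, h4⟩ := hu V ρ h2 hV
    rw [← Complex.normSq_eq_zero, ← realDiff_sq_add_eq_normSq hx (hC h2 hV), h3, h4]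
    ring
  · intro hu V' ρ' h' hV'
    obtain ⟨a, -, ha, -⟩ := h'.exists_smul h2 one_le_two one_le_two hV' hV hL hx
    have h3 := congrArg Complex.re hu
    have h4 := congrArg Complex.im hu
    rw [twoDel_re, Complex.zero_re] at h3
    rw [twoDel_im, Complex.zero_im, neg_eq_zero] at h4
    constructor
    · refine (realDiff_eq_fderiv hx (hC h' hV') u).trans ?_
      rw [ha, smul_apply, h3, smul_zero]
    · refine (realDiff_almostJ_eq_fderiv hx (hC h' hV') u).trans ?_
      rw [ha, smul_apply, h4, smul_zero]

/-- For a Levi flat hypersurface, the Levi form of a defining function vanishes on the kernel of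
`2∂ρ`, in any chart. -/
theorem eventually_leviH_eq_zero (h : IsDefiningFunction (n := n) k L V ρ) (hk : 2 ≤ k)
    (hflat : IsLeviFlat n L) (hV : x ∈ V) (hx : x ∈ (chartAt (Cn n) p).source) :
    ∀ᶠ z in 𝓝 (chartAt (Cn n) p x), (ρ ∘ (chartAt (Cn n) p).symm) z = 0 →
      ∀ u, twoDel (ρ ∘ (chartAt (Cn n) p).symm) z u = 0 →
        leviH (ρ ∘ (chartAt (Cn n) p).symm) z u = 0 := by
  have h2 := h.of_le hk
  filter_upwards [eventually_chart_symm hx (h.isOpen.eventually_mem hV),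
    (chartAt (Cn n) p).open_target.eventually_mem ((chartAt (Cn n) p).map_source hx)]
    with z hzV hzt hz0 u hu
  set y := (chartAt (Cn n) p).symm z with hy
  have hys : y ∈ (chartAt (Cn n) p).source := (chartAt (Cn n) p).map_target hzt
  have hyz : chartAt (Cn n) p y = z := (chartAt (Cn n) p).right_inv hzt
  obtain ⟨u', rfl⟩ := (chartDeriv_bijective hys).2 u
  rw [← hyz] at hu ⊢
  have hyL : y ∈ L := (h.mem_iff y hzV).2 hz0
  obtain ⟨h3, h4⟩ := (h.mem_complexTangent_iff hk hzV hyL hys u').2 hu V ρ h2 hzV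
  have h5 := hflat V ρ h2 y ⟨hyL, hzV⟩ u' h3 h4
  have h6 := (iddbar_almostJ_eq_leviH hys (h2.contMDiffAt hzV) u').symm.trans h5
  linarith

/-- Along the hypersurface, `i∂∂̄ρ²` is the square of `|2∂ρ|`. -/
theorem iddbar_sq (h : IsDefiningFunction (n := n) k L V ρ) (hk : 2 ≤ k) (hV : x ∈ V)
    (hL : x ∈ L) (hx : x ∈ (chartAt (Cn n) p).source) {R : X → ℝ}
    (hR : ∀ y ∈ V, R y = |ρ y|) (u : Cn n) :
    iddbar (n := n) (fun y => R y ^ 2) x u (almostJ (n := n) (x := x) u) = Complex.normSq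
      (twoDel (ρ ∘ (chartAt (Cn n) p).symm) (chartAt (Cn n) p x) (chartDeriv p x u)) := by
  have h2 := h.of_le hk
  have hR2 : (fun y => R y ^ 2) =ᶠ[𝓝 x] fun y => ρ y ^ 2 := by
    filter_upwards [h.isOpen.eventually_mem hV] with y hy
    rw [hR y hy, sq_abs]
  have hC : ContMDiffAt 𝓘(ℝ, Cn n) 𝓘(ℝ, ℝ) 2 (fun y => R y ^ 2) x :=
    ((h2.contMDiffAt hV).pow 2).congr_of_eventuallyEq hR2
  have h3 : (fun y => R y ^ 2) ∘ (chartAt (Cn n) p).symm =ᶠ[𝓝 (chartAt (Cn n) p x)]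
      fun z => (ρ ∘ (chartAt (Cn n) p).symm) z ^ 2 := eventually_chart_symm hx hR2
  have h0 : (ρ ∘ (chartAt (Cn n) p).symm) (chartAt (Cn n) p x) = 0 := by
    simpa [(chartAt (Cn n) p).left_inv hx] using (h.mem_iff x hV).1 hL
  rw [iddbar_almostJ_eq_leviH hx hC, leviH_congr h3, leviH_sq (h2.contDiffAt hV hx), h0]
  ring

end IsDefiningFunction

end DefiningFunctions

/-! ### A global defining function up to sign -/

section AbsDefiningFunction

open Filter

variable {n : ℕ} {X : Type*} [TopologicalSpace X] [ChartedSpace (Cn n) X]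
  [IsManifold 𝓘(ℂ, Cn n) ω X] {L : Set X}

/-- Locally, `R` is the absolute value of a defining function of class `C³` of `L`. A hypersurface
that is not co-oriented has no global defining function, but it has such an `R`. -/
def IsAbsDefiningFunction (n : ℕ) {X : Type*} [TopologicalSpace X] [ChartedSpace (Cn n) X]
    (L : Set X) (R : X → ℝ) : Prop :=
  ∀ p ∈ L, ∃ (V : Set X) (ρ : X → ℝ), p ∈ V ∧ IsDefiningFunction (n := n) 3 L V ρ ∧
    ∀ x ∈ V, R x = |ρ x|

/-- A number close to `a t` has the sign of `a t`. -/
theorem abs_eq_of_abs_sub_le {a s t : ℝ} (ha : a ≠ 0) (h : |s - a * t| ≤ |a| / 2 * |t|) :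
    |s| = SignType.sign t * (SignType.sign a * s) := by
  rcases lt_trichotomy t 0 with ht | ht | ht <;> rcases lt_or_gt_of_ne ha with h' | h'
  all_goals
    first
    | rw [ht] at h
      simp only [mul_zero, sub_zero, abs_zero] at h
      rw [ht, abs_nonpos_iff.1 h]; simp
    | simp only [abs_of_neg, abs_of_pos, ht, h', sign_neg, sign_pos] at h ⊢
      have h1 := abs_le.1 h
      push_cast
      simp only [SignType.coe_one]
      first
      | rw [abs_of_nonneg (by nlinarith [mul_pos_of_neg_of_neg h' ht])]; ring
      | rw [abs_of_nonneg (by nlinarith [mul_pos h' ht])]; ring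
      | rw [abs_of_nonpos (by nlinarith [mul_neg_of_pos_of_neg h' ht])]; ring
      | rw [abs_of_nonpos (by nlinarith [mul_neg_of_neg_of_pos h' ht])]; ring

/-- If a differentiable function dominates another one and vanishes at a point with zero
differential, so does the other one. -/
theorem fderiv_eq_zero_of_abs_le {E : Type*} [NormedAddCommGroup E] [NormedSpace ℝ E]
    {f g : E → ℝ} {z : E} {C : ℝ} (hf : DifferentiableAt ℝ f z) (h : ∀ᶠ y in 𝓝 z, |g y| ≤ C * |f y|)
    (h0 : f z = 0) (hd : fderiv ℝ f z = 0) : fderiv ℝ g z = 0 := by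
  have h1 := hf.hasFDerivAt.isLittleO
  simp only [h0, hd, sub_zero, zero_apply] at h1
  have h2 : g =O[𝓝 z] f := Asymptotics.IsBigO.of_bound C (by simpa using h)
  have hg0 : g z = 0 := by simpa [h0] using h.self_of_nhds
  refine HasFDerivAt.fderiv (HasFDerivAt.of_isLittleO ?_)
  simpa [hg0] using h2.trans_isLittleO h1

/-- A closed real hypersurface of class `C³` has a defining function up to sign. It is glued from
local ones by a partition of unity: near a given point, the local defining functions have the same
signs after a choice of signs, so that the sum of their absolute values is the absolute value of a
sum. -/
theorem exists_isAbsDefiningFunction [T2Space X] [SecondCountableTopology X] (hLc : IsClosed L)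
    (hL : IsRealHypersurface n 3 L) : ∃ R : X → ℝ, IsAbsDefiningFunction n L R := by
  have : LocallyCompactSpace X := ChartedSpace.locallyCompactSpace (Cn n) X
  have : IsManifold 𝓘(ℝ, Cn n) ∞ X := .of_le (n := ω) le_top
  choose! V ρ hpV hρ using hL
  obtain ⟨f, hf⟩ := SmoothPartitionOfUnity.exists_isSubordinate 𝓘(ℝ, Cn n) hLc
    (fun i : L => V i) (fun i => (hρ i i.2).isOpen)
    (fun x hx => mem_iUnion.2 ⟨⟨x, hx⟩, hpV x hx⟩)
  refine ⟨fun x => ∑ᶠ i, f i x • |ρ i x|, fun p hp => ?_⟩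
  have hpc : p ∈ (chartAt (Cn n) p).source := mem_chart_source _ p
  obtain ⟨j, hj⟩ := f.exists_pos_of_mem hp
  have hjV : p ∈ V j := hf j (subset_tsupport _ hj.ne')
  -- the factors relating the local defining functions to a fixed one
  have key : ∀ i : L, ∃ a : ℝ, a ≠ 0 ∧ (p ∈ tsupport (f i) →
      ∀ᶠ y in 𝓝 p, |ρ i y - a * ρ j y| ≤ |a| / 2 * |ρ j y|) := by
    intro i
    by_cases hi : p ∈ tsupport (f i)
    · obtain ⟨a, ha, -, h⟩ := (hρ i i.2).exists_smul (hρ j j.2) (by norm_num) (by norm_num)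
        (hf i hi) hjV hp hpc
      exact ⟨a, ha, fun _ => h⟩
    · exact ⟨1, one_ne_zero, fun h => absurd h hi⟩
  choose a ha hai using key
  set ρ' : X → ℝ := fun x => ∑ᶠ i, f i x • (SignType.sign (a i) * ρ i x) with hρ'
  have hC : ContMDiffAt 𝓘(ℝ, Cn n) 𝓘(ℝ, ℝ) 3 ρ' p :=
    f.contMDiffAt_finsum (n := 3) fun i hi =>
      contMDiffAt_const.mul ((hρ i i.2).contMDiffAt (hf i hi))
  have hCe : ∀ᶠ y in 𝓝 p, ContMDiffAt 𝓘(ℝ, Cn n) 𝓘(ℝ, ℝ) 3 ρ' y := by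
    have : IsManifold 𝓘(ℝ, Cn n) 3 X := .of_le (n := ω) le_top
    exact (contMDiffAt_iff_contMDiffAt_nhds (by norm_num)).1 hC
  have habs : ∀ᶠ y in 𝓝 p, ∀ i ∈ f.fintsupport p,
      |ρ i y - a i * ρ j y| ≤ |a i| / 2 * |ρ j y| ∧ y ∈ V i := by
    rw [eventually_all_finset]
    intro i hi
    rw [f.mem_fintsupport_iff] at hi
    exact (hai i hi).and ((hρ i i.2).isOpen.eventually_mem (hf i hi))
  have hpos : ∀ᶠ y in 𝓝 p, f j p / 2 < f j y :=
    (f j).contMDiff.continuous.continuousAt.eventually_const_lt (by linarith)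
  obtain ⟨W, hW, hWo, hpW⟩ := _root_.eventually_nhds_iff.1
    (((hCe.and habs).and (hpos.and (f.eventually_finsupport_subset p))).and
      (((hρ j j.2).isOpen.eventually_mem hjV).and
        ((chartAt (Cn n) p).open_source.eventually_mem hpc)))
  have hmem : ∀ y ∈ W, ∀ i, f i y ≠ 0 → i ∈ f.fintsupport p := fun y hy i hi =>
    (hW y hy).1.2.2 ((f.mem_finsupport y).2 hi)
  have hsign : ∀ y ∈ W, ∑ᶠ i, f i y • |ρ i y| = SignType.sign (ρ j y) * ρ' y := by
    intro y hy
    rw [hρ', mul_finsum]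
    refine finsum_congr fun i => ?_
    by_cases hi : f i y = 0
    · simp [hi]
    · rw [abs_eq_of_abs_sub_le (ha i) ((hW y hy).1.1.2 i (hmem y hy i hi)).1]
      simp only [smul_eq_mul]
      ring
  have hge : ∀ y ∈ W, f j p / 2 * |ρ j y| ≤ ∑ᶠ i, f i y • |ρ i y| := by
    intro y hy
    have h1 := (hW y hy).1.2.1
    have h2 : f j y • |ρ j y| ≤ ∑ᶠ i, f i y • |ρ i y| :=
      single_le_finsum (f := fun i => f i y • |ρ i y|) j
        ((f.finsupport y).finite_toSet.subset fun i hi => by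
          simp only [SmoothPartitionOfUnity.coe_finsupport]
          intro h
          exact hi (by simp [h]))
        fun i => smul_nonneg (f.nonneg i y) (abs_nonneg _)
    refine le_trans ?_ h2
    rw [smul_eq_mul]
    gcongr
  have hLz : ∀ y ∈ W, y ∈ L → ρ' y = 0 := by
    intro y hy hyL
    rw [hρ', ← finsum_zero (α := L)]
    refine finsum_congr fun i => ?_
    by_cases hi : f i y = 0
    · simp [hi]
    · have hyV := ((hW y hy).1.1.2 i (hmem y hy i hi)).2
      rw [((hρ i i.2).mem_iff y hyV).1 hyL]
      simp
  have hR : ∀ y ∈ W, ∑ᶠ i, f i y • |ρ i y| = |ρ' y| := by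
    intro y hy
    have h0 : 0 ≤ ∑ᶠ i, f i y • |ρ i y| := finsum_nonneg fun i =>
      smul_nonneg (f.nonneg i y) (abs_nonneg _)
    by_cases hyL : y ∈ L
    · rw [hsign y hy, hLz y hy hyL]; simp
    · have hne : ρ j y ≠ 0 := fun h => hyL (((hρ j j.2).mem_iff y (hW y hy).2.1).2 h)
      rw [← abs_of_nonneg h0, hsign y hy, abs_mul]
      rcases lt_or_gt_of_ne hne with h | h <;> simp [h]
  have hge' : ∀ y ∈ W, |ρ j y| ≤ 2 / f j p * |ρ' y| := by
    intro y hy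
    have h1 := hge y hy
    rw [hR y hy] at h1
    rw [div_mul_eq_mul_div, le_div_iff₀ hj]
    linarith
  refine ⟨W, ρ', hpW, ⟨hWo, fun y hy => (hW y hy).1.1.1.contMDiffWithinAt, fun y hy =>
    ⟨hLz y hy, fun h => ?_⟩, ?_⟩, hR⟩
  · have h1 := hge' y hy
    rw [h, abs_zero, mul_zero, abs_nonpos_iff] at h1
    exact ((hρ j j.2).mem_iff y (hW y hy).2.1).2 h1
  · rintro y ⟨hyL, hy⟩
    by_contra! h
    have hyc := (hW y hy).2.2
    have hCy : ContMDiffAt 𝓘(ℝ, Cn n) 𝓘(ℝ, ℝ) 1 ρ' y := (hW y hy).1.1.1.of_le (by norm_num)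
    refine (hρ j j.2).fderiv_ne_zero (by norm_num) (hW y hy).2.1 hyL hyc
      (fderiv_eq_zero_of_abs_le (((contMDiffAt_iff_chart hyc).1 hCy).differentiableAt one_ne_zero)
        (eventually_chart_symm hyc ((hWo.eventually_mem hy).mono hge')) ?_ ?_)
    · simpa [(chartAt (Cn n) p).left_inv hyc] using hLz y hy hyL
    · ext u
      obtain ⟨u', rfl⟩ := (chartDeriv_bijective hyc).2 u
      exact (realDiff_eq_fderiv hyc hCy u').symm.trans (h u')

end AbsDefiningFunction

/-! ### Vector fields with constant coordinates in a chart -/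

section ChartVec

open Filter

variable {n : ℕ} {X : Type*} [TopologicalSpace X] [ChartedSpace (Cn n) X]
  [IsManifold 𝓘(ℂ, Cn n) ω X]

/-- The tangent vector at `x` with coordinates `e` in the chart at `p`. -/
def chartVec (p : X) (e : Cn n) (x : X) : Cn n := tangentCoordChange 𝓘(ℂ, Cn n) p x x e

theorem chartDeriv_chartVec {p x : X} (hx : x ∈ (chartAt (Cn n) p).source) (e : Cn n) :
    chartDeriv p x (chartVec p e x) = e := by
  have hx' : x ∈ (extChartAt 𝓘(ℂ, Cn n) p).source := by simpa using hx
  have hxx : x ∈ (extChartAt 𝓘(ℂ, Cn n) x).source := by simp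
  rw [chartDeriv_eq_tangentCoordChange, chartVec,
    tangentCoordChange_comp ⟨⟨hx', hxx⟩, hx'⟩, tangentCoordChange_self hx']

theorem trivializationAt_complex_snd (p x : X) (u : Cn n) :
    (trivializationAt (Cn n) (TangentSpace 𝓘(ℂ, Cn n)) p
      (⟨x, u⟩ : TangentBundle 𝓘(ℂ, Cn n) X)).2 = chartDeriv p x u := by
  rw [TangentBundle.trivializationAt_apply]
  simp only [modelWithCornersSelf_coe, range_id, fderivWithin_univ, mfld_simps]
  rfl

theorem trivializationAt_real_snd {p x : X} (hx : x ∈ (chartAt (Cn n) p).source) (u : Cn n) :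
    (trivializationAt (Cn n) (TangentSpace 𝓘(ℝ, Cn n)) p
      (⟨x, u⟩ : TangentBundle 𝓘(ℝ, Cn n) X)).2 = chartDeriv p x u := by
  rw [TangentBundle.trivializationAt_apply, ← tangentCoordChange_real_apply hx]
  rfl

theorem chartDeriv_self (p : X) (u : Cn n) : chartDeriv p p u = u := by
  rw [chartDeriv_eq_tangentCoordChange, tangentCoordChange_self (by simp)]

theorem continuousLinearMapAt_real_apply {p x : X} (hx : x ∈ (chartAt (Cn n) p).source) (u : Cn n) :
    (trivializationAt (Cn n) (TangentSpace 𝓘(ℝ, Cn n)) p).continuousLinearMapAt ℝ x u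
      = chartDeriv p x u := by
  rw [TangentBundle.continuousLinearMapAt_trivializationAt_eq_core hx,
    ← tangentCoordChange_real_apply hx]
  rfl

theorem symmL_real_apply {p x : X} (hx : x ∈ (chartAt (Cn n) p).source) (u : Cn n) :
    (trivializationAt (Cn n) (TangentSpace 𝓘(ℝ, Cn n)) p).symmL ℝ x (chartDeriv p x u) = u := by
  rw [← continuousLinearMapAt_real_apply hx]
  exact (trivializationAt (Cn n) (TangentSpace 𝓘(ℝ, Cn n)) p).symmL_continuousLinearMapAt
    (by simpa using hx) u

theorem contMDiffOn_chartVec_real (p : X) (e : Cn n) :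
    ContMDiffOn 𝓘(ℝ, Cn n) 𝓘(ℝ, Cn n).tangent 2
      (fun x => (⟨x, chartVec p e x⟩ : TangentBundle 𝓘(ℝ, Cn n) X))
      (chartAt (Cn n) p).source := by
  have : IsManifold 𝓘(ℝ, Cn n) (2 + 1) X := .of_le (n := ω) le_top
  have : IsManifold 𝓘(ℝ, Cn n) 2 X := .of_le (n := ω) le_top
  have : ContMDiffVectorBundle 2 (Cn n) (TangentSpace 𝓘(ℝ, Cn n) : X → Type _) 𝓘(ℝ, Cn n) :=
    TangentBundle.contMDiffVectorBundle
  intro x hx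
  refine ContMDiffAt.contMDiffWithinAt ?_
  rw [ModelWithCorners.tangent,
    (trivializationAt (Cn n) (TangentSpace 𝓘(ℝ, Cn n)) p).contMDiffAt_iff (by simpa using hx)]
  refine ⟨contMDiffAt_id, (contMDiffAt_const (c := e)).congr_of_eventuallyEq ?_⟩
  filter_upwards [(chartAt (Cn n) p).open_source.mem_nhds hx] with y hy
  rw [trivializationAt_real_snd hy, chartDeriv_chartVec hy]

theorem contMDiffOn_chartVec_complex {m : ℕ} (p : X) (e : Cn n) {B : Set (Cn m)}
    {φ : Cn m → X} (hφ : ContMDiffOn 𝓘(ℂ, Cn m) 𝓘(ℂ, Cn n) ω φ B) (hB : IsOpen B)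
    (hs : ∀ b ∈ B, φ b ∈ (chartAt (Cn n) p).source) :
    ContMDiffOn 𝓘(ℂ, Cn m) 𝓘(ℂ, Cn n).tangent ω
      (fun b => (⟨φ b, chartVec p e (φ b)⟩ : TangentBundle 𝓘(ℂ, Cn n) X)) B := by
  have : IsManifold 𝓘(ℂ, Cn n) (ω + 1) X := .of_le (n := ω) le_top
  have : ContMDiffVectorBundle ω (Cn n) (TangentSpace 𝓘(ℂ, Cn n) : X → Type _) 𝓘(ℂ, Cn n) :=
    TangentBundle.contMDiffVectorBundle
  intro b hb
  refine ContMDiffAt.contMDiffWithinAt ?_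
  rw [ModelWithCorners.tangent,
    (trivializationAt (Cn n) (TangentSpace 𝓘(ℂ, Cn n)) p).contMDiffAt_iff (by simpa using hs b hb)]
  refine ⟨hφ.contMDiffAt (hB.mem_nhds hb), (contMDiffAt_const (c := e)).congr_of_eventuallyEq ?_⟩
  filter_upwards [hB.mem_nhds hb] with y hy
  rw [trivializationAt_complex_snd, chartDeriv_chartVec (hs y hy)]

end ChartVec

/-! ### The metric on the normal bundle as a multiple of `|2∂ρ|²` -/

section ConformalFactor

open Filter

variable {n : ℕ} {X : Type*} [TopologicalSpace X] [ChartedSpace (Cn n) X]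
  [IsManifold 𝓘(ℂ, Cn n) ω X] {L V : Set X} {ρ : X → ℝ} {k : ℕ} {p : X}

namespace LeviNormalMetric

/-- The squared length of the class of the tangent vector `u` at `x`. -/
def sq (h : LeviNormalMetric n L) (x : L) (u : Cn n) : ℝ :=
  ((h.core x).inner (Submodule.Quotient.mk u) (Submodule.Quotient.mk u)).re

variable (h : LeviNormalMetric n L) {x : L}

theorem sq_smul (c : ℂ) (u : Cn n) : h.sq x (c • u) = Complex.normSq c * h.sq x u := by
  have h1 : ∀ q : LeviNormal (n := n) L (x : X), ((h.core x).inner (c • q) (c • q)).re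
      = Complex.normSq c * ((h.core x).inner q q).re := by
    intro q
    have h2 := (h.core x).conj_inner_symm q (c • q)
    rw [(h.core x).smul_left q q c, map_mul, Complex.conj_conj, (h.core x).conj_inner_symm] at h2
    rw [(h.core x).smul_left, ← h2, ← mul_assoc, mul_comm _ c, Complex.mul_conj,
      Complex.re_ofReal_mul]
  exact h1 (Submodule.Quotient.mk u)

theorem sq_congr {u w : Cn n} (huw : u - w ∈ complexTangent (n := n) L x) :
    h.sq x u = h.sq x w := by
  rw [sq, sq, (Submodule.Quotient.eq _).2 huw]

theorem sq_pos {u : Cn n} (hu : u ∉ complexTangent (n := n) L x) : 0 < h.sq x u := by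
  set q : LeviNormal (n := n) L (x : X) := Submodule.Quotient.mk u with hq
  have h1 : 0 ≤ ((h.core x).inner q q).re := (h.core x).re_inner_nonneg q
  refine lt_of_le_of_ne h1 fun h0 => hu ?_
  have h2 : ((h.core x).inner q q).im = 0 := by
    have := congrArg Complex.im ((h.core x).conj_inner_symm q q)
    rw [Complex.conj_im] at this
    linarith
  have h3 := (h.core x).definite q (Complex.ext h0.symm h2)
  exact (Submodule.Quotient.mk_eq_zero _).1 h3

/-- On the one-dimensional fibre of the normal bundle, all Hermitian metrics are proportional. -/
theorem sq_mul_normSq (σ : Cn n →ₗ[ℂ] ℂ) (hσ : ∀ u, u ∈ complexTangent (n := n) L x ↔ σ u = 0)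
    (u w : Cn n) : h.sq x u * Complex.normSq (σ w) = h.sq x w * Complex.normSq (σ u) := by
  by_cases hw : σ w = 0
  · have h1 : h.sq x w = h.sq x ((0 : ℂ) • w) := h.sq_congr (by simpa using (hσ w).2 hw)
    rw [h1, sq_smul, hw]
    simp
  · have h1 : h.sq x u = h.sq x ((σ u / σ w) • w) := h.sq_congr <| (hσ _).2 <| by
      rw [map_sub, map_smul, smul_eq_mul, div_mul_cancel₀ _ hw, sub_self]
    have h2 := mt Complex.normSq_eq_zero.1 hw
    rw [h1, sq_smul, Complex.normSq_div]
    field_simp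

end LeviNormalMetric

theorem contDiffAt_normSq_twoDel {E : Type*} [NormedAddCommGroup E] [NormedSpace ℂ E]
    [NormedSpace ℝ E] [IsScalarTower ℝ ℂ E] {r : E → ℝ} {z : E} (hr : ContDiffAt ℝ 3 r z) (e : E) :
    ContDiffAt ℝ 2 (fun z => Complex.normSq (twoDel r z e)) z := by
  have h1 : ContDiffAt ℝ 2 (fun z => twoDel r z e) z :=
    hr.twoDel (a := fun z => z) (b := fun _ => e) (m := 2) (by norm_num) contDiffAt_id
      contDiffAt_const
  simp only [Complex.normSq_apply]
  exact ((Complex.reCLM.contDiff.contDiffAt.comp _ h1).mul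
    (Complex.reCLM.contDiff.contDiffAt.comp _ h1)).add
    ((Complex.imCLM.contDiff.contDiffAt.comp _ h1).mul
    (Complex.imCLM.contDiff.contDiffAt.comp _ h1))

/-- A tangent vector transverse to the complex tangent space. -/
theorem IsDefiningFunction.exists_twoDel_eq_one (hρ : IsDefiningFunction (n := n) k L V ρ)
    (hk : 1 ≤ k) (hV : p ∈ V) (hL : p ∈ L) :
    ∃ e, twoDel (ρ ∘ (chartAt (Cn n) p).symm) (chartAt (Cn n) p p) e = 1 := by
  have h1 := hρ.fderiv_ne_zero hk hV hL (mem_chart_source (Cn n) p)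
  obtain ⟨w, hw⟩ : ∃ w, fderiv ℝ (ρ ∘ (chartAt (Cn n) p).symm) (chartAt (Cn n) p p) w ≠ 0 := by
    by_contra! h
    exact h1 (ContinuousLinearMap.ext h)
  have hw' : twoDel (ρ ∘ (chartAt (Cn n) p).symm) (chartAt (Cn n) p p) w ≠ 0 := by
    intro h
    exact hw (by rw [← twoDel_re, h, Complex.zero_re])
  exact ⟨(twoDel (ρ ∘ (chartAt (Cn n) p).symm) (chartAt (Cn n) p p) w)⁻¹ • w, by
    rw [twoDel_smul, inv_mul_cancel₀ hw']⟩

/-- The metric on the normal bundle is `G |2∂ρ|²` with a positive function `G` of class `C²` on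
the manifold. -/
theorem LeviNormalMetric.exists_factor [T2Space X] [SecondCountableTopology X]
    (h : LeviNormalMetric n L) (hLc : IsClosed L) {R : X → ℝ} (hR : IsAbsDefiningFunction n L R) :
    ∃ G : X → ℝ, ContMDiff 𝓘(ℝ, Cn n) 𝓘(ℝ, ℝ) 2 G ∧ (∀ x, 0 < G x) ∧ ∀ (x : L) (u : Cn n),
      h.sq x u = G x
        * iddbar (n := n) (fun y => R y ^ 2) x u (almostJ (n := n) (x := (x : X)) u) := by
  have : LocallyCompactSpace X := ChartedSpace.locallyCompactSpace (Cn n) X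
  have : IsManifold 𝓘(ℝ, Cn n) ∞ X := .of_le (n := ω) le_top
  have : IsManifold 𝓘(ℝ, Cn n) 2 X := .of_le (n := ω) le_top
  set t : X → Set ℝ := fun x => {y | 0 < y ∧ ∀ hx : x ∈ L, ∀ u : Cn n, h.sq ⟨x, hx⟩ u
    = y * iddbar (n := n) (fun y => R y ^ 2) x u (almostJ (n := n) (x := x) u)} with ht
  have hconv : ∀ x, Convex ℝ (t x) := by
    rintro x a ⟨ha, ha'⟩ b ⟨hb, hb'⟩ α β hα hβ hαβ
    refine ⟨?_, fun hx u => ?_⟩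
    · exact (convex_Ioi (0 : ℝ)) ha hb hα hβ hαβ
    · rw [smul_eq_mul, smul_eq_mul, add_mul, mul_assoc, mul_assoc, ← ha' hx u, ← hb' hx u,
        ← add_mul, hαβ, one_mul]
  obtain ⟨G, hG⟩ := exists_contMDiffMap_forall_mem_convex_of_local 𝓘(ℝ, Cn n) (n := 2) hconv (by
    intro p
    by_cases hp : p ∈ L
    swap
    · exact ⟨Lᶜ, hLc.isOpen_compl.mem_nhds hp, fun _ => 1, contMDiffOn_const, fun y hy =>
        ⟨one_pos, fun hx => absurd hx hy⟩⟩
    obtain ⟨V, ρ, hpV, hρ, hRρ⟩ := hR p hp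
    have hpc : p ∈ (chartAt (Cn n) p).source := mem_chart_source _ p
    obtain ⟨e, he⟩ := hρ.exists_twoDel_eq_one (by norm_num) hpV hp
    set χ := chartAt (Cn n) p with hχ
    set r := ρ ∘ χ.symm with hr
    obtain ⟨W, f, hWo, hpW, hWs, hf, hfs⟩ := h.contMDiff _ χ.open_source (chartVec p e)
      (contMDiffOn_chartVec_real p e) p ⟨hp, hpc⟩
    have hs : ContMDiffOn 𝓘(ℝ, Cn n) 𝓘(ℝ, ℝ) 2
        (fun x => Complex.normSq (twoDel r (χ x) e)) (V ∩ χ.source) := by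
      rintro x ⟨hxV, hxs⟩
      refine ContMDiffAt.contMDiffWithinAt ?_
      rw [contMDiffAt_iff_chart hxs]
      refine (contDiffAt_normSq_twoDel (hρ.contDiffAt hxV hxs) e).congr_of_eventuallyEq ?_
      filter_upwards [χ.open_target.mem_nhds (χ.map_source hxs)] with z hz
      exact congrArg (fun w => Complex.normSq (twoDel r w e)) (χ.right_inv hz)
    have hsp : 0 < Complex.normSq (twoDel r (χ p) e) := by rw [he]; simp
    have hfp : 0 < f p := by
      rw [hfs ⟨p, hp⟩ hpW]
      refine h.sq_pos (x := ⟨p, hp⟩) fun hmem => ?_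
      rw [hρ.mem_complexTangent_iff (by norm_num) hpV hp hpc, chartDeriv_chartVec hpc] at hmem
      rw [hmem] at he
      exact zero_ne_one he
    have hfe : ∀ᶠ y in 𝓝 p, 0 < f y :=
      (hf.contMDiffAt (hWo.mem_nhds hpW)).continuousAt.eventually_const_lt hfp
    have hse : ∀ᶠ y in 𝓝 p, 0 < Complex.normSq (twoDel r (χ y) e) :=
      (hs.contMDiffAt ((hρ.isOpen.inter χ.open_source).mem_nhds
        ⟨hpV, hpc⟩)).continuousAt.eventually_const_lt hsp
    refine ⟨{y | (0 < f y ∧ 0 < Complex.normSq (twoDel r (χ y) e)) ∧ y ∈ W ∧ y ∈ V},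
      (hfe.and hse).and ((hWo.eventually_mem hpW).and (hρ.isOpen.eventually_mem hpV)),
      fun y => f y / Complex.normSq (twoDel r (χ y) e), ?_, ?_⟩
    · exact (hf.mono fun y hy => hy.2.1).div₀ (hs.mono fun y hy => ⟨hy.2.2, hWs hy.2.1⟩)
        fun y hy => hy.1.2.ne'
    · rintro y ⟨⟨h1, h2⟩, hyW, hyV⟩
      refine ⟨div_pos h1 h2, fun hyL u => ?_⟩
      have hys := hWs hyW
      rw [hρ.iddbar_sq (by norm_num) hyV hyL hys hRρ u, div_mul_eq_mul_div, eq_div_iff h2.ne',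
        hfs ⟨y, hyL⟩ hyW]
      set σ : Cn n →ₗ[ℂ] ℂ :=
        (twoDelₗ r (χ y)).comp (chartDeriv p y).toLinearMap with hσ
      have h3 := h.sq_mul_normSq (x := ⟨y, hyL⟩) σ
        (fun u => hρ.mem_complexTangent_iff (by norm_num) hyV hyL hys u) u (chartVec p e y)
      have h4 : σ (chartVec p e y) = twoDel r (χ y) e := by
        change twoDel r (χ y) (chartDeriv p y (chartVec p e y)) = _
        rw [chartDeriv_chartVec hys]
      rw [h4] at h3
      exact h3)
  exact ⟨G, G.contMDiff, fun x => (hG x).1, fun x u => (hG x).2 x.2 u⟩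

end ConformalFactor

/-! ### Positivity near a point of the hypersurface -/

section LocalEstimate

open Filter

variable {n : ℕ} {X : Type*} [TopologicalSpace X] [ChartedSpace (Cn n) X]
  [IsManifold 𝓘(ℂ, Cn n) ω X] {L V : Set X} {ρ : X → ℝ} {p : X}

theorem exists_linearMap_range_eq_ker (hn : 1 ≤ n) (σ : Cn n →ₗ[ℂ] ℂ) {e : Cn n} (he : σ e = 1) :
    ∃ ι : Cn (n - 1) →ₗ[ℂ] Cn n, Function.Injective ι ∧ LinearMap.range ι = LinearMap.ker σ := by
  have hs : LinearMap.range σ = ⊤ := LinearMap.range_eq_top.2 fun c => ⟨c • e, by simp [he]⟩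
  have h1 := σ.finrank_range_add_finrank_ker
  rw [hs, finrank_top, Module.finrank_self, finrank_euclideanSpace_fin] at h1
  have h2 : Module.finrank ℂ (Cn (n - 1)) = Module.finrank ℂ (LinearMap.ker σ) := by
    rw [finrank_euclideanSpace_fin]
    omega
  obtain ⟨f⟩ := FiniteDimensional.nonempty_linearEquiv_of_finrank_eq h2
  refine ⟨(LinearMap.ker σ).subtype ∘ₗ f.toLinearMap,
    (Submodule.injective_subtype _).comp f.injective, ?_⟩
  rw [LinearMap.range_comp, LinearEquiv.range, Submodule.map_top, Submodule.range_subtype]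

/-- A piece of a leaf, read in a chart, carries a holomorphic frame of the normal bundle with
constant coordinates. -/
theorem isLeafFrame_chartVec (hρ : IsDefiningFunction (n := n) 3 L V ρ) {B : Set (Cn (n - 1))}
    {φ : Cn (n - 1) → Cn n} {e : Cn n} (hB : IsOpen B) (hφ : ContDiffOn ℂ ω φ B)
    (hφt : ∀ b ∈ B, φ b ∈ (chartAt (Cn n) p).target)
    (hφV : ∀ b ∈ B, (chartAt (Cn n) p).symm (φ b) ∈ V)
    (hφ0 : ∀ b ∈ B, ρ ((chartAt (Cn n) p).symm (φ b)) = 0)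
    (hφi : ∀ b ∈ B, Function.Injective (fderiv ℂ φ b))
    (he : ∀ b ∈ B, twoDel (ρ ∘ (chartAt (Cn n) p).symm) (φ b) e ≠ 0) :
    IsLeafFrame L B (fun b => (⟨(chartAt (Cn n) p).symm (φ b),
      chartVec p e ((chartAt (Cn n) p).symm (φ b))⟩ : TangentBundle 𝓘(ℂ, Cn n) X)) := by
  set χ := chartAt (Cn n) p with hχ
  have hΦ : ContMDiffOn 𝓘(ℂ, Cn (n - 1)) 𝓘(ℂ, Cn n) ω (fun b => χ.symm (φ b)) B :=
    (contMDiffOn_chart_symm (I := 𝓘(ℂ, Cn n)) (x := p)).comp hφ.contMDiffOn hφt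
  have hs : ∀ b ∈ B, χ.symm (φ b) ∈ χ.source := fun b hb => χ.map_target (hφt b hb)
  have hL : ∀ b ∈ B, χ.symm (φ b) ∈ L := fun b hb => (hρ.mem_iff _ (hφV b hb)).2 (hφ0 b hb)
  refine ⟨hB, contMDiffOn_chartVec_complex p e hΦ hB hs, hL, fun b hb => ?_, fun b hb hmem => ?_⟩
  · have h1 : MDifferentiableAt 𝓘(ℂ, Cn (n - 1)) 𝓘(ℂ, Cn n) (fun b => χ.symm (φ b)) b :=
      (hΦ.contMDiffAt (hB.mem_nhds hb)).mdifferentiableAt (by simp)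
    have h2 : MDifferentiableAt 𝓘(ℂ, Cn n) 𝓘(ℂ, Cn n) χ (χ.symm (φ b)) :=
      ((contMDiffOn_chart (I := 𝓘(ℂ, Cn n)) (n := ω)).contMDiffAt
        (χ.open_source.mem_nhds (hs b hb))).mdifferentiableAt (by simp)
    have h3 : (χ ∘ fun b => χ.symm (φ b)) =ᶠ[𝓝 b] φ := by
      filter_upwards [hB.mem_nhds hb] with y hy
      exact χ.right_inv (hφt y hy)
    have h4 := h3.mfderiv_eq (I := 𝓘(ℂ, Cn (n - 1))) (I' := 𝓘(ℂ, Cn n))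
    rw [mfderiv_comp b h2 h1, mfderiv_eq_fderiv] at h4
    intro v w hvw
    refine hφi b hb ?_
    have h5 := DFunLike.congr_fun h4 v
    have h6 := DFunLike.congr_fun h4 w
    refine h5.symm.trans (Eq.trans ?_ h6)
    exact congrArg (mfderiv 𝓘(ℂ, Cn n) 𝓘(ℂ, Cn n) χ (χ.symm (φ b))) hvw
  · have h1 := (hρ.mem_complexTangent_iff (by norm_num) (hφV b hb) (hL b hb) (hs b hb) _).1 hmem
    have h2 : chartAt (Cn n) p (χ.symm (φ b)) = φ b := χ.right_inv (hφt b hb)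
    rw [chartDeriv_chartVec (hs b hb), h2] at h1
    exact he b hb h1

/-- Leafwise positivity of the curvature, read in a chart: along the leaf through `p`, the squared
length of the frame with constant coordinates `e` is `G |2∂ρ(e)|²`. -/
theorem leviH_neg_of_isLeafwisePositive (hn : 1 ≤ n) {h : LeviNormalMetric n L}
    (hpos : h.IsLeafwisePositive) (hflat : IsLeviFlat n L)
    (hρ : IsDefiningFunction (n := n) 3 L V ρ) {R : X → ℝ} (hRρ : ∀ x ∈ V, R x = |ρ x|)
    {G : X → ℝ} (hG : ContMDiff 𝓘(ℝ, Cn n) 𝓘(ℝ, ℝ) 2 G) (hG0 : ∀ x, 0 < G x)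
    (hGh : ∀ (x : L) (u : Cn n), h.sq x u
      = G x * iddbar (n := n) (fun y => R y ^ 2) x u (almostJ (n := n) (x := (x : X)) u))
    (hpV : p ∈ V) (hpL : p ∈ L) {e u : Cn n}
    (he : twoDel (ρ ∘ (chartAt (Cn n) p).symm) (chartAt (Cn n) p p) e = 1) (hu : u ≠ 0)
    (hker : twoDel (ρ ∘ (chartAt (Cn n) p).symm) (chartAt (Cn n) p p) u = 0) :
    leviH (fun z => Real.log (G ((chartAt (Cn n) p).symm z)) + Real.log (Complex.normSq
      (twoDel (ρ ∘ (chartAt (Cn n) p).symm) z e))) (chartAt (Cn n) p p) u < 0 := by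
  have hpc : p ∈ (chartAt (Cn n) p).source := mem_chart_source _ p
  set χ := chartAt (Cn n) p with hχ
  set r := ρ ∘ χ.symm with hr
  have hrC : ContDiffAt ℝ 3 r (χ p) := hρ.contDiffAt hpV hpc
  obtain ⟨ι, hι, hιr⟩ := exists_linearMap_range_eq_ker hn (twoDelₗ r (χ p)) he
  have hιk : ∀ ζ, twoDel r (χ p) (ι ζ) = 0 := fun ζ => by
    have : ι ζ ∈ LinearMap.ker (twoDelₗ r (χ p)) := hιr ▸ LinearMap.mem_range_self ι ζ
    exact this
  obtain ⟨ζ, rfl⟩ : u ∈ LinearMap.range ι := by rw [hιr]; exact hker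
  have hζ : ζ ≠ 0 := fun h0 => hu (by rw [h0, map_zero])
  have hne : ∀ᶠ z in 𝓝 (χ p), twoDel r z e ≠ 0 := by
    have h1 : ∀ᶠ z in 𝓝 (χ p), 0 < Complex.normSq (twoDel r z e) :=
      (contDiffAt_normSq_twoDel hrC e).continuousAt.eventually_const_lt (by simp [he])
    filter_upwards [h1] with z hz hz0
    rw [hz0] at hz
    simp at hz
  have hΩ := (χ.open_target.eventually_mem (χ.map_source hpc)).and
    ((eventually_chart_symm hpc (hρ.isOpen.eventually_mem hpV)).and hne)
  have h0 : r (χ p) = 0 := by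
    simpa [hr, χ.left_inv hpc] using (hρ.mem_iff p hpV).1 hpL
  obtain ⟨B, hB, hB0, φ, hφ0, hφ, hφd, hφB⟩ := exists_leaf hrC h0 he
    (hρ.eventually_leviH_eq_zero (by norm_num) hflat hpV hpc) ι hι hιk hΩ
  have hF := isLeafFrame_chartVec (p := p) (e := e) hρ hB hφ (fun b hb => (hφB b hb).1.1)
    (fun b hb => (hφB b hb).1.2.1) (fun b hb => (hφB b hb).2.1) (fun b hb => (hφB b hb).2.2)
    (fun b hb => (hφB b hb).1.2.2)
  have h1 := hpos B _ hF 0 hB0 ζ hζ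
  rw [iddbar_almostJ_eq_leviH_self (n := n - 1)] at h1
  set F : Cn n → ℝ := fun z => Real.log (G (χ.symm z))
    + Real.log (Complex.normSq (twoDel r z e)) with hFdef
  have hFC : ContDiffAt ℝ 2 F (φ 0) := by
    rw [hφ0]
    exact (((contMDiffAt_iff_chart hpc).1 hG.contMDiffAt).log (hG0 _).ne').add
      ((contDiffAt_normSq_twoDel hrC e).log (by rw [he]; simp))
  have h2 : (fun b => Real.log (h.normSq (⟨χ.symm (φ b), chartVec p e (χ.symm (φ b))⟩ :
      TangentBundle 𝓘(ℂ, Cn n) X))) =ᶠ[𝓝 0] fun b => F (φ b) := by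
    filter_upwards [hB.mem_nhds hB0] with b hb
    obtain ⟨⟨hbt, hbV, hbe⟩, hb0, -⟩ := hφB b hb
    have hbL : χ.symm (φ b) ∈ L := (hρ.mem_iff _ hbV).2 hb0
    have hbs := χ.map_target hbt
    have h3 : h.normSq (⟨χ.symm (φ b), chartVec p e (χ.symm (φ b))⟩ :
        TangentBundle 𝓘(ℂ, Cn n) X) = h.sq ⟨_, hbL⟩ (chartVec p e (χ.symm (φ b))) := dif_pos hbL
    have h4 : chartAt (Cn n) p (χ.symm (φ b)) = φ b := χ.right_inv hbt
    rw [h3, hGh, hρ.iddbar_sq (by norm_num) hbV hbL hbs hRρ, chartDeriv_chartVec hbs, h4,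
      Real.log_mul (hG0 _).ne' (by simpa using hbe)]
  have h5 : leviH (fun b => F (φ b)) 0 ζ = leviH F (χ p) (ι ζ) := by
    rw [leviH_comp hFC ((hφ.contDiffAt (hB.mem_nhds hB0)).of_le le_top), hφd, hφ0]
  have h6 := leviH_congr h2 ζ
  rw [h5] at h6
  rw [← h6]
  have h7 : ∀ f : Cn (n - 1) → ℝ, leviH (f ∘ (chartAt (Cn (n - 1)) (0 : Cn (n - 1))).symm)
      (chartAt (Cn (n - 1)) (0 : Cn (n - 1)) 0) ζ = leviH f 0 ζ := fun f => rfl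
  rw [h7] at h1
  linarith

/-- The complex Hessian of `-log (G R²)` is bounded below near a point of the hypersurface. -/
theorem exists_eventually_le_neg_iddbar (hn : 1 ≤ n) {h : LeviNormalMetric n L}
    (hpos : h.IsLeafwisePositive) (hflat : IsLeviFlat n L) {R : X → ℝ}
    (hR : IsAbsDefiningFunction n L R)
    {G : X → ℝ} (hG : ContMDiff 𝓘(ℝ, Cn n) 𝓘(ℝ, ℝ) 2 G) (hG0 : ∀ x, 0 < G x)
    (hGh : ∀ (x : L) (u : Cn n), h.sq x u
      = G x * iddbar (n := n) (fun y => R y ^ 2) x u (almostJ (n := n) (x := (x : X)) u))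
    (hpL : p ∈ L) :
    ∃ c > 0, ∀ᶠ x in 𝓝 p, x ∉ L → ∀ u : Cn n, c * ‖chartDeriv p x u‖ ^ 2
      ≤ - iddbar (n := n) (fun y => Real.log (G y * R y ^ 2)) x u
          (almostJ (n := n) (x := x) u) := by
  obtain ⟨V, ρ, hpV, hρ, hRρ⟩ := hR p hpL
  have hpc : p ∈ (chartAt (Cn n) p).source := mem_chart_source _ p
  obtain ⟨e, he⟩ := hρ.exists_twoDel_eq_one (by norm_num) hpV hpL
  set χ := chartAt (Cn n) p with hχ
  set r := ρ ∘ χ.symm with hr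
  have hrC : ContDiffAt ℝ 3 r (χ p) := hρ.contDiffAt hpV hpc
  have h0 : r (χ p) = 0 := by
    simpa [hr, χ.left_inv hpc] using (hρ.mem_iff p hpV).1 hpL
  obtain ⟨c, hc, hce⟩ := exists_eventually_mul_norm_sq_le_neg_leviH hrC
    (((contMDiffAt_iff_chart hpc).1 hG.contMDiffAt).log (hG0 _).ne') h0 he
    (hρ.eventually_leviH_eq_zero (by norm_num) hflat hpV hpc)
    (fun u hu hker => leviH_neg_of_isLeafwisePositive hn hpos hflat hρ hRρ hG hG0 hGh hpV hpL
      he hu hker)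
  refine ⟨c / 2, half_pos hc, ?_⟩
  filter_upwards [eventually_of_chart_symm hpc hce, hρ.isOpen.eventually_mem hpV,
    χ.open_source.eventually_mem hpc] with x hx hxV hxs hxL u
  have hρx : ρ x ≠ 0 := fun h0 => hxL ((hρ.mem_iff x hxV).2 h0)
  have hrx : r (χ x) = ρ x := by simp [hr, χ.left_inv hxs]
  have h1 := hx (by rw [hrx]; exact hρx) (chartDeriv p x u)
  have h2 : (fun y => Real.log (G y * R y ^ 2)) =ᶠ[𝓝 x]
      fun y => Real.log (G y) + (Real.log (ρ y) + Real.log (ρ y)) := by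
    filter_upwards [hρ.isOpen.mem_nhds hxV,
      (hρ.contMDiffAt hxV).continuousAt.eventually_ne hρx] with y hyV hy0
    rw [hRρ y hyV, Real.log_mul (hG0 y).ne' (by simpa using hy0), Real.log_pow, Real.log_abs]
    push_cast
    ring
  have hC : ContMDiffAt 𝓘(ℝ, Cn n) 𝓘(ℝ, ℝ) 2 (fun y => Real.log (G y * R y ^ 2)) x := by
    refine ContMDiffAt.congr_of_eventuallyEq ?_ h2
    rw [contMDiffAt_iff_chart hxs]
    have h3 : ContDiffAt ℝ 2 r (χ x) := (hρ.contDiffAt hxV hxs).of_le (by norm_num)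
    have h4 := h3.log (by rw [hrx]; exact hρx)
    exact (((contMDiffAt_iff_chart hxs).1 hG.contMDiffAt).log (hG0 _).ne').add (h4.add h4)
  have h6 : (fun y => Real.log (G y * R y ^ 2)) ∘ χ.symm =ᶠ[𝓝 (χ x)] fun z =>
      Real.log ((G ∘ χ.symm) z) + (Real.log (r z) + Real.log (r z)) :=
    eventually_chart_symm (P := fun y => Real.log (G y * R y ^ 2)
      = Real.log (G y) + (Real.log (ρ y) + Real.log (ρ y))) hxs h2
  rw [iddbar_almostJ_eq_leviH hxs hC, leviH_congr h6]
  linarith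

end LocalEstimate

/-! ### Comparison of the Riemannian norms at nearby points -/

section TangentNorm

open Filter

variable {n : ℕ} {X : Type*} [TopologicalSpace X] [ChartedSpace (Cn n) X]
  [IsManifold 𝓘(ℂ, Cn n) ω X] [RiemannianBundle (fun x : X => TangentSpace 𝓘(ℝ, Cn n) x)]

/-- The Riemannian norm of a tangent vector at `x`, given by its coordinates in the preferred chart
at `x`. The model space carries a norm of its own, which this definition keeps apart. -/
def tnorm (x : X) (u : Cn n) : ℝ := ‖(show TangentSpace 𝓘(ℝ, Cn n) x from u)‖

theorem tnorm_nonneg (x : X) (u : Cn n) : 0 ≤ tnorm x u := norm_nonneg _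

theorem tnorm_smul (x : X) (c : ℝ) (u : Cn n) : tnorm x (c • u) = |c| * tnorm x u :=
  norm_smul c (show TangentSpace 𝓘(ℝ, Cn n) x from u)

theorem exists_norm_le_mul_tnorm (x : X) : ∃ C > 0, ∀ u : Cn n, ‖u‖ ≤ C * tnorm x u := by
  let i : TangentSpace 𝓘(ℝ, Cn n) x →L[ℝ] Cn n := ContinuousLinearMap.id ℝ (Cn n)
  exact ⟨‖i‖ + 1, by positivity, fun u => (i.le_opNorm u).trans (by
    exact mul_le_mul_of_nonneg_right (by linarith) (tnorm_nonneg x u))⟩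

theorem exists_tnorm_le_mul_norm (x : X) : ∃ C > 0, ∀ u : Cn n, tnorm x u ≤ C * ‖u‖ := by
  let i : Cn n →L[ℝ] TangentSpace 𝓘(ℝ, Cn n) x := ContinuousLinearMap.id ℝ (Cn n)
  exact ⟨‖i‖ + 1, by positivity, fun u => (i.le_opNorm u).trans (by
    exact mul_le_mul_of_nonneg_right (by linarith) (norm_nonneg _))⟩

variable [IsContinuousRiemannianBundle (Cn n) (fun x : X => TangentSpace 𝓘(ℝ, Cn n) x)]

/-- The Riemannian norms at nearby points agree up to a factor close to `1`, in the coordinates of a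
chart. -/
theorem eventually_tnorm_chartDeriv_le (p : X) {κ : ℝ} (hκ : 1 < κ) :
    ∀ᶠ x in 𝓝 p, ∀ u : Cn n, tnorm p (chartDeriv p x u) ≤ κ * tnorm x u := by
  have : IsManifold 𝓘(ℝ, Cn n) 1 X := .of_le (n := ω) le_top
  filter_upwards [eventually_norm_symmL_trivializationAt_self_comp_lt (Cn n)
    (fun x : X => TangentSpace 𝓘(ℝ, Cn n) x) p hκ, chart_source_mem_nhds (Cn n) p] with x hx hxs u
  have h1 := ContinuousLinearMap.le_of_opNorm_le _ hx.le (show TangentSpace 𝓘(ℝ, Cn n) x from u)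
  have h2 : (trivializationAt (Cn n) (TangentSpace 𝓘(ℝ, Cn n)) p).symmL ℝ p
      ((trivializationAt (Cn n) (TangentSpace 𝓘(ℝ, Cn n)) p).continuousLinearMapAt ℝ x u)
        = chartDeriv p x u := by
    rw [continuousLinearMapAt_real_apply hxs]
    conv_lhs => rw [← chartDeriv_self p (chartDeriv p x u)]
    exact symmL_real_apply (mem_chart_source _ p) _
  rw [ContinuousLinearMap.comp_apply] at h1
  erw [h2] at h1
  exact h1

theorem eventually_tnorm_le_chartDeriv (p : X) {κ : ℝ} (hκ : 1 < κ) :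
    ∀ᶠ x in 𝓝 p, ∀ u : Cn n, tnorm x u ≤ κ * tnorm p (chartDeriv p x u) := by
  have : IsManifold 𝓘(ℝ, Cn n) 1 X := .of_le (n := ω) le_top
  filter_upwards [eventually_norm_symmL_trivializationAt_comp_self_lt (Cn n)
    (fun x : X => TangentSpace 𝓘(ℝ, Cn n) x) p hκ, chart_source_mem_nhds (Cn n) p] with x hx hxs u
  have h1 := ContinuousLinearMap.le_of_opNorm_le _ hx.le
    (show TangentSpace 𝓘(ℝ, Cn n) p from chartDeriv p x u)
  have h2 : (trivializationAt (Cn n) (TangentSpace 𝓘(ℝ, Cn n)) p).symmL ℝ x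
      ((trivializationAt (Cn n) (TangentSpace 𝓘(ℝ, Cn n)) p).continuousLinearMapAt ℝ p
        (chartDeriv p x u)) = u := by
    rw [continuousLinearMapAt_real_apply (mem_chart_source _ p), chartDeriv_self]
    exact symmL_real_apply hxs _
  rw [ContinuousLinearMap.comp_apply] at h1
  erw [h2] at h1
  exact h1

end TangentNorm

/-! ### The distance to the hypersurface -/

section Distance

open Filter MeasureTheory Manifold
open scoped ENNReal

variable {n : ℕ} {X : Type*} [TopologicalSpace X] [ChartedSpace (Cn n) X]
  [IsManifold 𝓘(ℂ, Cn n) ω X] [RiemannianBundle (fun x : X => TangentSpace 𝓘(ℝ, Cn n) x)]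

theorem enorm_eq_ofReal_tnorm (x : X) (u : TangentSpace 𝓘(ℝ, Cn n) x) :
    ‖u‖ₑ = ENNReal.ofReal (tnorm x u) := (ofReal_norm u).symm

/-- The change of a function along a path is at most the length of the path times a bound for the
differential. -/
theorem enorm_sub_le_mul_pathELength {f : X → ℝ} {Ω : Set X} {κ : ℝ} (hΩ : IsOpen Ω)
    (hf : ContMDiffOn 𝓘(ℝ, Cn n) 𝓘(ℝ, ℝ) 1 f Ω)
    (hκ : ∀ x ∈ Ω, ∀ u : Cn n, |realDiff (n := n) f x u| ≤ κ * tnorm x u) (hκ0 : 0 ≤ κ)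
    {γ : ℝ → X} (hγ : ContMDiffOn 𝓘(ℝ, ℝ) 𝓘(ℝ, Cn n) 1 γ (Icc 0 1)) (hγΩ : ∀ t ∈ Icc 0 1, γ t ∈ Ω) :
    ‖f (γ 1) - f (γ 0)‖ₑ ≤ ENNReal.ofReal κ * pathELength 𝓘(ℝ, Cn n) γ 0 1 := by
  have hC : ContMDiffOn 𝓘(ℝ, ℝ) 𝓘(ℝ, ℝ) 1 (f ∘ γ) (Icc 0 1) := hf.comp hγ hγΩ
  calc
    ‖f (γ 1) - f (γ 0)‖ₑ ≤ ∫⁻ t in Icc 0 1, ‖derivWithin (f ∘ γ) (Icc 0 1) t‖ₑ := by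
      apply enorm_sub_le_lintegral_derivWithin_Icc_of_contDiffOn_Icc _ zero_le_one
      rwa [← contMDiffOn_iff_contDiffOn]
    _ ≤ ∫⁻ t in Icc 0 1, ENNReal.ofReal κ *
          ‖mfderivWithin 𝓘(ℝ, ℝ) 𝓘(ℝ, Cn n) γ (Icc 0 1) t 1‖ₑ := by
      apply setLIntegral_mono' measurableSet_Icc (fun t ht ↦ ?_)
      have h1 : mfderivWithin 𝓘(ℝ, ℝ) 𝓘(ℝ, ℝ) (f ∘ γ) (Icc 0 1) t =
          (mfderiv 𝓘(ℝ, Cn n) 𝓘(ℝ, ℝ) f (γ t)) ∘L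
            (mfderivWithin 𝓘(ℝ, ℝ) 𝓘(ℝ, Cn n) γ (Icc 0 1) t) := by
        apply mfderiv_comp_mfderivWithin
        · exact (hf.contMDiffAt (hΩ.mem_nhds (hγΩ t ht))).mdifferentiableAt one_ne_zero
        · exact hγ.mdifferentiableOn one_ne_zero t ht
        · rw [uniqueMDiffWithinAt_iff_uniqueDiffWithinAt]
          exact uniqueDiffOn_Icc zero_lt_one _ ht
      have h2 : derivWithin (f ∘ γ) (Icc 0 1) t = realDiff (n := n) f (γ t)
          (mfderivWithin 𝓘(ℝ, ℝ) 𝓘(ℝ, Cn n) γ (Icc 0 1) t 1) := by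
        rw [← fderivWithin_derivWithin, ← mfderivWithin_eq_fderivWithin]
        exact DFunLike.congr_fun h1 1
      rw [h2, enorm_eq_ofReal_tnorm, ← ENNReal.ofReal_mul hκ0, Real.enorm_eq_ofReal_abs]
      exact ENNReal.ofReal_le_ofReal (hκ _ (hγΩ t ht) _)
    _ = ENNReal.ofReal κ * pathELength 𝓘(ℝ, Cn n) γ 0 1 := by
      rw [lintegral_const_mul' _ _ ENNReal.ofReal_ne_top,
        pathELength_eq_lintegral_mfderivWithin_Icc]

/-- The Riemannian distance between two points joined by a segment in a chart. -/
theorem riemannianEDist_chart_symm_le {p : X} {z w : Cn n} {κ : ℝ}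
    (ht : ∀ t ∈ Icc (0 : ℝ) 1, z + t • w ∈ (chartAt (Cn n) p).target)
    (hκ : ∀ t ∈ Icc (0 : ℝ) 1, ∀ u : Cn n,
      chartDeriv p ((chartAt (Cn n) p).symm (z + t • w)) u = w →
        tnorm ((chartAt (Cn n) p).symm (z + t • w)) u ≤ κ) :
    riemannianEDist 𝓘(ℝ, Cn n) ((chartAt (Cn n) p).symm z) ((chartAt (Cn n) p).symm (z + w))
      ≤ ENNReal.ofReal κ := by
  have : IsManifold 𝓘(ℝ, Cn n) 1 X := .of_le (n := ω) le_top
  set χ := chartAt (Cn n) p with hχ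
  set η : ℝ → Cn n := fun t => z + t • w with hη
  have hηd : ∀ t, HasDerivAt η w t := fun t =>
    (((hasDerivAt_id t).smul_const w).const_add z).congr_deriv (one_smul ℝ w)
  have hηC : ContDiff ℝ 1 η := contDiff_const.add (contDiff_id.smul contDiff_const)
  have hγ : ContMDiffOn 𝓘(ℝ, ℝ) 𝓘(ℝ, Cn n) 1 (χ.symm ∘ η) (Icc 0 1) :=
    (contMDiffOn_chart_symm (I := 𝓘(ℝ, Cn n)) (x := p)).comp hηC.contMDiff.contMDiffOn ht
  refine (riemannianEDist_le_pathELength hγ (by simp [hη]) (by simp [hη]) zero_le_one).trans ?_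
  rw [pathELength_eq_lintegral_mfderivWithin_Icc]
  calc
    _ ≤ ∫⁻ t in Icc (0 : ℝ) 1, ENNReal.ofReal κ := by
      apply setLIntegral_mono' measurableSet_Icc (fun t ht' ↦ ?_)
      rw [enorm_eq_ofReal_tnorm]
      refine ENNReal.ofReal_le_ofReal (hκ t ht' _ ?_)
      -- the velocity of the path has coordinates `w` in the chart
      have hs : χ.symm (η t) ∈ χ.source := χ.map_target (ht t ht')
      have h1 : MDifferentiableWithinAt 𝓘(ℝ, ℝ) 𝓘(ℝ, Cn n) (χ.symm ∘ η) (Icc 0 1) t :=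
        hγ.mdifferentiableOn one_ne_zero t ht'
      have hu : UniqueMDiffWithinAt 𝓘(ℝ, ℝ) (Icc (0 : ℝ) 1) t := by
        rw [uniqueMDiffWithinAt_iff_uniqueDiffWithinAt]
        exact uniqueDiffOn_Icc zero_lt_one _ ht'
      have h2 : MDifferentiableAt 𝓘(ℝ, Cn n) 𝓘(ℝ, Cn n) χ ((χ.symm ∘ η) t) :=
        ((contMDiffOn_chart (I := 𝓘(ℝ, Cn n)) (n := 1)).contMDiffAt
          (χ.open_source.mem_nhds hs)).mdifferentiableAt one_ne_zero
      have h3 := mfderiv_comp_mfderivWithin t h2 h1 hu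
      have h4 : mfderivWithin 𝓘(ℝ, ℝ) 𝓘(ℝ, Cn n) (χ ∘ χ.symm ∘ η) (Icc 0 1) t
          = mfderivWithin 𝓘(ℝ, ℝ) 𝓘(ℝ, Cn n) η (Icc 0 1) t :=
        mfderivWithin_congr (fun s hs => χ.right_inv (ht s hs)) (χ.right_inv (ht t ht'))
      have h5 : mfderivWithin 𝓘(ℝ, ℝ) 𝓘(ℝ, Cn n) η (Icc 0 1) t 1 = w := by
        rw [mfderivWithin_eq_fderivWithin]
        refine (fderivWithin_derivWithin (𝕜 := ℝ) (f := η)).trans ?_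
        exact (hηd t).hasDerivWithinAt.derivWithin (uniqueDiffOn_Icc zero_lt_one _ ht')
      have h6 : ∀ u : Cn n, mfderiv 𝓘(ℝ, Cn n) 𝓘(ℝ, Cn n) χ (χ.symm (η t)) u
          = chartDeriv p (χ.symm (η t)) u := by
        intro u
        refine (DFunLike.congr_fun h2.mfderiv u).trans ?_
        rw [← tangentCoordChange_real_apply hs]
        rfl
      refine (h6 _).symm.trans ?_
      refine Eq.trans ?_ h5
      rw [← h4, h3]
      rfl
    _ = ENNReal.ofReal κ := by simp

/-- The Riemannian distance to a set, with value `⊤` at the points that no path joins to the set;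
`geodesicDist` is its real value, which is `0` at these points. -/
def riemInfEDist (n : ℕ) {X : Type*} [TopologicalSpace X] [ChartedSpace (Cn n) X]
    [RiemannianBundle (fun x : X => TangentSpace 𝓘(ℝ, Cn n) x)] (L : Set X) (x : X) : ℝ≥0∞ :=
  ⨅ y ∈ L, riemannianEDist 𝓘(ℝ, Cn n) x y

variable [IsContinuousRiemannianBundle (Cn n) (fun x : X => TangentSpace 𝓘(ℝ, Cn n) x)]
  {L V : Set X} {ρ : X → ℝ} {p : X} {k : ℕ}

/-- A defining function is at most the distance times a bound for its differential: a short path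
from a point near `p` to the hypersurface stays near `p`. -/
theorem IsDefiningFunction.eventually_le_riemInfEDist [T2Space X]
    (hρ : IsDefiningFunction (n := n) k L V ρ) (hk : 1 ≤ k) (hpV : p ∈ V) (hpL : p ∈ L) {κ : ℝ}
    (hκ0 : 0 < κ) (hκ : ∀ᶠ x in 𝓝 p, ∀ u : Cn n, |realDiff (n := n) ρ x u| ≤ κ * tnorm x u) :
    ∀ᶠ x in 𝓝 p, ENNReal.ofReal (|ρ x| / κ) ≤ riemInfEDist n L x := by
  have : IsManifold 𝓘(ℝ, Cn n) 1 X := .of_le (n := ω) le_top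
  have : LocallyCompactSpace X := ChartedSpace.locallyCompactSpace (Cn n) X
  obtain ⟨Ω, hΩ, hΩo, hpΩ⟩ := _root_.eventually_nhds_iff.1
    (hκ.and (hρ.isOpen.eventually_mem hpV))
  obtain ⟨c, hc, hcΩ⟩ := setOfPred_riemannianEDist_lt_subset_nhds 𝓘(ℝ, Cn n)
    (hΩo.mem_nhds hpΩ)
  have hc2 : (0 : ℝ≥0∞) < (c / 2 : NNReal) := by
    rw [ENNReal.coe_pos]
    exact half_pos hc
  have hρ0 : ∀ᶠ x in 𝓝 p, |ρ x| / κ < (c / 2 : NNReal) := by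
    have h1 := ((hρ.contMDiffAt hpV).continuousAt.abs.div_const κ)
    refine h1.eventually_lt_const ?_
    change |ρ p| / κ < _
    rw [(hρ.mem_iff p hpV).1 hpL, abs_zero, zero_div]
    exact_mod_cast half_pos hc
  filter_upwards [eventually_riemannianEDist_lt 𝓘(ℝ, Cn n) p hc2, hρ0] with x hx hx0
  refine le_iInf₂ fun y hy => le_of_forall_gt_imp_ge_of_dense fun s hs => ?_
  by_cases hsc : ((c / 2 : NNReal) : ℝ≥0∞) ≤ s
  · refine le_trans ?_ hsc
    rw [← ENNReal.ofReal_coe_nnreal]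
    exact ENNReal.ofReal_le_ofReal hx0.le
  · obtain ⟨γ, hγ0, hγ1, hγ, hγs⟩ := exists_lt_of_riemannianEDist_lt hs
    have hγΩ : ∀ t ∈ Icc (0 : ℝ) 1, γ t ∈ Ω := by
      intro t ht
      refine hcΩ ?_
      have h1 : riemannianEDist 𝓘(ℝ, Cn n) x (γ t) ≤ pathELength 𝓘(ℝ, Cn n) γ 0 t :=
        riemannianEDist_le_pathELength (hγ.mono (Icc_subset_Icc_right ht.2)) hγ0 rfl ht.1
      have h2 : pathELength 𝓘(ℝ, Cn n) γ 0 t ≤ pathELength 𝓘(ℝ, Cn n) γ 0 1 :=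
        pathELength_mono le_rfl ht.2
      have h3 : riemannianEDist 𝓘(ℝ, Cn n) x (γ t) < (c / 2 : NNReal) :=
        (h1.trans h2).trans_lt (hγs.trans (not_le.1 hsc))
      refine (riemannianEDist_triangle (y := x)).trans_lt ?_
      refine (ENNReal.add_lt_add hx h3).trans_eq ?_
      rw [← ENNReal.coe_add, add_halves]
    have h4 := enorm_sub_le_mul_pathELength hΩo
      ((hρ.contMDiffOn.mono fun x hx => (hΩ x hx).2).of_le (by exact_mod_cast hk))
      (fun x hx => (hΩ x hx).1) hκ0.le hγ hγΩ
    have hyV : y ∈ V := hγ1 ▸ (hΩ _ (hγΩ 1 (by simp))).2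
    rw [hγ0, hγ1, (hρ.mem_iff y hyV).1 hy, zero_sub, enorm_neg, Real.enorm_eq_ofReal_abs] at h4
    rw [ENNReal.ofReal_div_of_pos hκ0]
    exact ENNReal.div_le_of_le_mul' (h4.trans (by gcongr))

/-- Moving along a vector `v` with `dρ(v) = 1` one reaches the hypersurface after a time close
to `|ρ|`. -/
theorem IsDefiningFunction.eventually_riemInfEDist_le
    (hρ : IsDefiningFunction (n := n) k L V ρ) (hk : 1 ≤ k) (hpV : p ∈ V) (hpL : p ∈ L) {v : Cn n}
    (hv : fderiv ℝ (ρ ∘ (chartAt (Cn n) p).symm) (chartAt (Cn n) p p) v = 1) {κ : ℝ}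
    (hκ : tnorm p v < κ) :
    ∀ᶠ x in 𝓝 p, riemInfEDist n L x ≤ ENNReal.ofReal (κ * |ρ x|) := by
  have hpc : p ∈ (chartAt (Cn n) p).source := mem_chart_source _ p
  have hmem := hρ.eventually_mem_iff hpV hpc
  set χ := chartAt (Cn n) p with hχ
  set r := ρ ∘ χ.symm with hr
  have hrC : ContDiffAt ℝ 1 r (χ p) := (hρ.contDiffAt hpV hpc).of_le (by exact_mod_cast hk)
  have hrs := hrC.hasStrictFDerivAt one_ne_zero
  have h0 : r (χ p) = 0 := by
    simpa [hr, χ.left_inv hpc] using (hρ.mem_iff p hpV).1 hpL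
  have hv0 : 0 < ‖v‖ := norm_pos_iff.2 fun h => by simp [h] at hv
  obtain ⟨a, ha1, haκ⟩ : ∃ a : ℝ, 1 < a ∧ a * a * tnorm p v < κ := by
    have h1 : ContinuousAt (fun a : ℝ => a * a * tnorm p v) 1 := by fun_prop
    have h2 : ∀ᶠ a in 𝓝[>] (1 : ℝ), a * a * tnorm p v < κ :=
      (h1.eventually_lt_const (by simpa using hκ)).filter_mono nhdsWithin_le_nhds
    obtain ⟨a, h3, h4⟩ := (eventually_mem_nhdsWithin.and h2).exists
    exact ⟨a, h3, h4⟩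
  have ha0 : 0 < a := one_pos.trans ha1
  have hε : 0 < (1 - a⁻¹) / ‖v‖ := div_pos (sub_pos.2 (inv_lt_one_of_one_lt₀ ha1)) hv0
  have hstrict := (hrs.isLittleO.def hε)
  rw [nhds_prod_eq] at hstrict
  obtain ⟨S, hS, hSr⟩ := (Filter.eventually_prod_self_iff (r := fun x y : Cn n =>
    ‖r x - r y - fderiv ℝ r (χ p) (x - y)‖ ≤ (1 - a⁻¹) / ‖v‖ * ‖x - y‖)).1 hstrict
  have hgood : ∀ᶠ z in 𝓝 (χ p), (z ∈ χ.target ∧ ∀ u : Cn n,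
      tnorm (χ.symm z) u ≤ a * tnorm p (chartDeriv p (χ.symm z) u)) ∧
      (χ.symm z ∈ L ↔ r z = 0) ∧ z ∈ S :=
    ((χ.open_target.eventually_mem (χ.map_source hpc)).and
      (eventually_chart_symm hpc (eventually_tnorm_le_chartDeriv p ha1))).and (hmem.and hS)
  obtain ⟨s, hs, hball⟩ := Metric.eventually_nhds_iff_ball.1 hgood
  have hsmall : ∀ᶠ z in 𝓝 (χ p), 2 * |r z| * ‖v‖ < s / 2 := by
    have h1 : ContinuousAt (fun z => 2 * |r z| * ‖v‖) (χ p) :=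
      (hrC.continuousAt.abs.const_mul 2).mul_const _
    refine h1.eventually_lt_const ?_
    simpa [h0] using hs
  refine ((eventually_of_chart_symm hpc ((hrs.eventually_exists_zero h0 hv).and
    (hsmall.and (Metric.ball_mem_nhds (χ p) (half_pos hs))))).and
      (χ.open_source.eventually_mem hpc)).mono ?_
  rintro x ⟨⟨⟨τ, hτ, hτ0⟩, hxs, hxb⟩, hxc⟩
  change |τ| ≤ 2 * |r (χ x)| at hτ
  change r (χ x - τ • v) = 0 at hτ0
  change χ x ∈ Metric.ball (χ p) (s / 2) at hxb
  change 2 * |r (χ x)| * ‖v‖ < s / 2 at hxs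
  have hrx : r (χ x) = ρ x := by simp [hr, χ.left_inv hxc]
  have hz1 : χ x ∈ Metric.ball (χ p) s := Metric.ball_subset_ball (by linarith) hxb
  have hz2 : χ x + (-τ) • v ∈ Metric.ball (χ p) s := by
    rw [mem_ball_iff_norm] at hxb ⊢
    have h1 : ‖(-τ) • v‖ ≤ 2 * |r (χ x)| * ‖v‖ := by
      rw [norm_smul, norm_neg, Real.norm_eq_abs]
      gcongr
    calc ‖χ x + (-τ) • v - χ p‖ = ‖(χ x - χ p) + (-τ) • v‖ := by congr 1; abel
      _ ≤ ‖χ x - χ p‖ + ‖(-τ) • v‖ := norm_add_le _ _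
      _ < s := by linarith
  -- the time needed is at most `a |ρ x|`
  have hτa : |τ| ≤ a * |ρ x| := by
    have h1 := hSr (χ x) (hball _ hz1).2.2 (χ x + (-τ) • v) (hball _ hz2).2.2
    have h2 : χ x + (-τ) • v = χ x - τ • v := by rw [neg_smul, sub_eq_add_neg]
    simp only [h2, hτ0, sub_zero, sub_sub_cancel, map_smul, hv, smul_eq_mul, mul_one] at h1
    rw [norm_smul, hrx, Real.norm_eq_abs, Real.norm_eq_abs, mul_comm |τ|, ← mul_assoc,
      div_mul_cancel₀ _ hv0.ne'] at h1
    have h3 : |τ| - |ρ x| ≤ (1 - a⁻¹) * |τ| :=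
      ((abs_sub_abs_le_abs_sub _ _).trans_eq (abs_sub_comm _ _)).trans h1
    have h4 : a⁻¹ * |τ| ≤ |ρ x| := by linarith
    rwa [inv_mul_le_iff₀ ha0] at h4
  have hseg : ∀ t ∈ Icc (0 : ℝ) 1, χ x + t • ((-τ) • v) ∈ Metric.ball (χ p) s := fun t ht => by
    have := (convex_ball (χ p) s).add_smul_mem hz1 hz2 ht
    exact this
  have h5 := riemannianEDist_chart_symm_le (p := p) (z := χ x) (w := (-τ) • v)
    (κ := a * (|τ| * tnorm p v)) (fun t ht => (hball _ (hseg t ht)).1.1) (fun t ht u hu => by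
      have h6 := (hball _ (hseg t ht)).1.2 u
      change chartDeriv p (χ.symm (χ x + t • ((-τ) • v))) u = _ at hu
      rw [hu, tnorm_smul, abs_neg] at h6
      exact h6)
  have h7 : χ.symm (χ x + (-τ) • v) ∈ L := (hball _ hz2).2.1.2 (by
    rw [neg_smul, ← sub_eq_add_neg]; exact hτ0)
  refine (iInf₂_le _ h7).trans ?_
  change riemannianEDist 𝓘(ℝ, Cn n) (χ.symm (χ x)) _ ≤ _ at h5
  rw [χ.left_inv hxc] at h5
  refine h5.trans (ENNReal.ofReal_le_ofReal ?_)
  have := tnorm_nonneg p v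
  calc a * (|τ| * tnorm p v) ≤ a * (a * |ρ x| * tnorm p v) := by gcongr
    _ = a * a * tnorm p v * |ρ x| := by ring
    _ ≤ κ * |ρ x| := by gcongr

/-- The differential of a defining function near `p`, measured by the Riemannian metric. -/
theorem IsDefiningFunction.eventually_realDiff_le (hρ : IsDefiningFunction (n := n) k L V ρ)
    (hk : 1 ≤ k) (hpV : p ∈ V) {ℓ κ : ℝ} (hℓ : ∀ u : Cn n, |fderiv ℝ (ρ ∘ (chartAt (Cn n) p).symm)
      (chartAt (Cn n) p p) u| ≤ ℓ * tnorm p u) (hℓ0 : 0 ≤ ℓ) (hκ : ℓ < κ) :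
    ∀ᶠ x in 𝓝 p, ∀ u : Cn n, |realDiff (n := n) ρ x u| ≤ κ * tnorm x u := by
  have hpc : p ∈ (chartAt (Cn n) p).source := mem_chart_source _ p
  obtain ⟨κ', hκ1, hκ2⟩ := exists_between hκ
  have hκ0 : 0 < κ' := hℓ0.trans_lt hκ1
  obtain ⟨C, hC, hCp⟩ := exists_norm_le_mul_tnorm (n := n) p
  set r := ρ ∘ (chartAt (Cn n) p).symm with hr
  have hrC : ContinuousAt (fderiv ℝ r) (chartAt (Cn n) p p) :=
    (((hρ.contDiffAt hpV hpc).of_le (m := 1) (by exact_mod_cast hk)).fderiv_right (m := 0)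
      (by simp)).continuousAt
  have h1 : ∀ᶠ z in 𝓝 (chartAt (Cn n) p p),
      ‖fderiv ℝ r z - fderiv ℝ r (chartAt (Cn n) p p)‖ < (κ' - ℓ) / C := by
    have := (hrC.sub_const (fderiv ℝ r (chartAt (Cn n) p p))).norm
    refine this.eventually_lt_const ?_
    simpa using div_pos (sub_pos.2 hκ1) hC
  filter_upwards [eventually_of_chart_symm hpc h1, hρ.isOpen.eventually_mem hpV,
    (chartAt (Cn n) p).open_source.eventually_mem hpc,
    eventually_tnorm_chartDeriv_le (n := n) p ((one_lt_div hκ0).2 hκ2)] with x hx hxV hxs hxt u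
  rw [realDiff_eq_fderiv hxs ((hρ.contMDiffAt hxV).of_le (by exact_mod_cast hk))]
  set w := chartDeriv p x u
  have h2 : |fderiv ℝ r (chartAt (Cn n) p x) w - fderiv ℝ r (chartAt (Cn n) p p) w|
      ≤ (κ' - ℓ) * tnorm p w := by
    have h3 := (fderiv ℝ r (chartAt (Cn n) p x)
      - fderiv ℝ r (chartAt (Cn n) p p)).le_of_opNorm_le hx.le w
    calc _ ≤ (κ' - ℓ) / C * ‖w‖ := h3
      _ ≤ (κ' - ℓ) / C * (C * tnorm p w) := by
        have := (div_pos (sub_pos.2 hκ1) hC).le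
        gcongr
        exact hCp w
      _ = (κ' - ℓ) * tnorm p w := by field_simp
  calc |fderiv ℝ r (chartAt (Cn n) p x) w|
      ≤ |fderiv ℝ r (chartAt (Cn n) p p) w|
        + |fderiv ℝ r (chartAt (Cn n) p x) w - fderiv ℝ r (chartAt (Cn n) p p) w| := by
        have := abs_sub_abs_le_abs_sub (fderiv ℝ r (chartAt (Cn n) p x) w)
          (fderiv ℝ r (chartAt (Cn n) p p) w)
        linarith
    _ ≤ κ' * tnorm p w := by linarith [hℓ w]
    _ ≤ κ' * (κ / κ' * tnorm x u) := by
        gcongr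
        exact hxt u
    _ = κ * tnorm x u := by field_simp

/-- Near a point `p` of the hypersurface, the absolute value of a defining function is asymptotic
to a multiple of the distance, the factor being the norm of the differential at `p`. -/
theorem IsAbsDefiningFunction.tendsto_div_geodesicDist [T2Space X] {R : X → ℝ}
    (hR : IsAbsDefiningFunction n L R) (hpL : p ∈ L) :
    (∀ᶠ x in 𝓝 p, riemInfEDist n L x ≠ ⊤) ∧ (∀ᶠ x in 𝓝 p, x ∉ L → 0 < geodesicDist n L x) ∧
      ∃ ℓ : ℝ, 0 < ℓ ∧ Tendsto (fun x => R x / geodesicDist n L x) (𝓝[Lᶜ] p) (𝓝 ℓ) := by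
  obtain ⟨V, ρ, hpV, hρ, hRρ⟩ := hR p hpL
  have hpc : p ∈ (chartAt (Cn n) p).source := mem_chart_source _ p
  have hd0 := hρ.fderiv_ne_zero (by norm_num) hpV hpL hpc
  set d : TangentSpace 𝓘(ℝ, Cn n) p →L[ℝ] ℝ :=
    fderiv ℝ (ρ ∘ (chartAt (Cn n) p).symm) (chartAt (Cn n) p p) with hd
  have hℓ : 0 < ‖d‖ := by
    refine lt_of_le_of_ne d.opNorm_nonneg fun h => hd0 (ContinuousLinearMap.ext fun u => ?_)
    have h1 := d.le_opNorm u
    rw [← h, zero_mul] at h1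
    exact norm_le_zero_iff.1 h1
  have hA : ∀ κ, ‖d‖ < κ → ∀ᶠ x in 𝓝 p, ENNReal.ofReal (|ρ x| / κ) ≤ riemInfEDist n L x :=
    fun κ hκ => hρ.eventually_le_riemInfEDist (by norm_num) hpV hpL (hℓ.trans hκ)
      (hρ.eventually_realDiff_le (by norm_num) hpV (ℓ := ‖d‖) (fun u => d.le_opNorm u) hℓ.le hκ)
  have hB : ∀ κ, 0 < κ → κ < ‖d‖ →
      ∀ᶠ x in 𝓝 p, riemInfEDist n L x ≤ ENNReal.ofReal (κ⁻¹ * |ρ x|) := by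
    intro κ hκ0 hκ
    obtain ⟨w, hw1, hw⟩ := d.exists_lt_apply_of_lt_opNorm hκ
    have hw0 : d w ≠ 0 := fun h => by rw [h, norm_zero] at hw; exact hκ0.not_gt hw
    refine hρ.eventually_riemInfEDist_le (by norm_num) hpV hpL
      (v := (d w)⁻¹ • (show Cn n from w)) ?_ ?_
    · change d ((d w)⁻¹ • w) = 1
      rw [map_smul, smul_eq_mul, inv_mul_cancel₀ hw0]
    · rw [tnorm_smul, abs_inv]
      have h1 : tnorm p (show Cn n from w) < 1 := hw1
      have h2 : |d w|⁻¹ < κ⁻¹ := inv_strictAnti₀ hκ0 hw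
      have h3 : 0 < |d w|⁻¹ := inv_pos.2 (abs_pos.2 hw0)
      nlinarith [tnorm_nonneg p (show Cn n from w)]
  have hfin : ∀ᶠ x in 𝓝 p, riemInfEDist n L x ≠ ⊤ :=
    (hB (‖d‖ / 2) (half_pos hℓ) (half_lt_self hℓ)).mono fun x hx =>
      (hx.trans_lt ENNReal.ofReal_lt_top).ne
  have hA' : ∀ κ, ‖d‖ < κ → ∀ᶠ x in 𝓝 p, |ρ x| / κ ≤ geodesicDist n L x := by
    intro κ hκ
    filter_upwards [hA κ hκ, hfin] with x hx hx'
    exact (ENNReal.ofReal_le_iff_le_toReal hx').1 hx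
  have hB' : ∀ κ, 0 < κ → κ < ‖d‖ → ∀ᶠ x in 𝓝 p, geodesicDist n L x ≤ κ⁻¹ * |ρ x| := by
    intro κ hκ0 hκ
    filter_upwards [hB κ hκ0 hκ] with x hx
    exact ENNReal.toReal_le_of_le_ofReal (by positivity) hx
  have hρ0 : ∀ᶠ x in 𝓝 p, R x = |ρ x| ∧ (x ∉ L → 0 < |ρ x|) := by
    filter_upwards [hρ.isOpen.mem_nhds hpV] with x hx
    exact ⟨hRρ x hx, fun hxL => abs_pos.2 fun h => hxL ((hρ.mem_iff x hx).2 h)⟩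
  have hpos : ∀ᶠ x in 𝓝 p, x ∉ L → 0 < geodesicDist n L x := by
    filter_upwards [hA' (‖d‖ + 1) (lt_add_one _), hρ0] with x h1 h2 hxL
    exact (div_pos (h2.2 hxL) (by positivity)).trans_le h1
  refine ⟨hfin, hpos, ‖d‖, hℓ, tendsto_order.2 ⟨fun a ha => ?_, fun b hb => ?_⟩⟩
  · obtain ⟨κ, hκ1, hκ2⟩ := exists_between (max_lt ha hℓ)
    have hκ0 := (le_max_right _ _).trans_lt hκ1
    filter_upwards [(hB' κ hκ0 hκ2).filter_mono nhdsWithin_le_nhds,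
      hpos.filter_mono nhdsWithin_le_nhds, hρ0.filter_mono nhdsWithin_le_nhds,
      self_mem_nhdsWithin] with x h1 h2 h3 hxL
    refine ((le_max_left _ _).trans_lt hκ1).trans_le ?_
    rw [le_div_iff₀ (h2 hxL), h3.1]
    rwa [le_inv_mul_iff₀ hκ0] at h1
  · obtain ⟨κ, hκ1, hκ2⟩ := exists_between hb
    have hκ0 := hℓ.trans hκ1
    filter_upwards [(hA' κ hκ1).filter_mono nhdsWithin_le_nhds,
      hpos.filter_mono nhdsWithin_le_nhds, hρ0.filter_mono nhdsWithin_le_nhds,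
      self_mem_nhdsWithin] with x h1 h2 h3 hxL
    refine lt_of_le_of_lt ?_ hκ2
    rw [div_le_iff₀ (h2 hxL), h3.1]
    rwa [div_le_iff₀ hκ0, mul_comm] at h1

/-- The distance to `L` is continuous where it is finite. -/
theorem continuousAt_geodesicDist [T2Space X] {x : X} (hx : riemInfEDist n L x ≠ ⊤) :
    ContinuousAt (geodesicDist n L) x := by
  have : IsManifold 𝓘(ℝ, Cn n) 1 X := .of_le (n := ω) le_top
  have : LocallyCompactSpace X := ChartedSpace.locallyCompactSpace (Cn n) X
  let : PseudoEMetricSpace X := PseudoEMetricSpace.ofRiemannianMetric 𝓘(ℝ, Cn n) X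
  have h1 : Continuous (riemInfEDist n L) := Metric.continuous_infEDist (s := L)
  exact (ENNReal.continuousAt_toReal hx).comp h1.continuousAt

end Distance

/-! ### Conclusion -/

section Conclusion

open Filter

variable {n : ℕ} {X : Type*} [TopologicalSpace X] [ChartedSpace (Cn n) X]
  [IsManifold 𝓘(ℂ, Cn n) ω X] {L V : Set X} {ρ : X → ℝ} {p : X}

/-- A hypersurface has no interior. -/
theorem IsRealHypersurface.subset_closure_compl {k : ℕ} (hk : 1 ≤ k)
    (hL : IsRealHypersurface n k L) : L ⊆ closure Lᶜ := by
  intro p hp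
  obtain ⟨V, ρ, hpV, hρ⟩ := hL p hp
  have hpc : p ∈ (chartAt (Cn n) p).source := mem_chart_source _ p
  rw [closure_compl, mem_compl_iff, mem_interior_iff_mem_nhds]
  intro hmem
  refine hρ.fderiv_ne_zero hk hpV hp hpc ?_
  have h1 : ∀ᶠ x in 𝓝 p, ρ x = 0 := by
    filter_upwards [hmem, hρ.isOpen.mem_nhds hpV] with x hx hxV
    exact (hρ.mem_iff x hxV).1 hx
  have h2 : ρ ∘ (chartAt (Cn n) p).symm =ᶠ[𝓝 (chartAt (Cn n) p p)] fun _ => (0 : ℝ) :=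
    eventually_chart_symm hpc h1
  rw [h2.fderiv_eq]
  simp

theorem geodesicDist_eq_zero [RiemannianBundle (fun x : X => TangentSpace 𝓘(ℝ, Cn n) x)]
    {x : X} (hx : x ∈ L) : geodesicDist n L x = 0 := by
  have h1 : riemInfEDist n L x ≤ 0 := (iInf₂_le x hx).trans_eq Manifold.riemannianEDist_self
  have h2 : riemInfEDist n L x = 0 := le_antisymm h1 bot_le
  change (riemInfEDist n L x).toReal = 0
  rw [h2, ENNReal.toReal_zero]

theorem fundamentalForm_almostJ [RiemannianBundle (fun x : X => TangentSpace 𝓘(ℝ, Cn n) x)]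
    (hJ : IsHermitianMetric n X) (x : X) (u : TangentSpace 𝓘(ℝ, Cn n) x) :
    fundamentalForm x u (almostJ u) = tnorm x u ^ 2 :=
  (hJ x u u).trans (real_inner_self_eq_norm_sq u)

/-- A property that depends on a constant, and holds near each point of a compact set for some
positive constant, holds on a neighborhood of the set with one constant. -/
theorem exists_isOpen_forall_of_isCompact {Y : Type*} [TopologicalSpace Y] {K : Set Y}
    (hK : IsCompact K) {P : ℝ → Y → Prop} (hP : ∀ c' c x, c' ≤ c → P c x → P c' x)
    (h : ∀ p ∈ K, ∃ c, 0 < c ∧ ∀ᶠ x in 𝓝 p, P c x) :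
    ∃ U, IsOpen U ∧ K ⊆ U ∧ ∃ c, 0 < c ∧ ∀ x ∈ U, P c x := by
  refine hK.induction_on ⟨∅, isOpen_empty, subset_rfl, 1, one_pos, fun x hx => hx.elim⟩
    (fun s t hst ⟨U, hU, htU, hc⟩ => ⟨U, hU, hst.trans htU, hc⟩) ?_ ?_
  · rintro s t ⟨U, hUo, hsU, c, hc, hU⟩ ⟨U', hUo', htU', c', hc', hU'⟩
    refine ⟨U ∪ U', hUo.union hUo', union_subset_union hsU htU', min c c', lt_min hc hc', ?_⟩
    rintro x (hx | hx)
    · exact hP _ _ x (min_le_left _ _) (hU x hx)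
    · exact hP _ _ x (min_le_right _ _) (hU' x hx)
  · intro p hp
    obtain ⟨c, hc, hce⟩ := h p hp
    obtain ⟨W, hW, hWo, hpW⟩ := _root_.eventually_nhds_iff.1 hce
    exact ⟨W, mem_nhdsWithin_of_mem_nhds (hWo.mem_nhds hpW), W, hWo, subset_rfl, c, hc, hW⟩

end Conclusion

end

theorem mainTheorem2 {n : ℕ} (hn : 2 ≤ n)
    {X : Type*} [TopologicalSpace X] [T2Space X] [SecondCountableTopology X]
    [ChartedSpace (Cn n) X] [IsManifold 𝓘(ℂ, Cn n) ω X]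
    [RiemannianBundle (fun x : X => TangentSpace 𝓘(ℝ, Cn n) x)]
    [IsContMDiffRiemannianBundle 𝓘(ℝ, Cn n) ∞ (Cn n) (fun x : X => TangentSpace 𝓘(ℝ, Cn n) x)]
    (hJ : IsHermitianMetric n X)
    (L : Set X) (hLc : IsCompact L) (hL : IsRealHypersurface n 3 L) (hflat : IsLeviFlat n L)
    (hN : ∃ h : LeviNormalMetric n L, h.IsLeafwisePositive) :
    ∃ (U : Set X) (c : ℝ) (v : X → ℝ), IsOpen U ∧ L ⊆ U ∧ 0 < c ∧
      ContMDiffOn 𝓘(ℝ, Cn n) 𝓘(ℝ, ℝ) 2 v U ∧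
      (∀ x ∈ L, v x = 0) ∧ (∀ x ∈ U \ L, 0 < v x) ∧
      (∀ x ∈ U \ L, ∀ u : TangentSpace 𝓘(ℝ, Cn n) x,
        c * fundamentalForm x u (almostJ u) ≤
          - iddbar (fun y => Real.log (v y)) x u (almostJ u)) ∧
      ∃ g : X → ℝ, ContinuousOn g U ∧
        ∀ x ∈ U, g x ≠ 0 ∧ v x = g x * geodesicDist n L x ^ 2 := by
  obtain ⟨h, hpos⟩ := hN
  have : IsContinuousRiemannianBundle (Cn n) (fun x : X => TangentSpace 𝓘(ℝ, Cn n) x) := by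
    obtain ⟨b, hb, hb'⟩ := IsContMDiffRiemannianBundle.exists_contMDiff (IB := 𝓘(ℝ, Cn n)) (n := ∞)
      (F := Cn n) (E := fun x : X => TangentSpace 𝓘(ℝ, Cn n) x)
    exact ⟨b, hb.continuous, hb'⟩
  obtain ⟨R, hR⟩ := exists_isAbsDefiningFunction hLc.isClosed hL
  obtain ⟨G, hG, hG0, hGh⟩ := h.exists_factor hLc.isClosed hR
  set v : X → ℝ := fun x => G x * R x ^ 2 with hv
  -- the properties of `v` that hold near each point of `L`, with a constant depending on the point
  obtain ⟨U, hUo, hLU, c, hc, hU⟩ : ∃ U : Set X, IsOpen U ∧ L ⊆ U ∧ ∃ c : ℝ, 0 < c ∧ ∀ x ∈ U,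
      (ContMDiffAt 𝓘(ℝ, Cn n) 𝓘(ℝ, ℝ) 2 v x ∧ riemInfEDist n L x ≠ ⊤ ∧
        (x ∉ L → 0 < v x ∧ 0 < geodesicDist n L x)) ∧
      (x ∉ L → ∀ u : Cn n, c * tnorm x u ^ 2 ≤
        - iddbar (n := n) (fun y => Real.log (v y)) x u (almostJ (n := n) (x := x) u)) := by
    refine exists_isOpen_forall_of_isCompact hLc (fun c' c x hcc hx => ⟨hx.1, fun hxL u =>
      le_trans (by gcongr) (hx.2 hxL u)⟩) fun p hp => ?_
    obtain ⟨c, hc, hce⟩ := exists_eventually_le_neg_iddbar (by omega) hpos hflat hR hG hG0 hGh hp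
    obtain ⟨hfin, hδ, -⟩ := hR.tendsto_div_geodesicDist hp
    obtain ⟨V, ρ, hpV, hρ, hRρ⟩ := hR p hp
    obtain ⟨C, hC, hCp⟩ := exists_tnorm_le_mul_norm (n := n) p
    refine ⟨c / (2 * C) ^ 2, by positivity, ?_⟩
    filter_upwards [hce, hfin, hδ, hρ.isOpen.eventually_mem hpV,
      eventually_tnorm_le_chartDeriv (n := n) p one_lt_two] with x hx1 hx2 hx3 hx4 hx5
    refine ⟨⟨?_, hx2, fun hxL => ⟨?_, hx3 hxL⟩⟩, fun hxL u => le_trans ?_ (hx1 hxL u)⟩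
    · refine (hG.contMDiffAt.mul (((hρ.contMDiffAt hx4).of_le (m := 2)
        (by norm_num)).pow 2)).congr_of_eventuallyEq ?_
      filter_upwards [hρ.isOpen.mem_nhds hx4] with y hy
      simp [hv, hRρ y hy]
    · have h1 : ρ x ≠ 0 := fun h0 => hxL ((hρ.mem_iff x hx4).2 h0)
      have h2 := hG0 x
      simp only [hv, hRρ x hx4]
      positivity
    · have h1 : tnorm x u ≤ 2 * C * ‖chartDeriv p x u‖ := by
        linarith [hx5 u, hCp (chartDeriv p x u)]
      have h2 : tnorm x u ^ 2 ≤ (2 * C * ‖chartDeriv p x u‖) ^ 2 :=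
        pow_le_pow_left₀ (tnorm_nonneg x u) h1 2
      calc c / (2 * C) ^ 2 * tnorm x u ^ 2
          ≤ c / (2 * C) ^ 2 * (2 * C * ‖chartDeriv p x u‖) ^ 2 := by gcongr
        _ = c * ‖chartDeriv p x u‖ ^ 2 := by field_simp
  have hvL : ∀ x ∈ L, v x = 0 := by
    intro x hx
    obtain ⟨V, ρ, hxV, hρ, hRρ⟩ := hR x hx
    simp [hv, hRρ x hxV, (hρ.mem_iff x hxV).1 hx]
  refine ⟨U, c, v, hUo, hLU, hc, fun x hx => (hU x hx).1.1.contMDiffWithinAt, hvL,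
    fun x hx => ((hU x hx.1).1.2.2 hx.2).1, fun x hx u => ?_, ?_⟩
  · rw [fundamentalForm_almostJ hJ]
    exact (hU x hx.1).2 hx.2 u
  -- `g` is `v / δ²` off `L`, extended by its nonzero limits at the points of `L`
  have hcl : U ⊆ closure (U \ L) := by
    intro x hx
    by_cases hxL : x ∈ L
    · exact hUo.inter_closure ⟨hx, hL.subset_closure_compl (by norm_num) hxL⟩
    · exact subset_closure ⟨hx, hxL⟩
  set f : X → ℝ := fun x => v x / geodesicDist n L x ^ 2 with hf
  have hlimU : ∀ x ∈ U, x ∉ L → Filter.Tendsto f (𝓝[U \ L] x) (𝓝 (f x)) := by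
    intro x hx hxL
    obtain ⟨hvx, hδx, hpx⟩ := (hU x hx).1
    exact ((hvx.continuousAt.div ((continuousAt_geodesicDist hδx).pow 2)
      (pow_ne_zero 2 (hpx hxL).2.ne')).mono_left nhdsWithin_le_nhds)
  have hlimL : ∀ x ∈ L, ∃ y, y ≠ 0 ∧ Filter.Tendsto f (𝓝[U \ L] x) (𝓝 y) := by
    intro x hxL
    obtain ⟨-, -, ℓ, hℓ, hlim⟩ := hR.tendsto_div_geodesicDist hxL
    refine ⟨G x * ℓ ^ 2, mul_ne_zero (hG0 x).ne' (pow_ne_zero 2 hℓ.ne'), ?_⟩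
    have h1 := ((hG.continuous.continuousAt (x := x)).mono_left
      (nhdsWithin_le_nhds (s := Lᶜ))).mul (hlim.pow 2)
    refine (h1.mono_left (nhdsWithin_mono x fun y hy => hy.2)).congr fun y => ?_
    simp only [hf, hv, div_pow, mul_div_assoc]
  refine ⟨extendFrom (U \ L) f, continuousOn_extendFrom hcl fun x hx => ?_, fun x hx => ?_⟩
  · by_cases hxL : x ∈ L
    · obtain ⟨y, -, hy⟩ := hlimL x hxL
      exact ⟨y, hy⟩
    · exact ⟨_, hlimU x hx hxL⟩
  · by_cases hxL : x ∈ L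
    · obtain ⟨y, hy0, hy⟩ := hlimL x hxL
      rw [extendFrom_eq (hcl hx) hy, hvL x hxL, geodesicDist_eq_zero hxL]
      exact ⟨hy0, by simp⟩
    · obtain ⟨hv0, hδ0⟩ := (hU x hx).1.2.2 hxL
      rw [extendFrom_eq (hcl hx) (hlimU x hx hxL)]
      exact ⟨(div_pos hv0 (pow_pos hδ0 2)).ne', (div_mul_cancel₀ _ (pow_pos hδ0 2).ne').symm⟩
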